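/- **The $(L,\{U_u\},\text{soft-}\emptyset,p)$-Supplier problem.** An instance consists of a finite set $\mathcal C$ of clients and a finite set $\mathcal F$ of facilities (which may overlap), integers $p, L\ge 0$, an integer upper bound $U_u\ge L$ for every facility $u\in\mathcal F$, and a symmetric function $d:(\mathcal C\cup\mathcal F)\times(\mathcal C\cup\mathcal F)\to\mathbb R_{\ge 0}$ that satisfies the triangle inequality. A feasible solution consists of a set $C\subseteq\mathcal C$ with $|C|\ge p$, a finite family $F=(u_1,\dots,u_a)$ of open centers $u_j\in\mathcal F$, where $a\geq 0$ is arbitrary and the same facility may occur several times, and an assignment $\phi:C\to\{1,\dots,a\}$ such that $L\le|\phi^{-1}(j)|\le U_{u_j}$ for every $j\in\{1,\dots,a\}$. Its value is the maximum cluster radius $\max_{v\in C}d(v,u_{\phi(v)})$ (which is $0$ if $C=\emptyset$), to be minimized; $\mathrm{OPT}$ is the minimum value of a feasible solution. **Theorem.** There is a polynomial-time $11$-approximation algorithm for the $(L,\{U_u\},\text{soft-}\emptyset,p)$-Supplier problem: there are an algorithm and a polynomial $P$ such that, on every instance, the algorithm halts after at most $P(|\mathcal C\cup\mathcal F|)$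 steps, and, on every instance that has a feasible solution, it outputs a feasible solution of value at most $11\cdot\mathrm{OPT}$. Here an algorithm is a program for a random access machine with natural-number registers and arrays, whose unit-cost operations are reading, writing, addition, truncated subtraction and comparison of natural numbers, and comparison of two of the given real distances. -/

import Mathlib

open scoped NNReal

namespace SoftSupplier

/-! ### The optimization problem -/

/-- An instance with uniform lower bound `L` and upper bounds `U u`. The set `𝒞 ∪ ℱ` of points is
numbered `0, …, n - 1`; a point may be a client, a facility, or both. -/
structure Instance where
  /-- number of points -/
  n : ℕ
  /-- the set `𝒞` of clients -/
  clients : Finset (Fin n)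
  /-- the set `ℱ` of facilities -/
  facilities : Finset (Fin n)
  cover : clients ∪ facilities = Finset.univ
  /-- number of clients that have to be served -/
  p : ℕ
  /-- capacity lower bound -/
  L : ℕ
  /-- capacity upper bounds (meaningful on facilities only) -/
  U : Fin n → ℕ
  L_le_U : ∀ u ∈ facilities, L ≤ U u
  /-- the distance function -/
  d : Fin n → Fin n → ℝ≥0
  d_comm : ∀ x y, d x y = d y x
  d_triangle : ∀ x y z, d x z ≤ d x y + d y z

/-- A candidate solution for soft capacities and no constraint on the number of centers:
a set of served clients, a finite family of open centers, in which the same facility may occur any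
number of times, and an assignment of every served client to one of the open centers. -/
structure Solution (I : Instance) where
  served : Finset (Fin I.n)
  /-- number of open centers, counted with multiplicity -/
  copies : ℕ
  /-- the location of each open center -/
  center : Fin copies → Fin I.n
  assign : {v // v ∈ served} → Fin copies

namespace Solution

variable {I : Instance}

/-- The number of clients assigned to the open center `j`. -/
def load (S : Solution I) (j : Fin S.copies) : ℕ :=
  (Finset.univ.filter fun v => S.assign v = j).card

/-- Feasibility. The capacity interval applies to every open center (every copy) separately. -/
structure IsFeasible (S : Solution I) : Prop where
  served_subset : S.served ⊆ I.clients
  p_le : I.p ≤ S.served.card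
  center_mem : ∀ j, S.center j ∈ I.facilities
  lower : ∀ j, I.L ≤ S.load j
  upper : ∀ j, S.load j ≤ I.U (S.center j)

/-- The maximum cluster radius (`0` if no client is served). -/
noncomputable def radius (S : Solution I) : ℝ≥0 :=
  Finset.univ.sup fun v : {v // v ∈ S.served} => I.d v (S.center (S.assign v))

end Solution

/-- The instance has a feasible solution. -/
def Instance.Solvable (I : Instance) : Prop := ∃ S : Solution I, S.IsFeasible

/-- The optimal value: the least maximum cluster radius of a feasible solution.
(Used for solvable instances only; the radii are then a nonempty finite set.) -/
noncomputable def Instance.opt (I : Instance) : ℝ≥0 :=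
  sInf {r | ∃ S : Solution I, S.IsFeasible ∧ S.radius = r}

/-! ### The machine model

A random access machine, programmed by structured (while) programs. It has finitely many natural
number registers and finitely many arrays of natural numbers (those named in the program), and a
read-only table of real distances, whose entries it can only compare with one another. There is no
multiplication, so that the bit length of the numbers grows only linearly in the number of
steps (up to an additive term for the input) and charging one unit per operation is justified. -/

/-- The contents of the registers and of the arrays. -/
structure State where
  var : ℕ → ℕ
  arr : ℕ → ℕ → ℕ

/-- Expressions; a test counts as true if its value is not `0`. -/
inductive Expr where
  /-- a constant -/
  | const (k : ℕ)
  /-- the content of register `x` -/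
  | var (x : ℕ)
  /-- the entry with index `i` of array `a` -/
  | get (a : ℕ) (i : Expr)
  | add (e₁ e₂ : Expr)
  /-- truncated subtraction -/
  | sub (e₁ e₂ : Expr)
  /-- `1` if `e₁ ≤ e₂`, and `0` otherwise -/
  | le (e₁ e₂ : Expr)
  /-- `1` if `d(e₁, e₂) ≤ d(e₃, e₄)`, and `0` otherwise -/
  | distLe (e₁ e₂ e₃ e₄ : Expr)

namespace Expr

/-- The value of an expression, where `D` is the distance table. -/
noncomputable def eval (D : ℕ → ℕ → ℝ≥0) (s : State) : Expr → ℕ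
  | const k => k
  | var x => s.var x
  | get a i => s.arr a (i.eval D s)
  | add e₁ e₂ => e₁.eval D s + e₂.eval D s
  | sub e₁ e₂ => e₁.eval D s - e₂.eval D s
  | le e₁ e₂ => if e₁.eval D s ≤ e₂.eval D s then 1 else 0
  | distLe e₁ e₂ e₃ e₄ =>
      if D (e₁.eval D s) (e₂.eval D s) ≤ D (e₃.eval D s) (e₄.eval D s) then 1 else 0

/-- The number of operations performed in evaluating an expression. -/
def cost : Expr → ℕ
  | const _ => 1
  | var _ => 1
  | get _ i => i.cost + 1
  | add e₁ e₂ => e₁.cost + e₂.cost + 1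
  | sub e₁ e₂ => e₁.cost + e₂.cost + 1
  | le e₁ e₂ => e₁.cost + e₂.cost + 1
  | distLe e₁ e₂ e₃ e₄ => e₁.cost + e₂.cost + e₃.cost + e₄.cost + 1

end Expr

/-- Programs. -/
inductive Prog where
  | skip
  /-- write `e` into register `x` -/
  | assign (x : ℕ) (e : Expr)
  /-- write `e` into array `a` at index `i` -/
  | store (a : ℕ) (i e : Expr)
  | seq (c₁ c₂ : Prog)
  /-- run `c₁` if the test `e` is true, and `c₂` otherwise -/
  | cond (e : Expr) (c₁ c₂ : Prog)
  /-- repeat `c` as long as the test `e` is true -/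
  | loop (e : Expr) (c : Prog)

/-- `Exec D c s t s'`: started in state `s`, with distance table `D`, the program `c` halts after
exactly `t` steps in state `s'`. -/
inductive Exec (D : ℕ → ℕ → ℝ≥0) : Prog → State → ℕ → State → Prop where
  | skip (s : State) : Exec D .skip s 1 s
  | assign (s : State) (x : ℕ) (e : Expr) :
      Exec D (.assign x e) s (e.cost + 1)
        ⟨Function.update s.var x (e.eval D s), s.arr⟩
  | store (s : State) (a : ℕ) (i e : Expr) :
      Exec D (.store a i e) s (i.cost + e.cost + 1)
        ⟨s.var, Function.update s.arr a
          (Function.update (s.arr a) (i.eval D s) (e.eval D s))⟩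
  | seq {c₁ c₂ : Prog} {s s₁ s₂ : State} {t₁ t₂ : ℕ} :
      Exec D c₁ s t₁ s₁ → Exec D c₂ s₁ t₂ s₂ → Exec D (.seq c₁ c₂) s (t₁ + t₂) s₂
  | cond_true {e : Expr} {c₁ c₂ : Prog} {s s' : State} {t : ℕ} :
      e.eval D s ≠ 0 → Exec D c₁ s t s' → Exec D (.cond e c₁ c₂) s (e.cost + 1 + t) s'
  | cond_false {e : Expr} {c₁ c₂ : Prog} {s s' : State} {t : ℕ} :
      e.eval D s = 0 → Exec D c₂ s t s' → Exec D (.cond e c₁ c₂) s (e.cost + 1 + t) s'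
  | loop_true {e : Expr} {c : Prog} {s s₁ s₂ : State} {t₁ t₂ : ℕ} :
      e.eval D s ≠ 0 → Exec D c s t₁ s₁ → Exec D (.loop e c) s₁ t₂ s₂ →
        Exec D (.loop e c) s (e.cost + 1 + t₁ + t₂) s₂
  | loop_false {e : Expr} {c : Prog} {s : State} :
      e.eval D s = 0 → Exec D (.loop e c) s (e.cost + 1) s

/-- Executions are deterministic: the final state and the number of steps are determined. -/
theorem Exec.deterministic {D : ℕ → ℕ → ℝ≥0} {c : Prog} {s s₁ s₂ : State} {t₁ t₂ : ℕ}
    (h₁ : Exec D c s t₁ s₁) (h₂ : Exec D c s t₂ s₂) : t₁ = t₂ ∧ s₁ = s₂ := by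
  induction h₁ generalizing t₂ s₂ with
  | skip s => cases h₂; exact ⟨rfl, rfl⟩
  | assign s x e => cases h₂; exact ⟨rfl, rfl⟩
  | store s a i e => cases h₂; exact ⟨rfl, rfl⟩
  | seq _ _ ih₁ ih₂ =>
    cases h₂ with
    | seq k₁ k₂ =>
      obtain ⟨rfl, rfl⟩ := ih₁ k₁
      obtain ⟨rfl, rfl⟩ := ih₂ k₂
      exact ⟨rfl, rfl⟩
  | cond_true he _ ih =>
    cases h₂ with
    | cond_true _ k => obtain ⟨rfl, rfl⟩ := ih k; exact ⟨rfl, rfl⟩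
    | cond_false he' _ => exact absurd he' he
  | cond_false he _ ih =>
    cases h₂ with
    | cond_true he' _ => exact absurd he he'
    | cond_false _ k => obtain ⟨rfl, rfl⟩ := ih k; exact ⟨rfl, rfl⟩
  | loop_true he _ _ ih₁ ih₂ =>
    cases h₂ with
    | loop_true _ k₁ k₂ =>
      obtain ⟨rfl, rfl⟩ := ih₁ k₁
      obtain ⟨rfl, rfl⟩ := ih₂ k₂
      exact ⟨rfl, rfl⟩
    | loop_false he' => exact absurd he' he
  | loop_false he =>
    cases h₂ with
    | loop_true he' _ _ => exact absurd he he'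
    | loop_false _ => exact ⟨rfl, rfl⟩

/-! ### Input, output and approximation algorithms -/

/-- The distance table of an instance (`0` outside the range of the indices). -/
def Instance.table (I : Instance) (i j : ℕ) : ℝ≥0 :=
  if h : i < I.n ∧ j < I.n then I.d ⟨i, h.1⟩ ⟨j, h.2⟩ else 0

/-- The initial state: registers `0, 1, 2` hold `n`, `L`, `p`; arrays `0` and `1` hold the
indicator functions of the clients and of the facilities; array `2` holds the capacity upper bounds
of the facilities. Everything else is `0`. -/
def Instance.input (I : Instance) : State where
  var
    | 0 => I.n
    | 1 => I.L
    | 2 => I.p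
    | _ => 0
  arr
    | 0 => fun i => if h : i < I.n then (if ⟨i, h⟩ ∈ I.clients then 1 else 0) else 0
    | 1 => fun i => if h : i < I.n then (if ⟨i, h⟩ ∈ I.facilities then 1 else 0) else 0
    | 2 => fun i => if h : i < I.n then (if ⟨i, h⟩ ∈ I.facilities then I.U ⟨i, h⟩ else 0) else 0
    | _ => fun _ => 0

/-- The state `s` holds the solution `S` as output: register `3` holds the number of open centers,
array `3` their locations, and array `4` holds at index `v` the number `j + 1` if the client `v` is
assigned to the open center `j`, and `0` if `v` is not served. -/
def Outputs {I : Instance} (s : State) (S : Solution I) : Prop :=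
  s.var 3 = S.copies ∧
  (∀ j : Fin S.copies, s.arr 3 j = S.center j) ∧
  (∀ v : Fin I.n, s.arr 4 v = if h : v ∈ S.served then (S.assign ⟨v, h⟩ : ℕ) + 1 else 0)

/-- The program `c` is a polynomial-time `ρ`-approximation algorithm: on every instance it halts
within a number of steps that is polynomial in the number of points, and on every instance that
has a feasible solution it outputs one of maximum cluster radius at most `ρ` times the optimum. -/
def IsPolyTimeApproximation (ρ : ℝ≥0) (c : Prog) : Prop :=
  ∃ P : Polynomial ℕ, ∀ I : Instance, ∃ (t : ℕ) (s : State),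
    Exec I.table c I.input t s ∧ t ≤ P.eval I.n ∧
    (I.Solvable → ∃ S : Solution I, Outputs s S ∧ S.IsFeasible ∧ S.radius ≤ ρ * I.opt)

end SoftSupplier

namespace SoftSupplier

/-! ### Terms and commands with bounded iteration -/

/-! A solution that serves somebody has one of the given distances as its radius. So every pair of
points supplies a guess `R`, and the smallest guess for which at least `p` clients get served is
kept. For fixed `R` it suffices to find a solution of radius at most `11 * R` that serves at least
as many clients as any solution of radius at most `R`. Empty clusters can be dropped, so `L` is
replaced by `max L 1`.

Call a facility heavy if its capacity is at least `L` and at least `L` clients are within `R`.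
Greedily select heavy facilities whose `R`-neighbourhoods are disjoint. The capacity of a selected
facility is the largest bound of a heavy facility sharing a client with it; that facility is at
distance at most `2 * R`. Every client near a heavy facility joins the group of a selected facility
within `3 * R`, whose capacity is at least the bound of each heavy facility near the client
(`IsCover.blob_of_near_heavy`). Two selected facilities are linked if one heavy facility has
neighbours in both groups; they are then within `8 * R`. Thus a nonempty cluster of a solution of
radius at most `R` lies in pairwise linked groups, each of capacity at least that of its center.

Take a maximum spanning forest of the link graph, where an edge weighs the smaller capacity of its
ends. From the leaves upwards, each node forms as many clusters of size `L` as it can and passes the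
remainder, fewer than `L` clients, to its parent. What arrives beyond the root is handed back to
fill clusters up to capacity. Each tree then serves the minimum of its number of clients and the
total capacity of its clusters (`Flow.sum_served`).

To bound an arbitrary solution by that total capacity, fix a threshold. The forest restricted to
nodes of capacity above it still spans the components of the restricted graph (`topNode_eq_of_adj`).
Such a component loses clients only through its top node, hence fewer than `L` (`Flow.class_bound`),
so it has at least as many clusters as the solution can form from its clients with bounds above the
threshold. Summing over thresholds compares total capacities (`Flow.card_le_served`).

Only core clients, those within `R` of the facility of their own node, are moved. The outflow of a
node is at most its number of core clients (`Flow.out_le`), so nobody moves along more than one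
edge. Moved clients travel at most `R + 8 * R + 2 * R`, the others at most `3 * R + 2 * R`
(`isPlan`).

The algorithm is written in a small language whose loops run over `0, …, n - 1`. Compilation
preserves meaning and takes time polynomial in `n` (`Cmd.exec`); products and quotients become
bounded sums and counts. -/

/-- The state in which register `x` has been set to `v`. -/
def State.set (s : State) (x v : ℕ) : State := ⟨Function.update s.var x v, s.arr⟩

/-- The state in which entry `i` of array `a` has been set to `v`. -/
def State.put (s : State) (a i v : ℕ) : State :=
  ⟨s.var, Function.update s.arr a (Function.update (s.arr a) i v)⟩

@[simp] theorem State.set_var (s : State) (x v y : ℕ) :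
    (s.set x v).var y = if y = x then v else s.var y := Function.update_apply ..

@[simp] theorem State.set_arr (s : State) (x v : ℕ) : (s.set x v).arr = s.arr := rfl

@[simp] theorem State.put_var (s : State) (a i v : ℕ) : (s.put a i v).var = s.var := rfl

@[simp] theorem State.put_arr (s : State) (a i v b : ℕ) :
    (s.put a i v).arr b = if b = a then Function.update (s.arr a) i v else s.arr b :=
  Function.update_apply ..

/-- Expressions with case distinction, bounded sums and bounded search; the range of the bound
register `x` is `0, …, n - 1`, where `n` is the content of register `0`. -/
inductive Term where
  | const (k : ℕ)
  | var (x : ℕ)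
  | get (a : ℕ) (i : Term)
  | add (e₁ e₂ : Term)
  | sub (e₁ e₂ : Term)
  | le (e₁ e₂ : Term)
  | distLe (e₁ e₂ e₃ e₄ : Term)
  | ite (c e₁ e₂ : Term)
  | sum (x : ℕ) (e : Term)
  /-- the least `x` for which `e` is true, and `n` if there is none -/
  | find (x : ℕ) (e : Term)

/-- Iterated accumulation of the values `f 0, …, f (n - 1)`. -/
def accum (g : ℕ → ℕ → ℕ → ℕ) (f : ℕ → ℕ) : ℕ → ℕ
  | 0 => 0
  | n + 1 => g n (accum g f n) (f n)

/-- The accumulation step that counts the leading zeros of a sequence. -/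
def searchStep (i acc v : ℕ) : ℕ := acc + ((if i ≤ acc then 1 else 0) - v)

namespace Term

/-- The value of a term. -/
noncomputable def eval (D : ℕ → ℕ → ℝ≥0) : Term → State → ℕ
  | const k, _ => k
  | var x, s => s.var x
  | get a i, s => s.arr a (i.eval D s)
  | add e₁ e₂, s => e₁.eval D s + e₂.eval D s
  | sub e₁ e₂, s => e₁.eval D s - e₂.eval D s
  | le e₁ e₂, s => if e₁.eval D s ≤ e₂.eval D s then 1 else 0
  | distLe e₁ e₂ e₃ e₄, s =>
      if D (e₁.eval D s) (e₂.eval D s) ≤ D (e₃.eval D s) (e₄.eval D s) then 1 else 0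
  | ite c e₁ e₂, s => if c.eval D s ≠ 0 then e₁.eval D s else e₂.eval D s
  | sum x e, s => accum (fun _ acc v => acc + v) (fun i => e.eval D (s.set x i)) (s.var 0)
  | find x e, s => accum searchStep (fun i => e.eval D (s.set x i)) (s.var 0)

/-- Terms whose registers are below `100` and which do not bind register `0`. -/
def ok : Term → Bool
  | const _ => true
  | var x => decide (x < 100)
  | get _ i => i.ok
  | add e₁ e₂ => e₁.ok && e₂.ok
  | sub e₁ e₂ => e₁.ok && e₂.ok
  | le e₁ e₂ => e₁.ok && e₂.ok
  | distLe e₁ e₂ e₃ e₄ => e₁.ok && e₂.ok && e₃.ok && e₄.ok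
  | ite c e₁ e₂ => c.ok && e₁.ok && e₂.ok
  | sum x e => decide (0 < x) && decide (x < 100) && e.ok
  | find x e => decide (0 < x) && decide (x < 100) && e.ok

/-- The loop that accumulates the values computed by `c` in register `k + 3`. -/
def accumProg (x k : ℕ) (upd : Expr) (c : Prog) : Prog :=
  .seq (.assign k (.var x)) <|
  .seq (.assign (k + 1) (.const 0)) <|
  .seq (.assign (k + 2) (.const 0)) <|
  .seq (.loop (.le (.add (.var (k + 2)) (.const 1)) (.var 0))
    (.seq (.assign x (.var (k + 2))) <|
     .seq c <|
     .seq (.assign (k + 1) upd) (.assign (k + 2) (.add (.var (k + 2)) (.const 1))))) <|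
  .seq (.assign x (.var k)) (.assign k (.var (k + 1)))

/-- A program that leaves the value of a term in register `k` and preserves the registers
below `k`. -/
def compile : Term → ℕ → Prog
  | const c, k => .assign k (.const c)
  | var x, k => .assign k (.var x)
  | get a i, k => .seq (i.compile k) (.assign k (.get a (.var k)))
  | add e₁ e₂, k =>
      .seq (e₁.compile k) (.seq (e₂.compile (k + 1)) (.assign k (.add (.var k) (.var (k + 1)))))
  | sub e₁ e₂, k =>
      .seq (e₁.compile k) (.seq (e₂.compile (k + 1)) (.assign k (.sub (.var k) (.var (k + 1)))))
  | le e₁ e₂, k =>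
      .seq (e₁.compile k) (.seq (e₂.compile (k + 1)) (.assign k (.le (.var k) (.var (k + 1)))))
  | distLe e₁ e₂ e₃ e₄, k =>
      .seq (e₁.compile k) <| .seq (e₂.compile (k + 1)) <| .seq (e₃.compile (k + 2)) <|
      .seq (e₄.compile (k + 3)) <|
      .assign k (.distLe (.var k) (.var (k + 1)) (.var (k + 2)) (.var (k + 3)))
  | ite c e₁ e₂, k => .seq (c.compile k) (.cond (.var k) (e₁.compile k) (e₂.compile k))
  | sum x e, k => accumProg x k (.add (.var (k + 1)) (.var (k + 3))) (e.compile (k + 3))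
  | find x e, k =>
      accumProg x k
        (.add (.var (k + 1)) (.sub (.le (.var (k + 2)) (.var (k + 1))) (.var (k + 3))))
        (e.compile (k + 3))

/-- Registers from `100` on are scratch space of the compiled code, and no admissible term reads
them. -/
theorem eval_congr {D : ℕ → ℕ → ℝ≥0} {e : Term} (he : e.ok) {s s' : State}
    (hv : ∀ j < 100, s.var j = s'.var j) (ha : s.arr = s'.arr) : e.eval D s = e.eval D s' := by
  induction e generalizing s s' with
  | const k => rfl
  | var x => exact hv x (by simpa [ok] using he)
  | get a i ih => simp only [eval, ha, ih he hv ha]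
  | add e₁ e₂ ih₁ ih₂ | sub e₁ e₂ ih₁ ih₂ | le e₁ e₂ ih₁ ih₂ =>
    simp only [ok, Bool.and_eq_true] at he
    simp only [eval, ih₁ he.1 hv ha, ih₂ he.2 hv ha]
  | distLe e₁ e₂ e₃ e₄ ih₁ ih₂ ih₃ ih₄ =>
    simp only [ok, Bool.and_eq_true] at he
    simp only [eval, ih₁ he.1.1.1 hv ha, ih₂ he.1.1.2 hv ha, ih₃ he.1.2 hv ha, ih₄ he.2 hv ha]
  | ite c e₁ e₂ ih ih₁ ih₂ =>
    simp only [ok, Bool.and_eq_true] at he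
    simp only [eval, ih he.1.1 hv ha, ih₁ he.1.2 hv ha, ih₂ he.2 hv ha]
  | sum x e ih | find x e ih =>
    simp only [ok, Bool.and_eq_true] at he
    have : ∀ i, e.eval D (s.set x i) = e.eval D (s'.set x i) := fun i =>
      ih he.2 (fun j hj => by simp [hv j hj]) (by simpa using ha)
    simp only [eval, this, hv 0 (by norm_num)]

end Term

/-! ### Program logic with time bounds -/

/-- The program `c`, started in state `s`, halts within `T` steps in a state satisfying `Q`. -/
def Reach (D : ℕ → ℕ → ℝ≥0) (c : Prog) (s : State) (T : ℕ) (Q : State → Prop) : Prop :=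
  ∃ t s', Exec D c s t s' ∧ t ≤ T ∧ Q s'

namespace Reach

variable {D : ℕ → ℕ → ℝ≥0} {c c₁ c₂ : Prog} {s : State} {T T' T₁ T₂ : ℕ} {Q Q' R : State → Prop}

theorem assign {x : ℕ} {e : Expr} (h : Q (s.set x (e.eval D s))) :
    Reach D (.assign x e) s (e.cost + 1) Q := ⟨_, _, .assign s x e, le_rfl, h⟩

theorem store {a : ℕ} {i e : Expr} (h : Q (s.put a (i.eval D s) (e.eval D s))) :
    Reach D (.store a i e) s (i.cost + e.cost + 1) Q := ⟨_, _, .store s a i e, le_rfl, h⟩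

theorem seq (h₁ : Reach D c₁ s T₁ Q) (h₂ : ∀ s', Q s' → Reach D c₂ s' T₂ R) :
    Reach D (.seq c₁ c₂) s (T₁ + T₂) R := by
  obtain ⟨t, s', h, ht, hQ⟩ := h₁
  obtain ⟨t', s'', h', ht', hR⟩ := h₂ s' hQ
  exact ⟨_, _, .seq h h', Nat.add_le_add ht ht', hR⟩

theorem mono (h : Reach D c s T Q) (hT : T ≤ T') (hQ : ∀ s', Q s' → Q' s') :
    Reach D c s T' Q' := by
  obtain ⟨t, s', h, ht, hs⟩ := h
  exact ⟨t, s', h, ht.trans hT, hQ s' hs⟩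

/-- The bounds of the branches are added instead of maximized, so that time bounds remain
polynomials. -/
theorem cond {e : Expr} (h₁ : e.eval D s ≠ 0 → Reach D c₁ s T₁ Q)
    (h₂ : e.eval D s = 0 → Reach D c₂ s T₂ Q) :
    Reach D (.cond e c₁ c₂) s (e.cost + 1 + (T₁ + T₂)) Q := by
  by_cases h : e.eval D s = 0
  · obtain ⟨t, s', h', ht, hs⟩ := h₂ h
    exact ⟨_, s', .cond_false h h', by omega, hs⟩
  · obtain ⟨t, s', h', ht, hs⟩ := h₁ h
    exact ⟨_, s', .cond_true h h', by omega, hs⟩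

/-- Register `z` is the counter and `w` holds the bound; the invariant is indexed by the counter.
Each test costs `6` steps, including the final failing one. -/
theorem loop {z w N : ℕ} {Inv : ℕ → State → Prop}
    (hInv : ∀ i s, Inv i s → s.var z = i ∧ s.var w = N)
    (hbody : ∀ i < N, ∀ s, Inv i s → Reach D c s T (Inv (i + 1))) (h₀ : Inv 0 s) :
    Reach D (.loop (.le (.add (.var z) (.const 1)) (.var w)) c) s (N * (T + 6) + 6) (Inv N) := by
  have key : ∀ d i s, i + d = N → Inv i s →
      Reach D (.loop (.le (.add (.var z) (.const 1)) (.var w)) c) s (d * (T + 6) + 6)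
        (Inv N) := by
    intro d
    induction d with
    | zero =>
      intro i s hi h
      obtain ⟨hz, hw⟩ := hInv i s h
      refine ⟨_, s, .loop_false ?_, ?_, ?_⟩
      · simp [Expr.eval, hz, hw]; omega
      · simp [Expr.cost]
      · rwa [← hi]
    | succ d ih =>
      intro i s hi h
      obtain ⟨hz, hw⟩ := hInv i s h
      obtain ⟨t₁, s₁, h₁, ht₁, hs₁⟩ := hbody i (by omega) s h
      obtain ⟨t₂, s₂, h₂, ht₂, hs₂⟩ := ih (i + 1) s₁ (by omega) hs₁
      refine ⟨_, s₂, .loop_true ?_ h₁ h₂, ?_, hs₂⟩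
      · simp [Expr.eval, hz, hw]; omega
      · simp only [Expr.cost]
        have : (d + 1) * (T + 6) = d * (T + 6) + (T + 6) := by ring
        omega
  exact key N 0 s (by simp) h₀

end Reach

namespace Term

/-- What is required of a compiled term. -/
def Sound (D : ℕ → ℕ → ℝ≥0) (e : Term) (s : State) (k : ℕ) (s' : State) : Prop :=
  s'.arr = s.arr ∧ s'.var k = e.eval D s ∧ ∀ j < k, s'.var j = s.var j

/-- Register `k` saves the old content of the bound register `x`, `k + 1` holds the accumulator, `k
+ 2` the counter and `k + 3` the current value. Hence `x` can be restored, and nested binders do not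
disturb each other. -/
theorem reach_accum {D : ℕ → ℕ → ℝ≥0} {e : Term} (he : e.ok) {x k : ℕ} (hx : 0 < x)
    (hx' : x < 100) (hk : 100 ≤ k) {upd : Expr} {g : ℕ → ℕ → ℕ → ℕ}
    (hg : ∀ s, upd.eval D s = g (s.var (k + 2)) (s.var (k + 1)) (s.var (k + 3)))
    {T : ℕ} {s : State}
    (hc : ∀ s', s'.var 0 = s.var 0 → Reach D (e.compile (k + 3)) s' T (e.Sound D s' (k + 3))) :
    Reach D (accumProg x k upd (e.compile (k + 3))) s
      (s.var 0 * ((T + upd.cost + 7) + 6) + 16) fun s' =>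
        s'.arr = s.arr ∧ s'.var k = accum g (fun i => e.eval D (s.set x i)) (s.var 0) ∧
        ∀ j < k, s'.var j = s.var j := by
  set f := fun i => e.eval D (s.set x i) with hf
  let Inv : ℕ → State → Prop := fun i s' => s'.arr = s.arr ∧ s'.var k = s.var x ∧
    s'.var (k + 1) = accum g f i ∧ s'.var (k + 2) = i ∧ ∀ j < k, j ≠ x → s'.var j = s.var j
  have hloop : ∀ s₀, Inv 0 s₀ → Reach D (.loop (.le (.add (.var (k + 2)) (.const 1)) (.var 0))
    (.seq (.assign x (.var (k + 2))) <|
     .seq (e.compile (k + 3)) <|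
     .seq (.assign (k + 1) upd) (.assign (k + 2) (.add (.var (k + 2)) (.const 1))))) s₀
      (s.var 0 * ((T + upd.cost + 7) + 6) + 6) (Inv (s.var 0)) := by
    intro s₀ h₀
    refine Reach.loop (Inv := Inv) (fun i s' h => ⟨h.2.2.2.1, h.2.2.2.2 0 (by omega) hx.ne⟩) ?_ h₀
    rintro i - s₁ ⟨ha, h0, h1, h2, h3⟩
    refine Reach.mono (T := 2 + (T + ((upd.cost + 1) + 4)))
      (Reach.seq (Q := fun s' => s' = s₁.set x i) (Reach.assign (by simp [Expr.eval, h2])) ?_)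
      (by omega) (fun _ h => h)
    rintro _ rfl
    refine Reach.seq (hc _ (by simp [hx.ne, h3 0 (by omega) hx.ne])) ?_
    rintro s₂ ⟨ha₂, hv₂, hj₂⟩
    have hval : s₂.var (k + 3) = f i := by
      rw [hv₂, hf]
      refine eval_congr he (fun j hj => ?_) (by simpa using ha)
      by_cases hjx : j = x
      · simp [hjx]
      · simp [hjx, h3 j (by omega) hjx]
    refine Reach.seq (Reach.assign (Q := fun s' => s' = s₂.set (k + 1) (accum g f (i + 1))) ?_) ?_
    · rw [hg, hval, hj₂ (k + 2) (by omega), hj₂ (k + 1) (by omega)]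
      simp [show k + 2 ≠ x by omega, show k + 1 ≠ x by omega, h1, h2, accum]
    · rintro _ rfl
      refine Reach.assign ?_
      refine ⟨by simp [ha₂, ha], ?_, by simp, ?_, ?_⟩
      · simp [hj₂ k (by omega), show k ≠ x by omega, h0]
      · simp [Expr.eval, hj₂ (k + 2) (by omega), h2, show k + 2 ≠ x by omega]
      · intro j hj hjx
        simp [show j ≠ k + 2 by omega, show j ≠ k + 1 by omega, hj₂ j (by omega), hjx, h3 j hj hjx]
  refine Reach.mono (T := 2 + (2 + (2 + ((s.var 0 * ((T + upd.cost + 7) + 6) + 6) + (2 + 2)))))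
    (Reach.seq (Q := fun s' => s' = s.set k (s.var x)) (Reach.assign (by simp [Expr.eval])) ?_)
    (by omega) (fun _ h => h)
  rintro _ rfl
  refine Reach.seq (Reach.assign (Q := fun s' => s' = (s.set k (s.var x)).set (k + 1) 0)
    (by simp [Expr.eval])) ?_
  rintro _ rfl
  refine Reach.seq (Q := Inv 0) (Reach.assign ?_) ?_
  · refine ⟨rfl, by simp, by simp [accum], by simp [Expr.eval], fun j hj hjx => ?_⟩
    simp [show j ≠ k + 2 by omega, show j ≠ k + 1 by omega, show j ≠ k by omega]
  intro s₁ h₁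
  refine Reach.seq (hloop s₁ h₁) ?_
  rintro s₂ ⟨ha, h0, h1, h2, h3⟩
  refine Reach.seq (Reach.assign (Q := fun s' => s' = s₂.set x (s.var x))
    (by simp [Expr.eval, h0])) ?_
  rintro _ rfl
  refine Reach.assign ⟨ha, ?_, fun j hj => ?_⟩
  · simp [Expr.eval, h1, show k + 1 ≠ x by omega]
  · by_cases hjx : j = x
    · simp [hjx, show x ≠ k by omega]
    · simp [hjx, show j ≠ k by omega, h3 j hj hjx]

/-- A later operand is evaluated after the earlier ones have changed scratch registers; its value
still refers to the initial state. -/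
theorem Sound.of_le {D : ℕ → ℕ → ℝ≥0} {e : Term} (he : e.ok) {s s' s'' : State} {k k' : ℕ}
    (hk : 100 ≤ k) (h : s'.arr = s.arr ∧ ∀ j < k, s'.var j = s.var j)
    (h' : e.Sound D s' k' s'') : s''.var k' = e.eval D s := by
  rw [h'.2.1]
  exact eval_congr he (fun j hj => h.2 j (by omega)) h.1

/-- The time depends on the state only through register `0`, the range of all bounded iterations.
The other numbers may be arbitrarily large, which matters for capacities. -/
theorem reach {e : Term} (he : e.ok) : ∃ P : Polynomial ℕ, ∀ (D : ℕ → ℕ → ℝ≥0) (s : State) (k : ℕ),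
    100 ≤ k → Reach D (e.compile k) s (P.eval (s.var 0)) (e.Sound D s k) := by
  induction e with
  | const c =>
    refine ⟨2, fun D s k hk => Reach.mono (T := 2) (Reach.assign ⟨rfl, ?_, fun j hj => ?_⟩) (by simp)
      fun _ h => h⟩
    · simp [Expr.eval, eval]
    · simp [hj.ne]
  | var c =>
    refine ⟨2, fun D s k hk => Reach.mono (T := 2) (Reach.assign ⟨rfl, ?_, fun j hj => ?_⟩) (by simp)
      fun _ h => h⟩
    · simp [Expr.eval, eval]
    · simp [hj.ne]
  | get a i ih =>
    obtain ⟨P, hP⟩ := ih he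
    refine ⟨P + 3, fun D s k hk => Reach.mono (T := P.eval (s.var 0) + 3)
      (Reach.seq (hP D s k hk) ?_) (by simp) fun _ h => h⟩
    rintro s₁ ⟨ha, hv, hj⟩
    refine Reach.assign ⟨ha, ?_, fun j hjk => ?_⟩
    · simp [Expr.eval, eval, hv, ha]
    · simp [hjk.ne, hj j hjk]
  | add e₁ e₂ ih₁ ih₂ | sub e₁ e₂ ih₁ ih₂ | le e₁ e₂ ih₁ ih₂ =>
    simp only [ok, Bool.and_eq_true] at he
    obtain ⟨P, hP⟩ := ih₁ he.1
    obtain ⟨Q, hQ⟩ := ih₂ he.2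
    refine ⟨P + (Q + 4), fun D s k hk => Reach.mono (T := P.eval (s.var 0) + (Q.eval (s.var 0) + 4))
      (Reach.seq (hP D s k hk) ?_) (by simp) fun _ h => h⟩
    rintro s₁ ⟨ha, hv, hj⟩
    refine Reach.seq (hj 0 (by omega) ▸ hQ D s₁ (k + 1) (by omega)) ?_
    intro s₂ h₂
    have hv₂ := h₂.of_le he.2 hk ⟨ha, hj⟩
    obtain ⟨ha₂, -, hj₂⟩ := h₂
    refine Reach.assign ⟨ha₂.trans ha, ?_, fun j hjk => ?_⟩
    · simp [Expr.eval, eval, hv₂, hj₂ k (by omega), hv]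
    · simp [hjk.ne, hj₂ j (by omega), hj j hjk]
  | distLe e₁ e₂ e₃ e₄ ih₁ ih₂ ih₃ ih₄ =>
    simp only [ok, Bool.and_eq_true] at he
    obtain ⟨P₁, hP₁⟩ := ih₁ he.1.1.1
    obtain ⟨P₂, hP₂⟩ := ih₂ he.1.1.2
    obtain ⟨P₃, hP₃⟩ := ih₃ he.1.2
    obtain ⟨P₄, hP₄⟩ := ih₄ he.2
    refine ⟨P₁ + (P₂ + (P₃ + (P₄ + 6))), fun D s k hk => Reach.mono
      (T := P₁.eval (s.var 0) + (P₂.eval (s.var 0) + (P₃.eval (s.var 0) + (P₄.eval (s.var 0) + 6))))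
      (Reach.seq (hP₁ D s k hk) ?_) (by simp) fun _ h => h⟩
    rintro s₁ ⟨ha, hv, hj⟩
    refine Reach.seq (hj 0 (by omega) ▸ hP₂ D s₁ (k + 1) (by omega)) ?_
    intro s₂ h₂
    have hv₂ := h₂.of_le he.1.1.2 hk ⟨ha, hj⟩
    obtain ⟨ha₂, -, hj₂⟩ := h₂
    have e₂ : s₂.arr = s.arr ∧ ∀ j < k, s₂.var j = s.var j :=
      ⟨ha₂.trans ha, fun j h => (hj₂ j (by omega)).trans (hj j h)⟩
    refine Reach.seq (e₂.2 0 (by omega) ▸ hP₃ D s₂ (k + 2) (by omega)) ?_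
    intro s₃ h₃
    have hv₃ := h₃.of_le he.1.2 hk e₂
    obtain ⟨ha₃, -, hj₃⟩ := h₃
    have e₃ : s₃.arr = s.arr ∧ ∀ j < k, s₃.var j = s.var j :=
      ⟨ha₃.trans e₂.1, fun j h => (hj₃ j (by omega)).trans (e₂.2 j h)⟩
    refine Reach.seq (e₃.2 0 (by omega) ▸ hP₄ D s₃ (k + 3) (by omega)) ?_
    intro s₄ h₄
    have hv₄ := h₄.of_le he.2 hk e₃
    obtain ⟨ha₄, -, hj₄⟩ := h₄
    refine Reach.assign ⟨ha₄.trans e₃.1, ?_, fun j hjk => ?_⟩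
    · simp [Expr.eval, eval, hv₄, hj₄ (k + 2) (by omega), hv₃, hj₄ (k + 1) (by omega),
        hj₃ (k + 1) (by omega), hv₂, hj₄ k (by omega), hj₃ k (by omega), hj₂ k (by omega), hv]
    · simp [hjk.ne, hj₄ j (by omega), e₃.2 j hjk]
  | ite c e₁ e₂ ih ih₁ ih₂ =>
    simp only [ok, Bool.and_eq_true] at he
    obtain ⟨P, hP⟩ := ih he.1.1
    obtain ⟨P₁, hP₁⟩ := ih₁ he.1.2
    obtain ⟨P₂, hP₂⟩ := ih₂ he.2
    refine ⟨P + (2 + (P₁ + P₂)), fun D s k hk => Reach.mono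
      (T := P.eval (s.var 0) + (2 + (P₁.eval (s.var 0) + P₂.eval (s.var 0))))
      (Reach.seq (hP D s k hk) ?_) (by simp) fun _ h => h⟩
    rintro s₁ ⟨ha, hv, hj⟩
    have h0 := hj 0 (by omega)
    refine Reach.cond (fun hc => ?_) (fun hc => ?_)
    · refine Reach.mono (h0 ▸ hP₁ D s₁ k hk) le_rfl fun s₂ h₂ => ?_
      have hv₂ := h₂.of_le he.1.2 hk ⟨ha, hj⟩
      refine ⟨h₂.1.trans ha, ?_, fun j hjk => (h₂.2.2 j hjk).trans (hj j hjk)⟩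
      simp only [Expr.eval, hv] at hc
      simp [eval, hc, hv₂]
    · refine Reach.mono (h0 ▸ hP₂ D s₁ k hk) le_rfl fun s₂ h₂ => ?_
      have hv₂ := h₂.of_le he.2 hk ⟨ha, hj⟩
      refine ⟨h₂.1.trans ha, ?_, fun j hjk => (h₂.2.2 j hjk).trans (hj j hjk)⟩
      simp only [Expr.eval, hv] at hc
      simp [eval, hc, hv₂]
  | sum x e ih | find x e ih =>
    simp only [ok, Bool.and_eq_true, decide_eq_true_eq] at he
    obtain ⟨P, hP⟩ := ih he.2
    -- The `20` covers `upd.cost + 7`: the two update expressions cost `3` and `7`.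
    refine ⟨Polynomial.X * ((P + 20) + 6) + 16, fun D s k hk => Reach.mono
      (reach_accum he.2 he.1.1 he.1.2 hk ?_ fun s' hs' => hs' ▸ hP D s' (k + 3) (by omega)) ?_
      fun _ h => h⟩
    · intro s
      rfl
    · simp only [Expr.cost, Polynomial.eval_add, Polynomial.eval_mul, Polynomial.eval_X,
        Polynomial.eval_ofNat]
      exact Nat.add_le_add_right (Nat.mul_le_mul_left _ (by omega)) 16

end Term

/-! ### Commands and their compilation -/

/-- Commands: programs whose loops run over `0, …, n - 1`. -/
inductive Cmd where
  | skip
  | assign (x : ℕ) (e : Term)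
  | store (a : ℕ) (i e : Term)
  | seq (c₁ c₂ : Cmd)
  | cond (e : Term) (c₁ c₂ : Cmd)
  | loop (x : ℕ) (c : Cmd)

/-- Iteration of `f 0, …, f (n - 1)` on a state. -/
def iter (f : ℕ → State → State) (s : State) : ℕ → State
  | 0 => s
  | n + 1 => f n (iter f s n)

namespace Cmd

/-- The effect of a command. -/
noncomputable def run (D : ℕ → ℕ → ℝ≥0) : Cmd → State → State
  | skip, s => s
  | assign x e, s => s.set x (e.eval D s)
  | store a i e, s => s.put a (i.eval D s) (e.eval D s)
  | seq c₁ c₂, s => c₂.run D (c₁.run D s)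
  | cond e c₁ c₂, s => if e.eval D s ≠ 0 then c₁.run D s else c₂.run D s
  | loop x c, s => iter (fun i s' => c.run D (s'.set x i)) s (s.var 0)

/-- Commands that use registers below `100` only and do not write register `0`. -/
def ok : Cmd → Bool
  | skip => true
  | assign x e => decide (0 < x) && decide (x < 100) && e.ok
  | store _ i e => i.ok && e.ok
  | seq c₁ c₂ => c₁.ok && c₂.ok
  | cond e c₁ c₂ => e.ok && c₁.ok && c₂.ok
  | loop x c => decide (0 < x) && decide (x < 100) && c.ok

/-- Translation of commands into programs, with auxiliary registers from `k` on. -/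
def compile : Cmd → ℕ → Prog
  | skip, _ => .skip
  | assign x e, k => .seq (e.compile k) (.assign x (.var k))
  | store a i e, k => .seq (i.compile k) (.seq (e.compile (k + 1)) (.store a (.var k) (.var (k + 1))))
  | seq c₁ c₂, k => .seq (c₁.compile k) (c₂.compile k)
  | cond e c₁ c₂, k => .seq (e.compile k) (.cond (.var k) (c₁.compile k) (c₂.compile k))
  | loop x c, k => .seq (.assign k (.const 0)) <|
      .loop (.le (.add (.var k) (.const 1)) (.var 0)) <|
        .seq (.assign x (.var k)) <| .seq (c.compile (k + 1)) <|
          .assign k (.add (.var k) (.const 1))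

/-- Agreement of two states on the arrays and on the registers below `100`. -/
def Agree (s σ : State) : Prop := s.arr = σ.arr ∧ ∀ j < 100, s.var j = σ.var j

/-- The loop bound never changes, so one polynomial in it can bound the time of all parts of a
command. -/
theorem run_var_zero {D : ℕ → ℕ → ℝ≥0} {c : Cmd} (hc : c.ok) (σ : State) :
    (c.run D σ).var 0 = σ.var 0 := by
  induction c generalizing σ with
  | skip => rfl
  | assign x e =>
    simp only [ok, Bool.and_eq_true, decide_eq_true_eq] at hc
    simp [run, hc.1.1.ne]
  | store => rfl
  | seq c₁ c₂ ih₁ ih₂ =>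
    simp only [ok, Bool.and_eq_true] at hc
    rw [run, ih₂ hc.2, ih₁ hc.1]
  | cond e c₁ c₂ ih₁ ih₂ =>
    simp only [ok, Bool.and_eq_true] at hc
    rw [run]
    split
    · exact ih₁ hc.1.2 σ
    · exact ih₂ hc.2 σ
  | loop x c ih =>
    simp only [ok, Bool.and_eq_true, decide_eq_true_eq] at hc
    suffices ∀ n, (iter (fun i s' => c.run D (s'.set x i)) σ n).var 0 = σ.var 0 from this _
    intro n
    induction n with
    | zero => rfl
    | succ n ihn => rw [iter, ih hc.2]; simp [hc.1.1.ne, ihn]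

/-- The real state `s` may differ from the abstract state `σ` in scratch registers. The last clause
protects the counters of enclosing loops, which are kept in registers between `100` and `k`. -/
theorem reach {c : Cmd} (hc : c.ok) : ∃ P : Polynomial ℕ, ∀ (D : ℕ → ℕ → ℝ≥0) (s σ : State) (k : ℕ),
    100 ≤ k → Agree s σ → Reach D (c.compile k) s (P.eval (s.var 0)) fun s' =>
      Agree s' (c.run D σ) ∧ ∀ j, 100 ≤ j → j < k → s'.var j = s.var j := by
  induction c with
  | skip =>
    exact ⟨1, fun D s σ k hk h => ⟨1, s, .skip s, by simp, h, fun j _ _ => rfl⟩⟩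
  | assign x e =>
    simp only [ok, Bool.and_eq_true, decide_eq_true_eq] at hc
    obtain ⟨P, hP⟩ := Term.reach hc.2
    refine ⟨P + 2, fun D s σ k hk h => Reach.mono (T := P.eval (s.var 0) + 2)
      (Reach.seq (hP D s k hk) ?_) (by simp) fun _ h => h⟩
    rintro s₁ ⟨ha, hv, hj⟩
    refine Reach.assign ⟨⟨ha.trans h.1, fun j hj' => ?_⟩, fun j h1 h2 => ?_⟩
    · simp only [Expr.eval, hv, run, State.set_var, Term.eval_congr hc.2 h.2 h.1]
      rw [hj j (by omega), h.2 j hj']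
    · simp [show j ≠ x by omega, hj j h2]
  | store a i e =>
    simp only [ok, Bool.and_eq_true] at hc
    obtain ⟨P, hP⟩ := Term.reach hc.1
    obtain ⟨Q, hQ⟩ := Term.reach hc.2
    refine ⟨P + (Q + 3), fun D s σ k hk h => Reach.mono
      (T := P.eval (s.var 0) + (Q.eval (s.var 0) + 3))
      (Reach.seq (hP D s k hk) ?_) (by simp) fun _ h => h⟩
    rintro s₁ ⟨ha, hv, hj⟩
    refine Reach.seq (hj 0 (by omega) ▸ hQ D s₁ (k + 1) (by omega)) ?_
    intro s₂ h₂
    have hv₂ := h₂.of_le hc.2 hk ⟨ha, hj⟩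
    obtain ⟨ha₂, -, hj₂⟩ := h₂
    refine Reach.store ⟨⟨?_, fun j hj' => ?_⟩, fun j h1 h2 => ?_⟩
    · simp only [State.put, Expr.eval, hv₂, hj₂ k (by omega), hv, run, ha₂, ha, h.1,
        Term.eval_congr hc.2 h.2 h.1, Term.eval_congr hc.1 h.2 h.1]
    · simp [run, hj₂ j (by omega), hj j (by omega), h.2 j hj']
    · simp [hj₂ j (by omega), hj j h2]
  | seq c₁ c₂ ih₁ ih₂ =>
    simp only [ok, Bool.and_eq_true] at hc
    obtain ⟨P, hP⟩ := ih₁ hc.1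
    obtain ⟨Q, hQ⟩ := ih₂ hc.2
    refine ⟨P + Q, fun D s σ k hk h => Reach.mono
      (T := P.eval (s.var 0) + Q.eval (s.var 0))
      (Reach.seq (hP D s σ k hk h) ?_) (by simp) fun _ h => h⟩
    rintro s₁ ⟨h₁, hj⟩
    have h0 : s₁.var 0 = s.var 0 := by
      rw [h₁.2 0 (by omega), run_var_zero hc.1, h.2 0 (by omega)]
    refine Reach.mono (h0 ▸ hQ D s₁ _ k hk h₁) le_rfl ?_
    rintro s₂ ⟨h₂, hj₂⟩
    exact ⟨h₂, fun j h1 h2 => (hj₂ j h1 h2).trans (hj j h1 h2)⟩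
  | cond e c₁ c₂ ih₁ ih₂ =>
    simp only [ok, Bool.and_eq_true] at hc
    obtain ⟨P, hP⟩ := Term.reach hc.1.1
    obtain ⟨P₁, hP₁⟩ := ih₁ hc.1.2
    obtain ⟨P₂, hP₂⟩ := ih₂ hc.2
    refine ⟨P + (2 + (P₁ + P₂)), fun D s σ k hk h => Reach.mono
      (T := P.eval (s.var 0) + (2 + (P₁.eval (s.var 0) + P₂.eval (s.var 0))))
      (Reach.seq (hP D s k hk) ?_) (by simp) fun _ h => h⟩
    rintro s₁ ⟨ha, hv, hj⟩
    have h0 := hj 0 (by omega)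
    have hs₁ : Agree s₁ σ := ⟨ha.trans h.1, fun j hj' => (hj j (by omega)).trans (h.2 j hj')⟩
    refine Reach.cond (fun he => ?_) (fun he => ?_)
    · refine Reach.mono (h0 ▸ hP₁ D s₁ σ k hk hs₁) le_rfl ?_
      rintro s₂ ⟨h₂, hj₂⟩
      simp only [Expr.eval, hv, Term.eval_congr hc.1.1 h.2 h.1] at he
      exact ⟨by simpa [run, he] using h₂, fun j h1 h2 => (hj₂ j h1 h2).trans (hj j h2)⟩
    · refine Reach.mono (h0 ▸ hP₂ D s₁ σ k hk hs₁) le_rfl ?_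
      rintro s₂ ⟨h₂, hj₂⟩
      simp only [Expr.eval, hv, Term.eval_congr hc.1.1 h.2 h.1] at he
      exact ⟨by simpa [run, he] using h₂, fun j h1 h2 => (hj₂ j h1 h2).trans (hj j h2)⟩
  | loop x c ih =>
    simp only [ok, Bool.and_eq_true, decide_eq_true_eq] at hc
    obtain ⟨⟨hx, hx'⟩, hc⟩ := hc
    obtain ⟨P, hP⟩ := ih hc
    refine ⟨2 + (Polynomial.X * ((2 + (P + 4)) + 6) + 6), fun D s σ k hk h => Reach.mono
      (T := 2 + (s.var 0 * ((2 + (P.eval (s.var 0) + 4)) + 6) + 6))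
      (Reach.seq (Q := fun s' => s' = s.set k 0) (Reach.assign (by simp [Expr.eval])) ?_) (by simp)
      fun _ h => h⟩
    rintro _ rfl
    set f := fun i (s' : State) => c.run D (s'.set x i) with hf
    have hf0 : ∀ i, (iter f σ i).var 0 = σ.var 0 := by
      intro i
      induction i with
      | zero => rfl
      | succ i ih => rw [iter, hf]; simp only [run_var_zero hc]; simp [hx.ne, ih, ← hf]
    have hn : σ.var 0 = s.var 0 := (h.2 0 (by omega)).symm
    refine Reach.mono (Reach.loop (N := s.var 0) (T := 2 + (P.eval (s.var 0) + 4))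
      (Inv := fun i s' => Agree s' (iter f σ i) ∧ s'.var k = i ∧
        ∀ j, 100 ≤ j → j < k → s'.var j = s.var j) ?_ ?_ ?_) le_rfl ?_
    · rintro i s' ⟨h1, h2, h3⟩
      exact ⟨h2, by rw [h1.2 0 (by omega), hf0, hn]⟩
    · rintro i hi s₁ ⟨h1, h2, h3⟩
      refine Reach.seq (Q := fun s' => s' = s₁.set x i) (Reach.assign (by simp [Expr.eval, h2])) ?_
      rintro _ rfl
      have h0 : (s₁.set x i).var 0 = s.var 0 := by
        simp [hx.ne, h1.2 0 (by omega), hf0, hn]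
      refine Reach.seq (h0 ▸ hP D (s₁.set x i) ((iter f σ i).set x i) (k + 1) (by omega)
        ⟨h1.1, fun j hj => by simp [h1.2 j hj]⟩) ?_
      rintro s₂ ⟨h₂, hj₂⟩
      refine Reach.assign ⟨⟨h₂.1, fun j hj => ?_⟩, ?_, fun j hj hj' => ?_⟩
      · simp [show j ≠ k by omega, h₂.2 j hj, iter, hf]
      · simp [Expr.eval, hj₂ k hk (by omega), show k ≠ x by omega, h2]
      · simp [show j ≠ k by omega, hj₂ j hj (by omega), show j ≠ x by omega, h3 j hj hj']
    · exact ⟨⟨h.1, fun j hj => by simp [show j ≠ k by omega, h.2 j hj, iter]⟩, by simp,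
        fun j _ hj => by simp [hj.ne]⟩
    · rintro s' ⟨h1, h2, h3⟩
      exact ⟨by rw [run, hn]; exact h1, h3⟩

theorem exec {c : Cmd} (hc : c.ok) : ∃ P : Polynomial ℕ, ∀ (D : ℕ → ℕ → ℝ≥0) (s : State),
    ∃ t s', Exec D (c.compile 100) s t s' ∧ t ≤ P.eval (s.var 0) ∧ Agree s' (c.run D s) := by
  obtain ⟨P, hP⟩ := reach hc
  refine ⟨P, fun D s => ?_⟩
  obtain ⟨t, s', h, ht, hs, -⟩ := hP D s s 100 le_rfl ⟨rfl, fun _ _ => rfl⟩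
  exact ⟨t, s', h, ht, hs⟩

end Cmd

open Finset

/-! ### Counting -/

open Classical in
/-- The number of `i < n` with `p i`. -/
noncomputable def cnt (p : ℕ → Prop) (n : ℕ) : ℕ := Nat.count p n

section cnt

variable {p q : ℕ → Prop} {n : ℕ}

@[simp] theorem cnt_zero : cnt p 0 = 0 := by classical exact Nat.count_zero p

theorem cnt_succ_pos (h : p n) : cnt p (n + 1) = cnt p n + 1 := by
  classical simp [cnt, Nat.count_succ, h]

theorem cnt_succ_neg (h : ¬ p n) : cnt p (n + 1) = cnt p n := by
  classical simp [cnt, Nat.count_succ, h]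

theorem cnt_eq_card [DecidablePred p] : cnt p n = #{i ∈ range n | p i} := by
  classical
  rw [cnt, Nat.count_eq_card_filter_range]
  congr

theorem cnt_congr (h : ∀ i < n, p i ↔ q i) : cnt p n = cnt q n := by
  classical
  rw [cnt_eq_card, cnt_eq_card, filter_congr fun i hi => h i (mem_range.1 hi)]

theorem cnt_mono (h : ∀ i < n, p i → q i) : cnt p n ≤ cnt q n := by
  classical
  rw [cnt_eq_card, cnt_eq_card]
  refine card_le_card fun i hi => ?_
  simp only [mem_filter, mem_range] at hi ⊢
  exact ⟨hi.1, h i hi.1 hi.2⟩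

theorem cnt_le : cnt p n ≤ n := by
  classical exact Nat.count_le _

theorem cnt_mono_right {m : ℕ} (h : m ≤ n) : cnt p m ≤ cnt p n := by
  classical exact Nat.count_monotone p h

theorem cnt_lt {v : ℕ} (hv : v < n) (h : p v) : cnt p v < cnt p n := by
  calc cnt p v < cnt p v + 1 := by omega
    _ = cnt p (v + 1) := (cnt_succ_pos h).symm
    _ ≤ _ := cnt_mono_right hv

theorem cnt_eq_zero (h : ∀ i < n, ¬ p i) : cnt p n = 0 := by
  classical
  rw [cnt_eq_card, card_eq_zero, filter_eq_empty_iff]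
  simpa using h

theorem cnt_pos {v : ℕ} (hv : v < n) (h : p v) : 0 < cnt p n :=
  (Nat.zero_le _).trans_lt (cnt_lt hv h)

theorem exists_of_cnt_pos (h : 0 < cnt p n) : ∃ v < n, p v := by
  by_contra! hn
  exact h.ne' (cnt_eq_zero hn)

theorem cnt_or (h : ∀ i < n, p i → ¬ q i) :
    cnt (fun i => p i ∨ q i) n = cnt p n + cnt q n := by
  classical
  rw [cnt_eq_card, cnt_eq_card, cnt_eq_card, filter_or, card_union_of_disjoint]
  rw [disjoint_filter]
  exact fun i hi => h i (mem_range.1 hi)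

theorem cnt_and_not_add : cnt (fun i => p i ∧ ¬ q i) n + cnt (fun i => p i ∧ q i) n = cnt p n := by
  rw [← cnt_or (by tauto)]
  exact cnt_congr fun i _ => by tauto

theorem cnt_eq_sum_fiber (f : ℕ → ℕ) (m : ℕ) :
    cnt (fun i => p i ∧ f i < m) n = ∑ k ∈ range m, cnt (fun i => p i ∧ f i = k) n := by
  induction m with
  | zero => simpa using cnt_eq_zero (by simp)
  | succ m ih =>
    rw [sum_range_succ, ← ih, ← cnt_or (by rintro i - ⟨-, h⟩ ⟨-, h'⟩; omega)]
    refine cnt_congr fun i _ => ?_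
    rw [← and_or_left, Nat.lt_succ_iff_lt_or_eq]

/-- The ranks `cnt p v` of the numbers with `p v` run through `0, …, cnt p n - 1`, each once.
Conditions on ranks can therefore be counted on an initial segment. -/
theorem cnt_and_rank (p q : ℕ → Prop) (n : ℕ) :
    cnt (fun v => p v ∧ q (cnt p v)) n = cnt q (cnt p n) := by
  induction n with
  | zero => simp
  | succ n ih =>
    by_cases hp : p n
    · rw [cnt_succ_pos hp]
      by_cases hq : q (cnt p n)
      · rw [cnt_succ_pos ⟨hp, hq⟩, cnt_succ_pos hq, ih]
      · rw [cnt_succ_neg (by tauto), cnt_succ_neg hq, ih]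
    · rw [cnt_succ_neg (by tauto), cnt_succ_neg hp, ih]

theorem cnt_and_lt {v : ℕ} (hv : v ≤ n) : cnt (fun i => i < v ∧ p i) n = cnt p v := by
  classical
  rw [cnt_eq_card, cnt_eq_card]
  congr 1
  ext i
  simp only [mem_filter, mem_range]
  constructor
  · tauto
  · rintro ⟨h, h'⟩
    exact ⟨by omega, h, h'⟩

theorem cnt_interval {a b : ℕ} (hb : b ≤ n) : cnt (fun i => a ≤ i ∧ i < b) n = b - a := by
  rw [cnt_eq_card, ← Nat.card_Ico]
  congr 1
  ext i
  simp only [mem_filter, mem_range, mem_Ico]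
  omega

/-- Dealing `n` items cyclically into `c` piles gives sizes `n / c` rounded down or up, and rounding
does not cross the integers `L` and `U`. -/
theorem cnt_mod_bounds {c j L U : ℕ} (hj : j < c) (hL : c * L ≤ n) (hU : n ≤ c * U) :
    L ≤ cnt (fun i => i % c = j) n ∧ cnt (fun i => i % c = j) n ≤ U := by
  have hc : 0 < c := by omega
  have key : cnt (fun i => i % c = j) n = n / c + if j < n % c then 1 else 0 := by
    have := Nat.count_modEq_card n hc j
    rw [Nat.mod_eq_of_lt hj] at this
    rw [← this, cnt_eq_card, Nat.count_eq_card_filter_range]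
    congr 1
    ext i
    simp [Nat.ModEq, Nat.mod_eq_of_lt hj]
  have h1 : L ≤ n / c := (Nat.le_div_iff_mul_le hc).2 (by linarith)
  rw [key]
  refine ⟨by omega, ?_⟩
  split_ifs with h
  · rw [Nat.add_one_le_iff, Nat.div_lt_iff_lt_mul hc]
    -- A pile is rounded up only if there is a remainder, which excludes `n = c * U`.
    refine lt_of_le_of_ne (by linarith) fun h' => ?_
    rw [h', Nat.mul_mod_left] at h
    omega
  · rw [add_zero]
    exact Nat.div_le_of_le_mul hU

end cnt

/-! ### Prefix sums -/

/-- Consecutive blocks of lengths `f 0, f 1, …` tile an initial segment. This, together with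
`prefix_unique`, locates ranks among the children of a node and cluster numbers among the nodes. -/
theorem exists_prefix (f : ℕ → ℕ) {n i : ℕ} (h : i < ∑ k ∈ range n, f k) :
    ∃ k < n, ∑ j ∈ range k, f j ≤ i ∧ i < ∑ j ∈ range k, f j + f k := by
  induction n with
  | zero => simp at h
  | succ n ih =>
    by_cases hi : i < ∑ k ∈ range n, f k
    · obtain ⟨k, hk, h'⟩ := ih hi
      exact ⟨k, by omega, h'⟩
    · exact ⟨n, by omega, by omega, by rwa [← sum_range_succ]⟩

theorem prefix_mono (f : ℕ → ℕ) {k l : ℕ} (h : k ≤ l) :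
    ∑ j ∈ range k, f j ≤ ∑ j ∈ range l, f j :=
  sum_le_sum_of_subset (range_mono h)

theorem prefix_unique (f : ℕ → ℕ) {k l i : ℕ} (hk : ∑ j ∈ range k, f j ≤ i)
    (hk' : i < ∑ j ∈ range k, f j + f k) (hl : ∑ j ∈ range l, f j ≤ i)
    (hl' : i < ∑ j ∈ range l, f j + f l) : k = l := by
  rw [← sum_range_succ] at hk' hl'
  by_contra hne
  rcases Nat.lt_or_gt_of_ne hne with h | h
  · exact absurd (prefix_mono f (Nat.succ_le_of_lt h)) (by simp only [Nat.succ_eq_add_one]; omega)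
  · exact absurd (prefix_mono f (Nat.succ_le_of_lt h)) (by simp only [Nat.succ_eq_add_one]; omega)

/-- Comparison of two weighted families through the numbers of members above each threshold. -/
theorem sum_le_sum_mul_of_card_le {ι : Type*} (J : Finset ι) (f : ι → ℕ) (K : Finset ℕ)
    (c g : ℕ → ℕ) (h : ∀ t, #{j ∈ J | t < f j} ≤ ∑ k ∈ K, if t < g k then c k else 0) :
    ∑ j ∈ J, f j ≤ ∑ k ∈ K, c k * g k := by
  obtain ⟨B, hB⟩ : ∃ B, ∀ j ∈ J, f j ≤ B := ⟨J.sup f, fun j hj => le_sup hj⟩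
  -- Layer-cake summation: each value is the number of thresholds below it, and the two sums are
  -- exchanged.
  have h1 : ∀ j ∈ J, f j = ∑ t ∈ range B, if t < f j then 1 else 0 := by
    intro j hj
    rw [sum_boole, ← card_range (f j)]
    simp only [Nat.cast_id]
    congr 1
    ext i
    have := hB j hj
    simp only [card_range, mem_range, mem_filter]
    omega
  have h2 : ∀ k ∈ K, ∑ t ∈ range B, (if t < g k then c k else 0) ≤ c k * g k := by
    intro k _
    rw [← sum_filter, sum_const, smul_eq_mul, mul_comm]
    refine Nat.mul_le_mul_left _ ?_
    rw [← card_range (g k)]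
    refine card_le_card fun i hi => ?_
    simp only [mem_filter, mem_range] at hi ⊢
    simpa using hi.2
  calc ∑ j ∈ J, f j = ∑ t ∈ range B, #{j ∈ J | t < f j} := by
        rw [sum_congr rfl h1, sum_comm]
        simp
    _ ≤ ∑ t ∈ range B, ∑ k ∈ K, if t < g k then c k else 0 := sum_le_sum fun t _ => h t
    _ = ∑ k ∈ K, ∑ t ∈ range B, if t < g k then c k else 0 := sum_comm
    _ ≤ _ := sum_le_sum h2

/-! ### Distribution of clients along a forest -/

/-- The arrays computed on a forest with nodes `0, …, n - 1` and parent function `par` (values at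
least `n` mean that there is no parent). Client `v` starts at node `b v`; node `k` gets `c k`
clusters of size at least `L` and `x k` clients more than `L * c k`; `s k` clients are passed from
the subtree of `k` to the parent, and `e k` clients are passed back. -/
structure Flow (n L : ℕ) (par cap b : ℕ → ℕ) (core : ℕ → Prop)
    (s c root gap pre x e : ℕ → ℕ) : Prop where
  L_pos : 0 < L
  par_lt : ∀ k < n, par k < n → par k < k
  node : ∀ k < n, (L ≤ cap k ∧ L ≤ cnt (fun v => b v = k ∧ core v) n) ∨
    (cnt (fun v => b v = k) n = 0 ∧ n ≤ par k ∧ ∀ j < n, par j ≠ k)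
  bal : ∀ k < n, L * c k + s k =
    cnt (fun v => b v = k) n + ∑ j ∈ range n, if par j = k then s j else 0
  s_lt : ∀ k < n, s k < L
  root_eq : ∀ k < n, root k = if par k < n then root (par k) else k
  gap_eq : ∀ k < n, gap k = c k * (cap k - L)
  pre_eq : ∀ k < n, pre k = ∑ j ∈ range k, if root j = root k then gap j else 0
  x_eq : ∀ k < n, x k = min (s (root k)) (pre k + gap k) - min (s (root k)) (pre k)
  e_eq : ∀ k < n, e k = x k + ∑ j ∈ range n, if par j = k then e j else 0

/-- Double counting: every edge of the forest is counted once, at its parent end. -/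
theorem sum_children {n : ℕ} (par f : ℕ → ℕ) (Q : ℕ → Prop) [DecidablePred Q] :
    (∑ k ∈ range n, if Q k then ∑ j ∈ range n, (if par j = k then f j else 0) else 0) =
      ∑ j ∈ range n, if par j < n ∧ Q (par j) then f j else 0 := by
  have : ∀ k ∈ range n, (if Q k then ∑ j ∈ range n, (if par j = k then f j else 0) else 0) =
      ∑ j ∈ range n, if k = par j then (if Q (par j) then f j else 0) else 0 := by
    intro k _
    split_ifs with h
    · refine sum_congr rfl fun j _ => ?_
      by_cases hj : par j = k
      · simp [hj, h]
      · simp [hj, Ne.symm hj]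
    · refine (sum_eq_zero fun j _ => ?_).symm
      by_cases hj : k = par j
      · simp [← hj, h]
      · simp [hj]
  rw [sum_congr rfl this, sum_comm]
  refine sum_congr rfl fun j _ => ?_
  rw [sum_ite_eq']
  simp only [mem_range]
  split_ifs <;> tauto

/-! ### Conservation laws of the flow -/

namespace Flow

variable {n L : ℕ} {par cap b : ℕ → ℕ} {core : ℕ → Prop} {s c root gap pre x e : ℕ → ℕ}

/-- Induction along the parents. The amount `e` does not decrease towards the root, because `e (par
k)` has `e k` as a summand. -/
theorem root_spec (F : Flow n L par cap b core s c root gap pre x e) {k : ℕ} (hk : k < n) :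
    root k < n ∧ ¬ par (root k) < n ∧ e k ≤ e (root k) := by
  induction k using Nat.strong_induction_on with
  | _ k ih =>
    by_cases hp : par k < n
    · have hr : root k = root (par k) := by rw [F.root_eq k hk, if_pos hp]
      obtain ⟨h1, h2, h3⟩ := ih (par k) (F.par_lt k hk hp) hp
      rw [hr]
      refine ⟨h1, h2, le_trans ?_ h3⟩
      rw [F.e_eq (par k) hp]
      have := single_le_sum (f := fun j => if par j = par k then e j else 0)
        (fun _ _ => Nat.zero_le _) (mem_range.2 hk)
      simp only [if_true] at this
      omega
    · have hr : root k = k := by rw [F.root_eq k hk, if_neg hp]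
      rw [hr]
      exact ⟨hk, hp, le_rfl⟩

theorem root_of_not (F : Flow n L par cap b core s c root gap pre x e) {k : ℕ} (hk : k < n)
    (h : ¬ par k < n) : root k = k := by rw [F.root_eq k hk, if_neg h]

/-- Two functions whose values on each node differ by the sum over the children. -/
theorem sum_tree (F : Flow n L par cap b core s c root gap pre x e) (f g : ℕ → ℕ)
    (h : ∀ k < n, f k + ∑ j ∈ range n, (if par j = k then g j else 0) = g k + c k * L)
    {ρ : ℕ} (hρ : ρ < n) (hp : ¬ par ρ < n) :
    (∑ k ∈ range n, if root k = ρ then f k else 0) =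
      g ρ + ∑ k ∈ range n, if root k = ρ then c k * L else 0 := by
  have h1 : (∑ k ∈ range n, if root k = ρ then f k else 0) +
      (∑ k ∈ range n, if root k = ρ then ∑ j ∈ range n, (if par j = k then g j else 0) else 0) =
      (∑ k ∈ range n, if root k = ρ then g k else 0) +
        ∑ k ∈ range n, if root k = ρ then c k * L else 0 := by
    rw [← sum_add_distrib, ← sum_add_distrib]
    refine sum_congr rfl fun k hk => ?_
    split_ifs
    · exact h k (mem_range.1 hk)
    · rfl
  rw [sum_children] at h1
  -- Every node of the tree other than `ρ` is a child of a node of the same tree, so everything but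
  -- `g ρ` cancels.
  have h2 : (∑ k ∈ range n, if root k = ρ then g k else 0) =
      g ρ + ∑ j ∈ range n, if par j < n ∧ root (par j) = ρ then g j else 0 := by
    have : ∀ k ∈ range n, (if root k = ρ then g k else 0) =
        (if k = ρ then g k else 0) + if par k < n ∧ root (par k) = ρ then g k else 0 := by
      intro k hk
      rw [mem_range] at hk
      by_cases hkp : par k < n
      · have hne : k ≠ ρ := by rintro rfl; exact hp hkp
        have hr : root k = root (par k) := by rw [F.root_eq k hk, if_pos hkp]
        simp [hne, hkp, hr]
      · simp [F.root_of_not hk hkp, hkp]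
    rw [sum_congr rfl this, sum_add_distrib, sum_ite_eq']
    simp [hρ]
  omega

/-- The `x k` are the increments of the running total of gaps, capped at `s ρ`, so they telescope.
-/
theorem sum_x (F : Flow n L par cap b core s c root gap pre x e) (ρ : ℕ) :
    (∑ k ∈ range n, if root k = ρ then x k else 0) =
      min (s ρ) (∑ k ∈ range n, if root k = ρ then gap k else 0) := by
  suffices ∀ m ≤ n, (∑ k ∈ range m, if root k = ρ then x k else 0) =
      min (s ρ) (∑ k ∈ range m, if root k = ρ then gap k else 0) from this n le_rfl
  intro m
  induction m with
  | zero => simp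
  | succ m ih =>
    intro hm
    rw [sum_range_succ, sum_range_succ, ih (by omega)]
    by_cases h : root m = ρ
    · simp only [h, if_true]
      rw [F.x_eq m hm, F.pre_eq m hm, h]
      omega
    · simp [h]

/-- The tree has `s ρ` clients, and its clusters have a total gap, beyond the `L * c k` clients
already placed. By `sum_x` the smaller of the two surpluses is served in addition. -/
theorem sum_served (F : Flow n L par cap b core s c root gap pre x e) {ρ : ℕ} (hρ : ρ < n)
    (hp : ¬ par ρ < n) :
    (∑ k ∈ range n, if root k = ρ then L * c k + x k else 0) =
      min (∑ k ∈ range n, if root k = ρ then cnt (fun v => b v = k) n else 0)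
        (∑ k ∈ range n, if root k = ρ then c k * cap k else 0) := by
  have h1 := F.sum_tree (fun k => cnt (fun v => b v = k) n) s
    (fun k hk => by rw [← F.bal k hk]; ring) hρ hp
  have h2 : (∑ k ∈ range n, if root k = ρ then c k * cap k else 0) =
      (∑ k ∈ range n, if root k = ρ then gap k else 0) +
        ∑ k ∈ range n, if root k = ρ then c k * L else 0 := by
    rw [← sum_add_distrib]
    refine sum_congr rfl fun k hk => ?_
    rw [mem_range] at hk
    split_ifs
    · rw [F.gap_eq k hk, ← mul_add]
      -- The truncated difference `cap k - L` is exact except possibly at an isolated node without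
      -- clients, where `c k = 0`.
      rcases F.node k hk with h | ⟨hm, -, hch⟩
      · rw [Nat.sub_add_cancel h.1]
      · have hb := F.bal k hk
        rw [hm, sum_eq_zero (fun j hj => by simp [hch j (mem_range.1 hj)])] at hb
        have hc : c k = 0 := by
          rcases Nat.eq_zero_or_pos (c k) with h | h
          · exact h
          · have := Nat.mul_pos F.L_pos h
            omega
        simp [hc]
    · rfl
  have h3 : (∑ k ∈ range n, if root k = ρ then L * c k + x k else 0) =
      (∑ k ∈ range n, if root k = ρ then c k * L else 0) +
        ∑ k ∈ range n, if root k = ρ then x k else 0 := by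
    rw [← sum_add_distrib]
    refine sum_congr rfl fun k hk => ?_
    split_ifs
    · ring
    · rfl
  rw [h1, h2, h3, F.sum_x]
  omega

/-- Down the tree, `e ρ` unfolds to the total of the `x k`, and `sum_x` caps that total by the
remainder at the root. -/
theorem e_root_le (F : Flow n L par cap b core s c root gap pre x e) {ρ : ℕ} (hρ : ρ < n)
    (hp : ¬ par ρ < n) : e ρ ≤ s ρ := by
  have h1 : (∑ k ∈ range n, if root k = ρ then x k else 0) +
      (∑ k ∈ range n, if root k = ρ then ∑ j ∈ range n, (if par j = k then e j else 0) else 0) =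
      (∑ k ∈ range n, if root k = ρ then e k else 0) := by
    rw [← sum_add_distrib]
    refine sum_congr rfl fun k hk => ?_
    split_ifs
    · exact (F.e_eq k (mem_range.1 hk)).symm
    · rfl
  rw [sum_children] at h1
  have h2 : e ρ + (∑ j ∈ range n, if par j < n ∧ root (par j) = ρ then e j else 0) ≤
      ∑ k ∈ range n, if root k = ρ then e k else 0 := by
    have : e ρ = ∑ k ∈ range n, if k = ρ then e k else 0 := by rw [sum_ite_eq']; simp [hρ]
    rw [this, ← sum_add_distrib]
    refine sum_le_sum fun k hk => ?_
    rw [mem_range] at hk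
    by_cases hkp : par k < n
    · have hne : k ≠ ρ := by rintro rfl; exact hp hkp
      have hr : root k = root (par k) := by rw [F.root_eq k hk, if_pos hkp]
      simp [hne, hkp, hr]
    · simp [F.root_of_not hk hkp, hkp]
  rw [F.sum_x] at h1
  omega

theorem e_lt (F : Flow n L par cap b core s c root gap pre x e) {k : ℕ} (hk : k < n) :
    e k < L := by
  obtain ⟨h1, h2, h3⟩ := F.root_spec hk
  have := F.e_root_le h1 h2
  have := F.s_lt _ h1
  omega

/-- The clients leaving node `k` are fewer than its core clients. -/
theorem out_le (F : Flow n L par cap b core s c root gap pre x e) {k : ℕ} (hk : k < n) :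
    (s k - e k) + (∑ j ∈ range n, if par j = k then e j - s j else 0) ≤
      cnt (fun v => b v = k ∧ core v) n := by
  have he := F.e_eq k hk
  have h1 : (∑ j ∈ range n, if par j = k then e j - s j else 0) ≤
      ∑ j ∈ range n, if par j = k then e j else 0 :=
    sum_le_sum fun j _ => by split_ifs <;> omega
  rcases F.node k hk with h | ⟨hm, hp, hch⟩
  -- The children receive at most `e k` in total. So the outflow is at most `s k` if `e k ≤ s k`,
  -- and at most `e k` otherwise; both are below `L`.
  · have := F.s_lt k hk
    have := F.e_lt hk
    omega
  · have hb := F.bal k hk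
    rw [hm, sum_eq_zero (fun j hj => by simp [hch j (mem_range.1 hj)])] at hb
    have hc : s k = 0 := by omega
    rw [sum_eq_zero (fun j hj => by simp [hch j (mem_range.1 hj)])]
    omega

/-- The node to which the core client of rank `r` at node `w` is sent. -/
structure IsDest (n : ℕ) (par s e : ℕ → ℕ) (dest : ℕ → ℕ → ℕ) : Prop where
  up : ∀ w < n, ∀ r, r < s w - e w → dest w r = par w
  down : ∀ w < n, ∀ r, ∀ j < n, par j = w →
    (s w - e w) + (∑ i ∈ range j, if par i = w then e i - s i else 0) ≤ r →
    r < (s w - e w) + (∑ i ∈ range j, if par i = w then e i - s i else 0) + (e j - s j) →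
    dest w r = j
  stay : ∀ w < n, ∀ r, ¬ r < s w - e w → (∀ j < n, par j = w →
    (s w - e w) + (∑ i ∈ range j, if par i = w then e i - s i else 0) ≤ r →
    ¬ r < (s w - e w) + (∑ i ∈ range j, if par i = w then e i - s i else 0) + (e j - s j)) →
    dest w r = w

/-- The ranks at `w` are cut into consecutive blocks: `s w - e w` for the parent, then `e j - s j`
for each child `j`, and the rest stays. Truncated subtraction lets only the net amount cross an
edge, in one direction. -/
theorem dest_cases (_ : Flow n L par cap b core s c root gap pre x e) {dest : ℕ → ℕ → ℕ}
    (hd : IsDest n par s e dest) {w : ℕ} (hw : w < n) (r : ℕ) :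
    (r < s w - e w ∧ dest w r = par w) ∨
    (∃ j < n, par j = w ∧
      (s w - e w) + (∑ i ∈ range j, if par i = w then e i - s i else 0) ≤ r ∧
      r < (s w - e w) + (∑ i ∈ range j, if par i = w then e i - s i else 0) + (e j - s j) ∧
      r < (s w - e w) + (∑ i ∈ range n, if par i = w then e i - s i else 0) ∧
      dest w r = j) ∨
    ((s w - e w) + (∑ i ∈ range n, if par i = w then e i - s i else 0) ≤ r ∧ dest w r = w) := by
  by_cases h1 : r < s w - e w
  · exact .inl ⟨h1, hd.up w hw r h1⟩
  by_cases h2 : r < (s w - e w) + (∑ i ∈ range n, if par i = w then e i - s i else 0)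
  · obtain ⟨j, hj, hj1, hj2⟩ := exists_prefix (fun i => if par i = w then e i - s i else 0)
      (n := n) (i := r - (s w - e w)) (by omega)
    have hpj : par j = w := by
      by_contra hne
      simp only [hne, if_false] at hj2
      omega
    simp only [hpj, if_true] at hj2
    have a1 : (s w - e w) + (∑ i ∈ range j, if par i = w then e i - s i else 0) ≤ r := by omega
    have a2 : r < (s w - e w) + (∑ i ∈ range j, if par i = w then e i - s i else 0) +
      (e j - s j) := by omega
    exact .inr (.inl ⟨j, hj, hpj, a1, a2, h2, hd.down w hw r j hj hpj a1 a2⟩)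
  · refine .inr (.inr ⟨by omega, hd.stay w hw r h1 fun j hj hpj _ h4 => ?_⟩)
    have := prefix_mono (fun i => if par i = w then e i - s i else 0) (Nat.succ_le_of_lt hj)
    rw [Nat.succ_eq_add_one, sum_range_succ] at this
    simp only [hpj, if_true] at this
    omega

/-- By `out_le` all blocks of outgoing ranks fit among the core clients of `w`, so every neighbour
receives its full block. -/
theorem cnt_dest (F : Flow n L par cap b core s c root gap pre x e) {dest : ℕ → ℕ → ℕ}
    (hd : IsDest n par s e dest) {w k : ℕ} (hw : w < n) (hk : k < n) :
    cnt (fun r => dest w r = k) (cnt (fun v => b v = w ∧ core v) n) =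
      (if w = k then cnt (fun v => b v = k ∧ core v) n -
        ((s k - e k) + ∑ j ∈ range n, if par j = k then e j - s j else 0) else 0) +
      (if par k = w then e k - s k else 0) + (if par w = k then s w - e w else 0) := by
  have hout := F.out_le hw
  set κ := cnt (fun v => b v = w ∧ core v) n with hκ
  have hch : ∀ j < n, par j = w → w < j := fun j hj h => h ▸ F.par_lt j hj (h ▸ hw)
  by_cases h1 : w = k
  · subst h1
    have hpw : par w ≠ w := fun h => (hch w hw h).false
    rw [if_pos rfl, if_neg hpw, if_neg hpw, ← cnt_interval le_rfl]
    refine cnt_congr fun r hr => ?_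
    rcases F.dest_cases hd hw r with ⟨a, a'⟩ | ⟨j, hj, hpj, -, -, a, a'⟩ | ⟨a, a'⟩
    · simp only [a', hpw, false_iff]
      omega
    · have := hch j hj hpj
      simp only [a']
      omega
    · simp only [a', true_iff]
      exact ⟨a, hr⟩
  rw [if_neg h1]
  by_cases h2 : par k = w
  · have hwk := hch k hk h2
    have h3 : par w ≠ k := fun h => by have := F.par_lt w hw (h ▸ hk); omega
    rw [if_pos h2, if_neg h3]
    set Fk := ∑ i ∈ range k, if par i = w then e i - s i else 0 with hFk
    have hle := prefix_mono (fun i => if par i = w then e i - s i else 0) (Nat.succ_le_of_lt hk)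
    rw [Nat.succ_eq_add_one, sum_range_succ] at hle
    simp only [h2, if_true] at hle
    have : ∀ r < κ, dest w r = k ↔
        (s w - e w) + Fk ≤ r ∧ r < (s w - e w) + Fk + (e k - s k) := by
      intro r _
      refine ⟨fun h => ?_, fun h => hd.down w hw r k hk h2 h.1 h.2⟩
      rcases F.dest_cases hd hw r with ⟨a, a'⟩ | ⟨j, hj, hpj, a, a'', -, a'⟩ | ⟨a, a'⟩
      · exact absurd (a'.symm.trans h) h3
      · obtain rfl : j = k := a'.symm.trans h
        exact ⟨a, a''⟩
      · exact absurd (a'.symm.trans h) h1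
    rw [cnt_congr this, cnt_interval]
    · omega
    · omega
  rw [if_neg h2]
  by_cases h3 : par w = k
  · rw [if_pos h3]
    have : ∀ r < κ, dest w r = k ↔ 0 ≤ r ∧ r < s w - e w := by
      intro r _
      refine ⟨fun h => ?_, fun h => (hd.up w hw r h.2).trans h3⟩
      rcases F.dest_cases hd hw r with ⟨a, a'⟩ | ⟨j, hj, hpj, a, a'', -, a'⟩ | ⟨a, a'⟩
      · omega
      · obtain rfl : j = k := a'.symm.trans h
        exact absurd hpj h2
      · exact absurd (a'.symm.trans h) h1
    rw [cnt_congr this, cnt_interval]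
    · omega
    · omega
  · rw [if_neg h3]
    refine cnt_eq_zero fun r _ h => ?_
    rcases F.dest_cases hd hw r with ⟨a, a'⟩ | ⟨j, hj, hpj, a, a'', -, a'⟩ | ⟨a, a'⟩
    · exact h3 (a'.symm.trans h)
    · obtain rfl : j = k := a'.symm.trans h
      exact h2 hpj
    · exact h1 (a'.symm.trans h)

/-- After the redistribution, node `k` has `L * c k + x k` clients. -/
theorem cnt_target (F : Flow n L par cap b core s c root gap pre x e) {dest : ℕ → ℕ → ℕ}
    (hd : IsDest n par s e dest) {tgt : ℕ → ℕ}
    (ht : ∀ v < n, b v < n → core v →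
      tgt v = dest (b v) (cnt (fun u => b u = b v ∧ core u) v))
    (ht' : ∀ v < n, ¬ (b v < n ∧ core v) → tgt v = b v) {k : ℕ} (hk : k < n) :
    cnt (fun v => tgt v = k) n = L * c k + x k := by
  have h1 : cnt (fun v => tgt v = k) n = cnt (fun v => b v = k ∧ ¬ core v) n +
      ∑ w ∈ range n, cnt (fun r => dest w r = k) (cnt (fun v => b v = w ∧ core v) n) := by
    have h2 : ∀ w, cnt (fun r => dest w r = k) (cnt (fun v => b v = w ∧ core v) n) =
        cnt (fun v => (core v ∧ tgt v = k) ∧ b v = w ∧ w < n) n ∨ ¬ w < n := by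
      intro w
      by_cases hw : w < n
      · left
        rw [← cnt_and_rank]
        refine cnt_congr fun v hv => ?_
        constructor
        · rintro ⟨⟨rfl, h⟩, h'⟩
          exact ⟨⟨h, (ht v hv hw h).trans h'⟩, rfl, hw⟩
        · rintro ⟨⟨h, h'⟩, rfl, -⟩
          exact ⟨⟨rfl, h⟩, (ht v hv hw h).symm.trans h'⟩
      · exact .inr hw
    have h3 : ∑ w ∈ range n, cnt (fun r => dest w r = k) (cnt (fun v => b v = w ∧ core v) n) =
        ∑ w ∈ range n, cnt (fun v => (core v ∧ tgt v = k) ∧ b v = w) n := by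
      refine sum_congr rfl fun w hw => ?_
      rw [mem_range] at hw
      rw [(h2 w).resolve_right (by omega)]
      exact cnt_congr fun v _ => by tauto
    rw [h3, ← cnt_eq_sum_fiber, ← cnt_or (by tauto)]
    refine cnt_congr fun v hv => ?_
    by_cases hc : b v < n ∧ core v
    · tauto
    · rw [ht' v hv hc]
      constructor
      · rintro rfl
        left
        tauto
      · rintro (h | ⟨⟨h, -⟩, h'⟩)
        · exact h.1
        · exact absurd ⟨h', h⟩ hc
  rw [h1, sum_congr rfl fun w hw => F.cnt_dest hd (mem_range.1 hw) hk, sum_add_distrib,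
    sum_add_distrib, sum_ite_eq', if_pos (mem_range.2 hk), sum_ite_eq]
  -- A root has no parent to receive clients from, and expects none since `e k ≤ s k` there.
  have hdn : (if par k ∈ range n then e k - s k else 0) = e k - s k := by
    split_ifs with h
    · rfl
    · rw [mem_range] at h
      have := F.e_root_le hk h
      omega
  have hsplit : cnt (fun v => b v = k ∧ ¬ core v) n + cnt (fun v => b v = k ∧ core v) n =
      cnt (fun v => b v = k) n := cnt_and_not_add
  have hout := F.out_le hk
  have hb := F.bal k hk
  have he := F.e_eq k hk
  -- Edge by edge, with truncated differences, `(e - s) + s = (s - e) + e`. This turns net flows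
  -- into the gross flows of the two balance equations.
  have hsum : (∑ j ∈ range n, if par j = k then e j - s j else 0) +
      (∑ j ∈ range n, if par j = k then s j else 0) =
      (∑ j ∈ range n, if par j = k then s j - e j else 0) +
      ∑ j ∈ range n, if par j = k then e j else 0 := by
    rw [← sum_add_distrib, ← sum_add_distrib]
    refine sum_congr rfl fun j _ => ?_
    split_ifs <;> omega
  omega

end Flow

/-! ### Maximum spanning forests -/

/-- `par` is the parent function of a maximum spanning forest, found by Prim's algorithm, of the
graph `A` on the nodes `0, …, n - 1` (in the order in which the algorithm adds them), where the
edge `i j` has weight `min (cap i) (cap j)`. -/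
structure IsPrim (n : ℕ) (par cap : ℕ → ℕ) (A : ℕ → ℕ → Prop) : Prop where
  par_lt : ∀ k < n, par k < n → par k < k
  adj : ∀ k < n, par k < n → A (par k) k
  max : ∀ k < n, par k < n → ∀ i < k, ∀ j < n, k ≤ j → A i j →
    min (cap i) (cap j) ≤ min (cap (par k)) (cap k)
  root : ∀ k < n, ¬ par k < n → ∀ i < k, ∀ j < n, k ≤ j → ¬ A i j

/-- The highest node that is reached from `k` through parents without passing a node of capacity
below `t`. -/
def topNode (par cap : ℕ → ℕ) (t k : ℕ) : ℕ :=
  if par k < k ∧ t ≤ cap k ∧ t ≤ cap (par k) then topNode par cap t (par k) else k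
termination_by k
decreasing_by omega

/-! ### Components above a capacity threshold -/

section topNode

variable {n : ℕ} {par cap : ℕ → ℕ} {A : ℕ → ℕ → Prop}

theorem topNode_of_par {t k : ℕ} (h : par k < k ∧ t ≤ cap k ∧ t ≤ cap (par k)) :
    topNode par cap t k = topNode par cap t (par k) := by rw [topNode, if_pos h]

theorem topNode_le (t k : ℕ) : topNode par cap t k ≤ k := by
  induction k using Nat.strong_induction_on with
  | _ k ih =>
    rw [topNode]
    split_ifs with h
    · exact (ih _ h.1).trans h.1.le
    · exact le_rfl

/-- Climbing along parents stays in the tree, so the class of a top node never meets two trees. -/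
theorem topNode_invariant {root : ℕ → ℕ} (hroot : ∀ k < n, root k = if par k < n then root (par k) else k)
    (t : ℕ) {k : ℕ} (hk : k < n) : root (topNode par cap t k) = root k := by
  induction k using Nat.strong_induction_on with
  | _ k ih =>
    rw [topNode]
    split_ifs with h
    · rw [ih _ h.1 (by omega), hroot k hk, if_pos (by omega)]
    · rfl

/-- At threshold `0` no edge is cut, so statements about classes apply to whole trees. -/
theorem root_eq_topNode_zero (P : IsPrim n par cap A) {root : ℕ → ℕ}
    (hroot : ∀ k < n, root k = if par k < n then root (par k) else k) {k : ℕ} (hk : k < n) :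
    root k = topNode par cap 0 k := by
  induction k using Nat.strong_induction_on with
  | _ k ih =>
    rw [topNode, hroot k hk]
    by_cases h : par k < n
    · have := P.par_lt k hk h
      rw [if_pos h, if_pos ⟨this, by simp, by simp⟩, ih _ this h]
    · rw [if_neg h, if_neg (by omega)]

/-- Prim's algorithm does not leave a component of the graph above `t` before exhausting it.
Accordingly, the second clause of `key` says that all edges of weight at least `t` leaving the
processed prefix start in one class. -/
theorem topNode_eq_of_adj (hA : ∀ i j, A i j → A j i) (P : IsPrim n par cap A) {t i j : ℕ} (hi : i < n) (hj : j < n)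
    (hti : t ≤ cap i) (htj : t ≤ cap j) (h : A i j) :
    topNode par cap t i = topNode par cap t j := by
  have key : ∀ k ≤ n,
      (∀ i < k, ∀ j < k, t ≤ cap i → t ≤ cap j → A i j →
        topNode par cap t i = topNode par cap t j) ∧
      (∀ i < k, ∀ i' < k, ∀ j < n, ∀ j' < n, k ≤ j → k ≤ j' → t ≤ cap i → t ≤ cap i' →
        t ≤ cap j → t ≤ cap j' → A i j → A i' j' →
        topNode par cap t i = topNode par cap t i') := by
    intro k
    induction k with
    | zero => simp
    | succ k ih =>
      intro hk
      obtain ⟨h1, h2⟩ := ih (by omega)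
      -- An edge of weight at least `t` crosses the cut, so the chosen edge from `par k` to `k` is
      -- at least as heavy. The second clause then puts `par k` and `i` into one class.
      have hlink : ∀ i < k, ∀ j < n, k ≤ j → t ≤ cap i → t ≤ cap j → A i j → t ≤ cap k →
          topNode par cap t i = topNode par cap t k := by
        intro i hi j hj hkj hti htj hij htk
        have hp : par k < n := by
          by_contra hp
          exact P.root k hk hp i hi j hj hkj hij
        have hpk := P.par_lt k hk hp
        have hm := P.max k hk hp i hi j hj hkj hij
        have htp : t ≤ cap (par k) := by
          have : t ≤ min (cap i) (cap j) := le_min hti htj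
          omega
        rw [topNode_of_par (k := k) ⟨hpk, htk, htp⟩]
        exact h2 i hi (par k) hpk j hj k hk hkj le_rfl hti htp htj htk hij (P.adj k hk hp)
      refine ⟨fun i hi j hj hti htj hij => ?_,
        fun i hi i' hi' j hj j' hj' hkj hkj' hti hti' htj htj' hij hij' => ?_⟩
      · rcases Nat.lt_succ_iff_lt_or_eq.1 hi with hi | rfl
        · rcases Nat.lt_succ_iff_lt_or_eq.1 hj with hj | rfl
          · exact h1 i hi j hj hti htj hij
          · exact hlink i hi j hk le_rfl hti htj hij htj
        · rcases Nat.lt_succ_iff_lt_or_eq.1 hj with hj | rfl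
          · exact (hlink j hj i hk le_rfl htj hti (hA _ _ hij) hti).symm
          · rfl
      · rcases Nat.lt_succ_iff_lt_or_eq.1 hi with hi | rfl
        · rcases Nat.lt_succ_iff_lt_or_eq.1 hi' with hi' | rfl
          · exact h2 i hi i' hi' j hj j' hj' (by omega) (by omega) hti hti' htj htj' hij hij'
          · exact hlink i hi j hj (by omega) hti htj hij hti'
        · rcases Nat.lt_succ_iff_lt_or_eq.1 hi' with hi' | rfl
          · exact (hlink i' hi' j' hj' (by omega) hti' htj' hij' hti).symm
          · rfl
  exact (key n le_rfl).1 i hi j hj hti htj h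

end topNode

/-! ### Comparison with an arbitrary solution -/

namespace Flow

variable {n L : ℕ} {par cap b : ℕ → ℕ} {core : ℕ → Prop} {s c root gap pre x e : ℕ → ℕ}
  {A : ℕ → ℕ → Prop}

/-- A class of nodes connected above the threshold `t` loses fewer than `L` clients. -/
theorem class_bound (F : Flow n L par cap b core s c root gap pre x e) (t q : ℕ) :
    (∑ k ∈ range n, if t ≤ cap k ∧ topNode par cap t k = q then cnt (fun v => b v = k) n else 0) <
      L * (∑ k ∈ range n, if t ≤ cap k ∧ topNode par cap t k = q then c k else 0) + L := by
  set Q : ℕ → Prop := fun k => t ≤ cap k ∧ topNode par cap t k = q with hQ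
  have h1 : (∑ k ∈ range n, if Q k then cnt (fun v => b v = k) n else 0) +
      (∑ k ∈ range n, if Q k then ∑ j ∈ range n, (if par j = k then s j else 0) else 0) =
      L * (∑ k ∈ range n, if Q k then c k else 0) + ∑ k ∈ range n, if Q k then s k else 0 := by
    rw [mul_sum, ← sum_add_distrib, ← sum_add_distrib]
    refine sum_congr rfl fun k hk => ?_
    split_ifs
    · exact (F.bal k (mem_range.1 hk)).symm
    · simp
  rw [sum_children] at h1
  -- The remainder of a node of the class is passed to a node of the class, unless the node is the
  -- top `q`.
  have h2 : (∑ k ∈ range n, if Q k then s k else 0) ≤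
      (∑ k ∈ range n, if k = q then s k else 0) +
        ∑ j ∈ range n, if par j < n ∧ Q (par j) then s j else 0 := by
    rw [← sum_add_distrib]
    refine sum_le_sum fun k hk => ?_
    rw [mem_range] at hk
    by_cases hQk : Q k
    · rw [if_pos hQk]
      by_cases hkp : par k < k ∧ t ≤ cap k ∧ t ≤ cap (par k)
      · have : Q (par k) := ⟨hkp.2.2, (topNode_of_par hkp).symm.trans hQk.2⟩
        rw [if_pos (⟨by omega, this⟩ : par k < n ∧ Q (par k))]
        omega
      · have : k = q := by rw [← hQk.2, topNode, if_neg hkp]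
        rw [if_pos this]
        omega
    · simp [hQk]
  have h3 : (∑ k ∈ range n, if k = q then s k else 0) < L := by
    rw [sum_ite_eq']
    split_ifs with h
    · exact F.s_lt q (mem_range.1 h)
    · exact F.L_pos
  change (∑ k ∈ range n, if Q k then cnt (fun v => b v = k) n else 0) <
      L * (∑ k ∈ range n, if Q k then c k else 0) + L
  omega

/-- Disjoint clusters of size between `L` and `u j`, each contained in the nodes of a clique of
nodes with capacity at least `u j`, have at most as many clients as are served by the flow. -/
theorem card_le_served (F : Flow n L par cap b core s c root gap pre x e)
    (hA : ∀ i j, A i j → A j i) (P : IsPrim n par cap A)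
    {ι : Type*} (J : Finset ι) (X : ι → Finset ℕ) (u : ι → ℕ)
    (hdisj : (J : Set ι).PairwiseDisjoint X)
    (hL : ∀ j ∈ J, L ≤ #(X j)) (hU : ∀ j ∈ J, #(X j) ≤ u j)
    (hX : ∀ j ∈ J, ∀ v ∈ X j, v < n ∧ b v < n ∧ u j ≤ cap (b v))
    (hclique : ∀ j ∈ J, ∀ v ∈ X j, ∀ v' ∈ X j, A (b v) (b v')) :
    ∑ j ∈ J, #(X j) ≤ ∑ k ∈ range n, (L * c k + x k) := by
  classical
  have hne : ∀ j ∈ J, ∃ v, v ∈ X j := fun j hj =>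
    card_pos.1 (F.L_pos.trans_le (hL j hj))
  choose! rep hrep using hne
  set β : ι → ℕ := fun j => b (rep j) with hβ
  have htop : ∀ j ∈ J, ∀ t ≤ u j, ∀ v ∈ X j,
      topNode par cap t (b v) = topNode par cap t (β j) := fun j hj t ht v hv =>
    topNode_eq_of_adj hA P (hX j hj v hv).2.1 (hX j hj _ (hrep j hj)).2.1
      (ht.trans (hX j hj v hv).2.2) (ht.trans (hX j hj _ (hrep j hj)).2.2)
      (hclique j hj v hv _ (hrep j hj))
  have hroot : ∀ j ∈ J, ∀ v ∈ X j, root (b v) = root (β j) := fun j hj v hv => by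
    rw [root_eq_topNode_zero P F.root_eq (hX j hj v hv).2.1,
      root_eq_topNode_zero P F.root_eq (hX j hj _ (hrep j hj)).2.1]
    exact htop j hj 0 (Nat.zero_le _) v hv
  -- Disjoint clusters inside a set of nodes use no more clients than start there. This is applied
  -- to a tree and to a threshold class.
  have hsub : ∀ J' ⊆ J, ∀ Q : ℕ → Prop, [DecidablePred Q] → (∀ j ∈ J', ∀ v ∈ X j, Q (b v)) →
      ∑ j ∈ J', #(X j) ≤ ∑ k ∈ range n, if Q k then cnt (fun v => b v = k) n else 0 := by
    intro J' hJ' Q _ hQ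
    rw [← card_biUnion fun i hi j hj hij => hdisj (hJ' hi) (hJ' hj) hij]
    have : ∀ k ∈ range n, (if Q k then cnt (fun v => b v = k) n else 0) =
        cnt (fun v => Q (b v) ∧ b v = k) n := by
      intro k _
      split_ifs with h
      · exact cnt_congr fun v _ => ⟨fun h' => ⟨h' ▸ h, h'⟩, fun h' => h'.2⟩
      · exact (cnt_eq_zero (by rintro v - ⟨h', rfl⟩; exact h h')).symm
    rw [sum_congr rfl this, ← cnt_eq_sum_fiber, cnt_eq_card]
    refine card_le_card fun v hv => ?_
    obtain ⟨j, hj, hv⟩ := mem_biUnion.1 hv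
    obtain ⟨h1, h2, -⟩ := hX j (hJ' hj) v hv
    simp only [mem_filter, mem_range]
    exact ⟨h1, hQ j hj v hv, h2⟩
  have hβn : ∀ j ∈ J, β j < n := fun j hj => (hX j hj _ (hrep j hj)).2.1
  rw [← sum_fiberwise_of_maps_to (s := J) (t := range n) (g := fun j => root (β j))
    fun j hj => mem_range.2 (F.root_spec (hβn j hj)).1]
  rw [← sum_fiberwise_of_maps_to (s := range n) (t := range n) (g := root)
    (f := fun k => L * c k + x k)
    fun k hk => mem_range.2 (F.root_spec (mem_range.1 hk)).1]
  refine sum_le_sum fun ρ hρ => ?_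
  rw [mem_range] at hρ
  by_cases hp : par ρ < n
  · have : {j ∈ J | root (β j) = ρ} = (∅ : Finset ι) := by
      rw [filter_eq_empty_iff]
      rintro j hj rfl
      exact (F.root_spec (hβn j hj)).2.1 hp
    simp [this]
  rw [sum_filter (s := range n), F.sum_served hρ hp]
  refine le_min ?_ ?_
  · refine hsub _ (filter_subset _ _) (fun k => root k = ρ) fun j hj v hv => ?_
    rw [mem_filter] at hj
    exact (hroot j hj.1 v hv).trans hj.2
  · rw [← sum_filter]
    refine (sum_le_sum fun j hj => hU j (mem_of_mem_filter j hj)).trans ?_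
    -- It remains to compare, for each `t`, how many clusters have bound above `t`. These are
    -- counted class by class at threshold `t + 1`.
    refine sum_le_sum_mul_of_card_le _ u _ c cap fun t => ?_
    rw [filter_filter]
    set J' := {j ∈ J | root (β j) = ρ ∧ t < u j} with hJ'
    have hmem : ∀ j ∈ J', j ∈ J ∧ root (β j) = ρ ∧ t < u j := fun j hj => mem_filter.1 hj
    have hcap : ∀ j ∈ J', t + 1 ≤ cap (β j) := fun j hj =>
      (Nat.succ_le_of_lt (hmem j hj).2.2).trans (hX j (hmem j hj).1 _ (hrep j (hmem j hj).1)).2.2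
    rw [← sum_filter, filter_filter]
    set T := topNode par cap (t + 1) with hT
    have hTn : ∀ k < n, T k < n := fun k hk => (topNode_le _ _).trans_lt hk
    rw [card_eq_sum_card_fiberwise (f := fun j => T (β j)) (t := range n)
      fun j hj => mem_coe.2 (mem_range.2 (hTn _ (hβn j (hmem j hj).1)))]
    rw [← sum_fiberwise_of_maps_to (t := range n) (g := T) (f := c) fun k hk =>
      mem_range.2 (hTn k (mem_range.1 (mem_of_mem_filter k hk)))]
    refine sum_le_sum fun q hq => ?_
    rw [mem_range] at hq
    by_cases hqρ : root q = ρ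
    · have h1 := hsub {j ∈ J' | T (β j) = q} (fun j hj => (hmem j (mem_of_mem_filter j hj)).1)
        (fun k => t + 1 ≤ cap k ∧ topNode par cap (t + 1) k = q) fun j hj v hv => by
          rw [mem_filter] at hj
          obtain ⟨hjJ, -, htu⟩ := hmem j hj.1
          exact ⟨(Nat.succ_le_of_lt htu).trans (hX j hjJ v hv).2.2,
            (htop j hjJ (t + 1) htu v hv).trans hj.2⟩
      have h2 := F.class_bound (t + 1) q
      have h3 : #{j ∈ J' | T (β j) = q} * L ≤ ∑ j ∈ J' with T (β j) = q, #(X j) := by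
        rw [← smul_eq_mul]
        exact card_nsmul_le_sum _ _ _ fun j hj => hL j (hmem j (mem_of_mem_filter j hj)).1
      -- Each of the counted clusters uses at least `L` clients of the class, which has fewer than
      -- `L` times one more than its number of flow clusters.
      have h4 : #{j ∈ J' | T (β j) = q} <
          (∑ k ∈ range n, if t + 1 ≤ cap k ∧ topNode par cap (t + 1) k = q then c k else 0) + 1 := by
        refine lt_of_mul_lt_mul_left (a := L) ?_ (Nat.zero_le _)
        rw [mul_add, mul_one, mul_comm]
        omega
      refine (Nat.lt_succ_iff.1 h4).trans (le_of_eq ?_)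
      rw [← sum_filter]
      refine sum_congr ?_ fun _ _ => rfl
      ext k
      simp only [mem_filter, mem_range, ← hT, Nat.succ_le_iff]
      constructor
      · rintro ⟨hk, h5, h6⟩
        refine ⟨⟨hk, ?_, h5⟩, h6⟩
        rw [← hqρ, ← h6, hT, topNode_invariant F.root_eq _ hk]
      · rintro ⟨⟨hk, -, h5⟩, h6⟩
        exact ⟨hk, h5, h6⟩
    · have : {j ∈ J' | T (β j) = q} = (∅ : Finset ι) := by
        rw [filter_eq_empty_iff]
        rintro j hj h
        refine hqρ ?_
        rw [← h, hT, topNode_invariant F.root_eq _ (hβn j (hmem j hj).1)]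
        exact (hmem j hj).2.1
      simp [this]

end Flow

/-! ### Splitting into clusters -/

/-- The clients at node `k` are dealt cyclically, by rank, to its `c k` clusters; the numbers of
these clusters form the block starting at the prefix sum. `cnt_mod_bounds` gives the sizes. -/
theorem cnt_copy {n L : ℕ} {tgt c cap asg : ℕ → ℕ}
    (hlo : ∀ k < n, c k * L ≤ cnt (fun v => tgt v = k) n)
    (hup : ∀ k < n, cnt (fun v => tgt v = k) n ≤ c k * cap k)
    (hasg : ∀ v < n, tgt v < n → asg v = ∑ j ∈ range (tgt v), c j +
      cnt (fun u => tgt u = tgt v) v % c (tgt v)) :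
    (∀ v < n, tgt v < n → ∑ j ∈ range (tgt v), c j ≤ asg v ∧
      asg v < ∑ j ∈ range (tgt v), c j + c (tgt v)) ∧
    ∀ k < n, ∀ i, ∑ j ∈ range k, c j ≤ i → i < ∑ j ∈ range k, c j + c k →
      L ≤ cnt (fun v => tgt v < n ∧ asg v = i) n ∧
      cnt (fun v => tgt v < n ∧ asg v = i) n ≤ cap k := by
  have hlt : ∀ v < n, tgt v < n → ∑ j ∈ range (tgt v), c j ≤ asg v ∧
      asg v < ∑ j ∈ range (tgt v), c j + c (tgt v) := by
    intro v hv ht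
    have hpos : 0 < c (tgt v) := by
      rcases Nat.eq_zero_or_pos (c (tgt v)) with h | h
      · have h1 := hup _ ht
        rw [h, zero_mul] at h1
        have h2 : 0 < cnt (fun u => tgt u = tgt v) n := cnt_pos hv rfl
        omega
      · exact h
    have := Nat.mod_lt (cnt (fun u => tgt u = tgt v) v) hpos
    rw [hasg v hv ht]
    omega
  refine ⟨hlt, fun k hk i hi hi' => ?_⟩
  have h1 : cnt (fun v => tgt v < n ∧ asg v = i) n =
      cnt (fun r => r % c k = i - ∑ j ∈ range k, c j) (cnt (fun v => tgt v = k) n) := by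
    rw [← cnt_and_rank]
    refine cnt_congr fun v hv => ?_
    constructor
    · rintro ⟨ht, rfl⟩
      obtain ⟨h2, h3⟩ := hlt v hv ht
      obtain rfl := prefix_unique c h2 h3 hi hi'
      refine ⟨rfl, ?_⟩
      rw [hasg v hv ht]
      omega
    · rintro ⟨rfl, h⟩
      refine ⟨hk, ?_⟩
      rw [hasg v hv hk, h]
      omega
  rw [h1]
  exact cnt_mod_bounds (by omega) (hlo k hk) (hup k hk)

/-! ### Evaluation of terms -/

open Classical in
/-- The least `i < n` with `p i`, and `n` if there is none. -/
noncomputable def first (p : ℕ → Prop) (n : ℕ) : ℕ :=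
  if h : ∃ i, i < n ∧ p i then Nat.find h else n

theorem first_le (p : ℕ → Prop) (n : ℕ) : first p n ≤ n := by
  classical
  rw [first]
  split_ifs with h
  · exact (Nat.find_spec h).1.le
  · exact le_rfl

theorem first_spec {p : ℕ → Prop} {n : ℕ} (h : first p n < n) : p (first p n) := by
  classical
  rw [first] at h ⊢
  split_ifs with h'
  · exact (Nat.find_spec h').2
  · rw [dif_neg h'] at h
    exact absurd h (lt_irrefl n)

theorem first_lt {p : ℕ → Prop} {n i : ℕ} (hi : i < n) (h : p i) : first p n < n := by
  classical
  have h' : ∃ i, i < n ∧ p i := ⟨i, hi, h⟩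
  rw [first, dif_pos h']
  exact (Nat.find_spec h').1

theorem first_min {p : ℕ → Prop} {n i : ℕ} (h : i < first p n) : ¬ p i := by
  classical
  intro hp
  have hi : i < n := h.trans_le (first_le p n)
  have h' : ∃ i, i < n ∧ p i := ⟨i, hi, hp⟩
  rw [first, dif_pos h'] at h
  exact Nat.find_min h' h ⟨hi, hp⟩

theorem first_eq {p : ℕ → Prop} {n i : ℕ} (hi : i < n) (h : p i) (hu : ∀ j < n, p j → j = i) :
    first p n = i :=
  hu _ (first_lt hi h) (first_spec (first_lt hi h))

theorem first_congr {p q : ℕ → Prop} {n : ℕ} (h : ∀ i < n, p i ↔ q i) : first p n = first q n := by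
  have key : ∀ {p q : ℕ → Prop}, (∀ i < n, p i ↔ q i) → first p n ≤ first q n := by
    intro p q h
    by_contra! hlt
    have hq := hlt.trans_le (first_le p n)
    exact first_min hlt ((h _ hq).2 (first_spec hq))
  exact le_antisymm (key h) (key fun i hi => (h i hi).symm)

theorem accum_add (f : ℕ → ℕ) (n : ℕ) :
    accum (fun _ acc v => acc + v) f n = ∑ i ∈ range n, f i := by
  induction n with
  | zero => rfl
  | succ n ih => rw [accum, ih, sum_range_succ]

theorem accum_search (f : ℕ → ℕ) (n : ℕ) : accum searchStep f n = first (fun i => f i ≠ 0) n := by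
  -- The accumulator advances only while it equals the current index, so it stops at the first
  -- nonzero value.
  suffices h : accum searchStep f n ≤ n ∧ (∀ i < accum searchStep f n, f i = 0) ∧
      (accum searchStep f n < n → f (accum searchStep f n) ≠ 0) by
    obtain ⟨h1, h2, h3⟩ := h
    apply le_antisymm
    · by_contra! hlt
      exact first_spec (hlt.trans_le h1) (h2 _ hlt)
    · by_contra! hlt
      exact first_min hlt (h3 (hlt.trans_le (first_le _ _)))
  induction n with
  | zero => simp [accum]
  | succ n ih =>
    obtain ⟨h1, h2, h3⟩ := ih
    rw [accum, searchStep]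
    generalize accum searchStep f n = r at *
    by_cases hr : n ≤ r
    · obtain rfl : r = n := le_antisymm h1 hr
      by_cases hf : f r = 0
      · simp only [le_refl, if_true, hf, Nat.sub_zero]
        refine ⟨trivial, fun i hi => ?_, by simp⟩
        rcases Nat.lt_succ_iff_lt_or_eq.1 hi with hi | rfl
        · exact h2 i hi
        · exact hf
      · have : 1 - f r = 0 := by omega
        simp only [le_refl, if_true, this, add_zero]
        exact ⟨by omega, h2, fun _ => hf⟩
    · simp only [if_neg hr, Nat.zero_sub, add_zero]
      exact ⟨by omega, h2, fun _ => h3 (by omega)⟩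

namespace Term

/-- The term is true. -/
def tr (D : ℕ → ℕ → ℝ≥0) (e : Term) (s : State) : Prop := e.eval D s ≠ 0

def and (a b : Term) : Term := .ite a b (.const 0)
def or (a b : Term) : Term := .ite a (.const 1) b
def not (a : Term) : Term := .ite a (.const 0) (.const 1)
def imp (a b : Term) : Term := .ite a b (.const 1)
def lt (a b : Term) : Term := .le (.add a (.const 1)) b
def eq (a b : Term) : Term := and (.le a b) (.le b a)
def any (x : ℕ) (e : Term) : Term := .sum x e
def all (x : ℕ) (e : Term) : Term := not (any x (not e))
def count (x : ℕ) (e : Term) : Term := .sum x (.ite e (.const 1) (.const 0))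
def sumIf (x : ℕ) (c e : Term) : Term := .sum x (.ite c e (.const 0))
def min (a b : Term) : Term := .ite (.le a b) a b
/-- The product of `a ≤ n` and `b`. -/
def mul (x : ℕ) (a b : Term) : Term := sumIf x (lt (.var x) a) b
/-- The quotient of `a ≤ n * b` by `b`. -/
def div (x y : ℕ) (a b : Term) : Term := count x (.le (mul y (.add (.var x) (.const 1)) b) a)

variable {D : ℕ → ℕ → ℝ≥0} {s : State} {a b c e e₁ e₂ e₃ e₄ : Term} {x y i : ℕ}

@[simp] theorem eval_const : (const i).eval D s = i := rfl
@[simp] theorem eval_var : (var x).eval D s = s.var x := rfl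
@[simp] theorem eval_get : (get x e).eval D s = s.arr x (e.eval D s) := rfl
@[simp] theorem eval_add : (add e₁ e₂).eval D s = e₁.eval D s + e₂.eval D s := rfl
@[simp] theorem eval_sub : (sub e₁ e₂).eval D s = e₁.eval D s - e₂.eval D s := rfl
open Classical in
@[simp] theorem eval_ite : (ite c a b).eval D s = if c.tr D s then a.eval D s else b.eval D s := by
  simp only [eval, tr]
  congr
@[simp] theorem eval_find :
    (find x e).eval D s = first (fun i => e.tr D (s.set x i)) (s.var 0) := accum_search _ _
@[simp] theorem eval_sum :
    (sum x e).eval D s = ∑ i ∈ range (s.var 0), e.eval D (s.set x i) := accum_add _ _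

@[simp] theorem tr_get : (get x e).tr D s ↔ s.arr x (e.eval D s) ≠ 0 := Iff.rfl
@[simp] theorem tr_var : (var x).tr D s ↔ s.var x ≠ 0 := Iff.rfl
@[simp] theorem tr_le : (le e₁ e₂).tr D s ↔ e₁.eval D s ≤ e₂.eval D s := by simp [tr, eval]
@[simp] theorem tr_distLe : (distLe e₁ e₂ e₃ e₄).tr D s ↔
    D (e₁.eval D s) (e₂.eval D s) ≤ D (e₃.eval D s) (e₄.eval D s) := by simp [tr, eval]
@[simp] theorem tr_and : (and a b).tr D s ↔ a.tr D s ∧ b.tr D s := by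
  by_cases h : a.tr D s <;> simp [and, tr, eval] at h ⊢ <;> simp [h]
@[simp] theorem tr_or : (or a b).tr D s ↔ a.tr D s ∨ b.tr D s := by
  by_cases h : a.tr D s <;> simp [or, tr, eval] at h ⊢ <;> simp [h]
@[simp] theorem tr_imp : (imp a b).tr D s ↔ (a.tr D s → b.tr D s) := by
  by_cases h : a.tr D s <;> simp [imp, tr, eval] at h ⊢ <;> simp [h]
@[simp] theorem tr_not : (not a).tr D s ↔ ¬ a.tr D s := by
  by_cases h : a.tr D s <;> simp [not, tr, eval] at h ⊢ <;> simp [h]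
@[simp] theorem tr_lt : (lt a b).tr D s ↔ a.eval D s < b.eval D s := by
  simp [lt]
@[simp] theorem tr_eq : (eq a b).tr D s ↔ a.eval D s = b.eval D s := by
  simp [eq, le_antisymm_iff]
@[simp] theorem tr_any : (any x e).tr D s ↔ ∃ i < s.var 0, e.tr D (s.set x i) := by
  rw [tr, any, eval_sum, Ne, sum_eq_zero_iff]
  simp [tr]
@[simp] theorem tr_all : (all x e).tr D s ↔ ∀ i < s.var 0, e.tr D (s.set x i) := by
  simp [all]
@[simp] theorem eval_count :
    (count x e).eval D s = cnt (fun i => e.tr D (s.set x i)) (s.var 0) := by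
  classical
  rw [cnt_eq_card]
  simp [count]
open Classical in
@[simp] theorem eval_sumIf : (sumIf x c e).eval D s =
    ∑ i ∈ range (s.var 0), if c.tr D (s.set x i) then e.eval D (s.set x i) else 0 := by
  simp [sumIf]
@[simp] theorem eval_min : (min a b).eval D s = Min.min (a.eval D s) (b.eval D s) := by
  simp only [min, eval_ite, tr_le]
  split_ifs with h
  · exact (min_eq_left h).symm
  · exact (min_eq_right (by omega)).symm

/-- The value of `b` is summed once for each index below `a`; indices end at `n`, which explains the
bound on `a` only. -/
theorem eval_mul (ha : ∀ i, a.eval D (s.set x i) = a.eval D s)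
    (hb : ∀ i, b.eval D (s.set x i) = b.eval D s) (h : a.eval D s ≤ s.var 0) :
    (mul x a b).eval D s = a.eval D s * b.eval D s := by
  classical
  simp only [mul, eval_sumIf, tr_lt, eval_var, State.set_var, if_true, ha, hb]
  rw [← sum_filter, sum_const, smul_eq_mul]
  congr 1
  rw [← card_range (a.eval D s)]
  congr 1
  ext i
  simp only [card_range, mem_filter, mem_range]
  omega

/-- The quotient is the number of `i` with `(i + 1) * b ≤ a`. The bound on `a` ensures that the
range `i < n` finds all of them. -/
theorem eval_div (hxy : x ≠ y) (h0 : x ≠ 0)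
    (ha : ∀ i, a.eval D (s.set x i) = a.eval D s)
    (hb : ∀ i, b.eval D (s.set x i) = b.eval D s)
    (hb' : ∀ i j, b.eval D ((s.set x i).set y j) = b.eval D s)
    (h : a.eval D s ≤ s.var 0 * b.eval D s) (hpos : 0 < b.eval D s) :
    (div x y a b).eval D s = a.eval D s / b.eval D s := by
  have hq : a.eval D s / b.eval D s ≤ s.var 0 :=
    Nat.div_le_of_le_mul (by rwa [mul_comm])
  rw [div, eval_count, ← Nat.sub_zero (a.eval D s / b.eval D s), ← cnt_interval hq]
  refine cnt_congr fun i hi => ?_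
  rw [tr_le, eval_mul]
  · simp only [eval_add, eval_var, State.set_var, if_true, eval_const, ha, hb]
    rw [← Nat.le_div_iff_mul_le hpos]
    omega
  · intro j
    simp [hxy]
  · intro j
    rw [hb', hb]
  · simp only [eval_add, eval_var, State.set_var, if_true, eval_const, h0.symm, if_false]
    omega

end Term

/-! ### Effects of commands -/

theorem iter_invariant {f : ℕ → State → State} {s : State} {n : ℕ} (Inv : ℕ → State → Prop)
    (h₀ : Inv 0 s) (h : ∀ i < n, ∀ s', Inv i s' → Inv (i + 1) (f i s')) : Inv n (iter f s n) := by
  suffices ∀ m ≤ n, Inv m (iter f s m) from this n le_rfl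
  intro m
  induction m with
  | zero => exact fun _ => h₀
  | succ m ih => exact fun hm => h m hm _ (ih (by omega))

namespace Cmd

/-- The command does not write array `a`. -/
def keepsArr (a : ℕ) : Cmd → Bool
  | skip => true
  | assign _ _ => true
  | store b _ _ => decide (a ≠ b)
  | seq c₁ c₂ => c₁.keepsArr a && c₂.keepsArr a
  | cond _ c₁ c₂ => c₁.keepsArr a && c₂.keepsArr a
  | loop _ c => c.keepsArr a

/-- The command does not write register `x`. -/
def keepsVar (x : ℕ) : Cmd → Bool
  | skip => true
  | assign y _ => decide (x ≠ y)
  | store _ _ _ => true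
  | seq c₁ c₂ => c₁.keepsVar x && c₂.keepsVar x
  | cond _ c₁ c₂ => c₁.keepsVar x && c₂.keepsVar x
  | loop y c => decide (x ≠ y) && c.keepsVar x

variable {D : ℕ → ℕ → ℝ≥0}

theorem run_arr {a : ℕ} {c : Cmd} (h : c.keepsArr a) (σ : State) :
    (c.run D σ).arr a = σ.arr a := by
  induction c generalizing σ with
  | skip => rfl
  | assign => rfl
  | store b i e =>
    simp only [keepsArr, decide_eq_true_eq] at h
    simp [run, h]
  | seq c₁ c₂ ih₁ ih₂ =>
    simp only [keepsArr, Bool.and_eq_true] at h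
    rw [run, ih₂ h.2, ih₁ h.1]
  | cond e c₁ c₂ ih₁ ih₂ =>
    simp only [keepsArr, Bool.and_eq_true] at h
    rw [run]
    split
    · exact ih₁ h.1 σ
    · exact ih₂ h.2 σ
  | loop x c ih =>
    exact iter_invariant (fun _ s => s.arr a = σ.arr a) rfl
      fun i _ s hs => by rw [ih h]; exact hs

theorem run_var {x : ℕ} {c : Cmd} (h : c.keepsVar x) (σ : State) :
    (c.run D σ).var x = σ.var x := by
  induction c generalizing σ with
  | skip => rfl
  | assign y e =>
    simp only [keepsVar, decide_eq_true_eq] at h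
    simp [run, h]
  | store => rfl
  | seq c₁ c₂ ih₁ ih₂ =>
    simp only [keepsVar, Bool.and_eq_true] at h
    rw [run, ih₂ h.2, ih₁ h.1]
  | cond e c₁ c₂ ih₁ ih₂ =>
    simp only [keepsVar, Bool.and_eq_true] at h
    rw [run]
    split
    · exact ih₁ h.1 σ
    · exact ih₂ h.2 σ
  | loop y c ih =>
    simp only [keepsVar, Bool.and_eq_true, decide_eq_true_eq] at h
    exact iter_invariant (fun _ s => s.var x = σ.var x) rfl
      fun i _ s hs => by rw [ih h.2]; simpa [h.1] using hs

/-- Compute the entries `0, …, n - 1` of array `a`, one after the other; register `20` holds the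
index. -/
def fill (a : ℕ) (e : Term) : Cmd := .loop 20 (.store a (.var 20) e)

/-- The state in which entry `i` of array `a` is computed by `fill`. -/
structure FillState (a : ℕ) (σ τ : State) (i : ℕ) (ρ : State) : Prop where
  idx : ρ.var 20 = i
  var : ∀ y, y ≠ 20 → ρ.var y = σ.var y
  arr : ∀ b, b ≠ a → ρ.arr b = σ.arr b
  prev : ∀ j < i, ρ.arr a j = τ.arr a j

/-- Entries below `i` already have their final values when entry `i` is computed, so a term reading
only those yields a recursion for the final array. -/
theorem run_fill (a : ℕ) (e : Term) (σ : State) :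
    (∀ y, y ≠ 20 → ((fill a e).run D σ).var y = σ.var y) ∧
    (∀ b, b ≠ a → ((fill a e).run D σ).arr b = σ.arr b) ∧
    ∀ i < σ.var 0, ∃ ρ, FillState a σ ((fill a e).run D σ) i ρ ∧
      ((fill a e).run D σ).arr a i = e.eval D ρ := by
  refine ⟨fun y hy => run_var (by simp [fill, keepsVar, hy]) σ,
    fun b hb => run_arr (by simp [fill, keepsArr, hb]) σ, ?_⟩
  rw [fill, run]
  set f := fun i (s' : State) => run D (.store a (.var 20) e) (s'.set 20 i) with hf
  suffices ∀ m, (∀ y, y ≠ 20 → (iter f σ m).var y = σ.var y) ∧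
      (∀ b, b ≠ a → (iter f σ m).arr b = σ.arr b) ∧
      ∀ i < m, ∃ ρ, FillState a σ (iter f σ m) i ρ ∧ (iter f σ m).arr a i = e.eval D ρ from
    (this _).2.2
  intro m
  induction m with
  | zero => simp [iter]
  | succ m ih =>
    obtain ⟨h1, h2, h3⟩ := ih
    set τ := iter f σ m with hτ
    have harr : ∀ j, (iter f σ (m + 1)).arr a j =
        if j = m then e.eval D (τ.set 20 m) else τ.arr a j := by
      intro j
      rw [iter, ← hτ, hf]
      simp [run, Function.update_apply]
    refine ⟨fun y hy => ?_, fun b hb => ?_, fun i hi => ?_⟩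
    · rw [iter, ← hτ, hf]
      simp [run, hy, h1]
    · rw [iter, ← hτ, hf]
      simp [run, hb, h2]
    · rcases Nat.lt_succ_iff_lt_or_eq.1 hi with hi | rfl
      · obtain ⟨ρ, hρ, he⟩ := h3 i hi
        refine ⟨ρ, ⟨hρ.idx, hρ.var, hρ.arr, fun j hj => ?_⟩, ?_⟩
        · rw [harr, if_neg (by omega), hρ.prev j hj]
        · rw [harr, if_neg (by omega), he]
      · refine ⟨τ.set 20 i, ⟨by simp, fun y hy => by simp [hy, h1], by simpa using h2,
          fun j hj => ?_⟩, by rw [harr, if_pos rfl]⟩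
        rw [harr, if_neg (by omega)]
        rfl

end Cmd

namespace Cmd

/-- Compute the entries `n - 1, …, 0` of array `a`, one after the other; register `21` holds the
index. -/
def revFill (a : ℕ) (e : Term) : Cmd :=
  .loop 20 (.seq (.assign 21 (.sub (.var 0) (.add (.var 20) (.const 1)))) (.store a (.var 21) e))

/-- The state in which entry `i` of array `a` is computed by `revFill`. -/
structure RevFillState (a : ℕ) (σ τ : State) (i : ℕ) (ρ : State) : Prop where
  idx : ρ.var 21 = i
  var : ∀ y, y ≠ 20 → y ≠ 21 → ρ.var y = σ.var y
  arr : ∀ b, b ≠ a → ρ.arr b = σ.arr b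
  next : ∀ j, i < j → j < σ.var 0 → ρ.arr a j = τ.arr a j

/-- Here entries above `i` are final. This is the order needed on the forest, where children have
larger numbers than their parent. -/
theorem run_revFill {D : ℕ → ℕ → ℝ≥0} (a : ℕ) (e : Term) (σ : State) :
    (∀ y, y ≠ 20 → y ≠ 21 → ((revFill a e).run D σ).var y = σ.var y) ∧
    (∀ b, b ≠ a → ((revFill a e).run D σ).arr b = σ.arr b) ∧
    ∀ i < σ.var 0, ∃ ρ, RevFillState a σ ((revFill a e).run D σ) i ρ ∧
      ((revFill a e).run D σ).arr a i = e.eval D ρ := by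
  refine ⟨fun y hy hy' => run_var (by simp [revFill, keepsVar, hy, hy']) σ,
    fun b hb => run_arr (by simp [revFill, keepsArr, hb]) σ, ?_⟩
  rw [revFill, run]
  set n := σ.var 0 with hn
  set f := fun i (s' : State) => run D (.seq (.assign 21 (.sub (.var 0) (.add (.var 20) (.const 1))))
    (.store a (.var 21) e)) (s'.set 20 i) with hf
  suffices ∀ m ≤ n, (∀ y, y ≠ 20 → y ≠ 21 → (iter f σ m).var y = σ.var y) ∧
      (∀ b, b ≠ a → (iter f σ m).arr b = σ.arr b) ∧
      ∀ i < n, n - m ≤ i → ∃ ρ, RevFillState a σ (iter f σ m) i ρ ∧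
        (iter f σ m).arr a i = e.eval D ρ by
    intro i hi
    exact (this n le_rfl).2.2 i hi (by omega)
  intro m
  induction m with
  | zero =>
    refine fun _ => ⟨fun _ _ _ => rfl, fun _ _ => rfl, fun i hi hi' => ?_⟩
    omega
  | succ m ih =>
    intro hm
    obtain ⟨h1, h2, h3⟩ := ih (by omega)
    set τ := iter f σ m with hτ
    have h0 : τ.var 0 = n := h1 0 (by omega) (by omega)
    have harr : ∀ j, (iter f σ (m + 1)).arr a j =
        if j = n - (m + 1) then e.eval D ((τ.set 20 m).set 21 (n - (m + 1))) else τ.arr a j := by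
      intro j
      rw [iter, ← hτ, hf]
      simp [run, Function.update_apply, h0]
    refine ⟨fun y hy hy' => ?_, fun b hb => ?_, fun i hi hi' => ?_⟩
    · rw [iter, ← hτ, hf]
      simp [run, hy, hy', h1]
    · rw [iter, ← hτ, hf]
      simp [run, hb, h2]
    · by_cases him : n - m ≤ i
      · obtain ⟨ρ, hρ, he⟩ := h3 i hi him
        refine ⟨ρ, ⟨hρ.idx, hρ.var, hρ.arr, fun j hj hj' => ?_⟩, ?_⟩
        · rw [harr, if_neg (by omega), hρ.next j hj hj']
        · rw [harr, if_neg (by omega), he]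
      · have hin : i = n - (m + 1) := by omega
        refine ⟨(τ.set 20 m).set 21 (n - (m + 1)), ⟨by simp [hin],
          fun y hy hy' => by simp [hy, hy', h1], by simpa using h2, fun j hj hj' => ?_⟩,
          by rw [harr, if_pos hin]⟩
        rw [harr, if_neg (by omega)]
        rfl

end Cmd

/-! ### First stage: groups of clients -/

section Neighbourhoods

variable (I : Instance) (R : ℝ≥0)

/-- `v` is a client at distance at most `R` from `u`. -/
def Instance.Near (v u : ℕ) : Prop := I.input.arr 0 v ≠ 0 ∧ I.table v u ≤ R

/-- `u` and `w` have a common neighbouring client. -/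
def Instance.Meets (u w : ℕ) : Prop := ∃ v < I.n, I.Near R v u ∧ I.Near R v w

/-- Some heavy facility has neighbours in the groups of `x` and of `y`. -/
def Instance.Linked (heavy blob : ℕ → ℕ) (x y : ℕ) : Prop :=
  ∃ u < I.n, heavy u ≠ 0 ∧ (∃ v < I.n, I.Near R v u ∧ blob v = x) ∧
    ∃ v < I.n, I.Near R v u ∧ blob v = y

/-- The arrays computed in the first stage: heavy facilities, selected facilities with disjoint
neighbourhoods, the best facility near a selected one and its capacity, the best facility near a
client, and the selected facility to whose group a client belongs. -/
structure IsCover (L : ℕ) (heavy sel eff cap ub blob : ℕ → ℕ) : Prop where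
  heavy_iff : ∀ u < I.n, heavy u ≠ 0 ↔ I.input.arr 1 u ≠ 0 ∧
    L ≤ cnt (fun v => I.Near R v u) I.n ∧ L ≤ I.input.arr 2 u
  sel_iff : ∀ w < I.n, sel w ≠ 0 ↔ heavy w ≠ 0 ∧
    ¬ ∃ w' < I.n, w' < w ∧ sel w' ≠ 0 ∧ I.Meets R w' w
  eff_eq : ∀ w < I.n, eff w = first (fun u => (heavy u ≠ 0 ∧ I.Meets R u w) ∧
    ∀ u' < I.n, heavy u' ≠ 0 ∧ I.Meets R u' w → I.input.arr 2 u' ≤ I.input.arr 2 u) I.n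
  cap_eq : ∀ w < I.n, cap w = I.input.arr 2 (eff w)
  ub_eq : ∀ v < I.n, ub v = first (fun u => (heavy u ≠ 0 ∧ I.Near R v u) ∧
    ∀ u' < I.n, heavy u' ≠ 0 ∧ I.Near R v u' → I.input.arr 2 u' ≤ I.input.arr 2 u) I.n
  blob_eq : ∀ v < I.n, blob v = first (fun w => sel w ≠ 0 ∧ (I.Near R v w ∨
    (¬ ∃ w' < I.n, sel w' ≠ 0 ∧ I.Near R v w') ∧ ub v < I.n ∧ I.Meets R (ub v) w)) I.n

/-- `y` is an unprocessed facility that is joined to the processed facility `nd j`. -/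
def IsCand (n : ℕ) (S : ℕ → Prop) (A : ℕ → ℕ → Prop) (nd : ℕ → ℕ) (k j y : ℕ) : Prop :=
  j < k ∧ S y ∧ (¬ ∃ i < n, i < k ∧ nd i = y) ∧ A (nd j) y

/-- The edge from `nd j` to `y` has maximal weight. -/
def IsBest (n : ℕ) (S : ℕ → Prop) (A : ℕ → ℕ → Prop) (cap nd : ℕ → ℕ) (k j y : ℕ) : Prop :=
  IsCand n S A nd k j y ∧ ∀ j' < n, ∀ y' < n, IsCand n S A nd k j' y' →
    min (cap (nd j')) (cap y') ≤ min (cap (nd j)) (cap y)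

/-- The order in which Prim's algorithm processes the facilities in `S`: `nd k` is the facility
at position `k` (or `n`), and `par k` is the position of its parent (or `n`). -/
structure IsPrimOrder (n : ℕ) (S : ℕ → Prop) (A : ℕ → ℕ → Prop) (cap nd par : ℕ → ℕ) : Prop where
  nd_eq : ∀ k < n, ∀ y₁, y₁ = first (fun y => ∃ j < n, IsBest n S A cap nd k j y) n →
    nd k = if y₁ < n then y₁ else first (fun y => S y ∧ ¬ ∃ i < n, i < k ∧ nd i = y) n
  par_eq : ∀ k < n, par k = first (fun j => nd k < n ∧ IsBest n S A cap nd k j (nd k)) n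

/-- Only entries of `nd` below `k` matter, so the partially filled array can be replaced by the
final one. -/
theorem isCand_congr {n : ℕ} {S : ℕ → Prop} {A : ℕ → ℕ → Prop} {nd nd' : ℕ → ℕ} {k : ℕ}
    (h : ∀ i < k, nd i = nd' i) (j y : ℕ) : IsCand n S A nd k j y ↔ IsCand n S A nd' k j y := by
  have h1 : (∃ i < n, i < k ∧ nd i = y) ↔ ∃ i < n, i < k ∧ nd' i = y := by
    refine exists_congr fun i => and_congr_right fun _ => and_congr_right fun hi => ?_
    rw [h i hi]
  rw [IsCand, IsCand, h1]
  refine and_congr_right fun hj => ?_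
  rw [h j hj]

theorem isBest_congr {n : ℕ} {S : ℕ → Prop} {A : ℕ → ℕ → Prop} {cap nd nd' : ℕ → ℕ} {k : ℕ}
    (h : ∀ i < k, nd i = nd' i) (j y : ℕ) :
    IsBest n S A cap nd k j y ↔ IsBest n S A cap nd' k j y := by
  rw [IsBest, IsBest, isCand_congr h]
  refine and_congr_right fun hj => ?_
  rw [h j hj.1]
  refine forall_congr' fun j' => forall_congr' fun _ => forall_congr' fun y' =>
    forall_congr' fun _ => ?_
  rw [isCand_congr h]
  refine forall_congr' fun hj' => ?_
  rw [h j' hj'.1]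

end Neighbourhoods

/-! ### Terms and commands of the first stage -/

namespace Term

/-- `a` is a client near `b`. -/
def near (a b : Term) : Term := and (.get 0 a) (.distLe a b (.var 5) (.var 6))
def meets (a b : Term) : Term := any 30 (and (near (.var 30) a) (near (.var 30) b))
-- Layout of the first stage: registers `4`, `5`, `6` hold the lower bound and the pair at distance
-- `R`. Arrays `5`, `6`, `7`, `8`, `26`, `9` hold `heavy`, `sel`, `eff`, `cap`, `ub`, `blob`; arrays
-- `10` to `13` hold the Prim order, the parents, the nodes of the clients and the capacities of the
-- nodes.
def heavyT : Term := and (.get 1 (.var 20))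
  (and (.le (.var 4) (count 31 (near (.var 31) (.var 20)))) (.le (.var 4) (.get 2 (.var 20))))
def selT : Term := and (.get 5 (.var 20))
  (not (any 32 (and (lt (.var 32) (.var 20)) (and (.get 6 (.var 32)) (meets (.var 32) (.var 20))))))
def effT : Term := .find 33 (and (and (.get 5 (.var 33)) (meets (.var 33) (.var 20)))
  (all 34 (imp (and (.get 5 (.var 34)) (meets (.var 34) (.var 20)))
    (.le (.get 2 (.var 34)) (.get 2 (.var 33))))))
def capT : Term := .get 2 (.get 7 (.var 20))
def ubT : Term := .find 33 (and (and (.get 5 (.var 33)) (near (.var 20) (.var 33)))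
  (all 34 (imp (and (.get 5 (.var 34)) (near (.var 20) (.var 34)))
    (.le (.get 2 (.var 34)) (.get 2 (.var 33))))))
def blobT : Term := .find 33 (and (.get 6 (.var 33)) (or (near (.var 20) (.var 33))
  (and (not (any 34 (and (.get 6 (.var 34)) (near (.var 20) (.var 34)))))
    (and (lt (.get 26 (.var 20)) (.var 0)) (meets (.get 26 (.var 20)) (.var 33))))))
def linked (a b : Term) : Term := any 35 (and (.get 5 (.var 35))
  (and (any 36 (and (near (.var 36) (.var 35)) (eq (.get 9 (.var 36)) a)))
    (any 36 (and (near (.var 36) (.var 35)) (eq (.get 9 (.var 36)) b)))))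
def picked (a : Term) : Term := any 37 (and (lt (.var 37) (.var 20)) (eq (.get 10 (.var 37)) a))
def cand (a b : Term) : Term := and (lt a (.var 20)) (and (.get 6 b)
  (and (not (picked b)) (linked (.get 10 a) b)))
def weight (a b : Term) : Term := min (.get 8 (.get 10 a)) (.get 8 b)
def best (a b : Term) : Term := and (cand a b)
  (all 40 (all 41 (imp (cand (.var 40) (.var 41)) (.le (weight (.var 40) (.var 41)) (weight a b)))))
def nextT : Term := .find 42 (any 43 (best (.var 43) (.var 42)))
def ndT : Term := .ite (lt nextT (.var 0)) nextT
  (.find 42 (and (.get 6 (.var 42)) (not (picked (.var 42)))))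
def parT : Term := .find 43 (and (lt (.get 10 (.var 20)) (.var 0))
  (best (.var 43) (.get 10 (.var 20))))
def nodeT : Term := .find 33 (and (lt (.get 9 (.var 20)) (.var 0))
  (eq (.get 10 (.var 33)) (.get 9 (.var 20))))
def nodeCapT : Term := .get 8 (.get 10 (.var 20))

end Term

namespace Cmd

/-- Computation of the groups of clients. -/
def coverCmd : Cmd :=
  .seq (fill 5 Term.heavyT) <| .seq (fill 6 Term.selT) <| .seq (fill 7 Term.effT) <|
  .seq (fill 8 Term.capT) <| .seq (fill 26 Term.ubT) (fill 9 Term.blobT)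

/-- Prim's algorithm. -/
def primCmd : Cmd := .seq (fill 10 Term.ndT) <| .seq (fill 11 Term.parT) <|
  .seq (fill 12 Term.nodeT) (fill 13 Term.nodeCapT)

end Cmd

/-- The state holds the input, the lower bound `L` and two points at distance `R`. -/
structure Instance.Holds (I : Instance) (L : ℕ) (R : ℝ≥0) (σ : State) : Prop where
  n_eq : σ.var 0 = I.n
  L_eq : σ.var 4 = L
  R_eq : I.table (σ.var 5) (σ.var 6) = R
  clients : σ.arr 0 = I.input.arr 0
  facilities : σ.arr 1 = I.input.arr 1
  bounds : σ.arr 2 = I.input.arr 2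

theorem Instance.Holds.run {I : Instance} {L : ℕ} {R : ℝ≥0} {σ : State} (h : I.Holds L R σ)
    {c : Cmd} (hv : (c.keepsVar 0 && c.keepsVar 4 && c.keepsVar 5 && c.keepsVar 6) = true)
    (ha : (c.keepsArr 0 && c.keepsArr 1 && c.keepsArr 2) = true) :
    I.Holds L R (c.run I.table σ) := by
  simp only [Bool.and_eq_true] at hv ha
  obtain ⟨⟨⟨h0, h4⟩, h5⟩, h6⟩ := hv
  obtain ⟨⟨a0, a1⟩, a2⟩ := ha
  exact ⟨by rw [Cmd.run_var h0, h.n_eq], by rw [Cmd.run_var h4, h.L_eq],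
    by rw [Cmd.run_var h5, Cmd.run_var h6, h.R_eq], by rw [Cmd.run_arr a0, h.clients],
    by rw [Cmd.run_arr a1, h.facilities], by rw [Cmd.run_arr a2, h.bounds]⟩

theorem Instance.Holds.fill {I : Instance} {L : ℕ} {R : ℝ≥0} {σ τ ρ : State} (h : I.Holds L R σ)
    {a i : ℕ} (ha : 2 < a) (hρ : Cmd.FillState a σ τ i ρ) : I.Holds L R ρ :=
  ⟨by rw [hρ.var 0 (by omega), h.n_eq], by rw [hρ.var 4 (by omega), h.L_eq],
    by rw [hρ.var 5 (by omega), hρ.var 6 (by omega), h.R_eq],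
    by rw [hρ.arr 0 (by omega), h.clients], by rw [hρ.arr 1 (by omega), h.facilities],
    by rw [hρ.arr 2 (by omega), h.bounds]⟩

section Stage

variable {I : Instance} {L : ℕ} {R : ℝ≥0} {σ ρ : State}

/-- Each array depends on finished arrays only, except that the greedy selection also consults its
own earlier entries. -/
theorem run_cover (h : I.Holds L R σ) :
    let τ := Cmd.coverCmd.run I.table σ
    IsCover I R L (τ.arr 5) (τ.arr 6) (τ.arr 7) (τ.arr 8) (τ.arr 26) (τ.arr 9) := by
  intro τ
  obtain ⟨σ₁, e₁⟩ : ∃ s, s = (Cmd.fill 5 Term.heavyT).run I.table σ := ⟨_, rfl⟩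
  obtain ⟨σ₂, e₂⟩ : ∃ s, s = (Cmd.fill 6 Term.selT).run I.table σ₁ := ⟨_, rfl⟩
  obtain ⟨σ₃, e₃⟩ : ∃ s, s = (Cmd.fill 7 Term.effT).run I.table σ₂ := ⟨_, rfl⟩
  obtain ⟨σ₄, e₄⟩ : ∃ s, s = (Cmd.fill 8 Term.capT).run I.table σ₃ := ⟨_, rfl⟩
  obtain ⟨σ₅, e₅⟩ : ∃ s, s = (Cmd.fill 26 Term.ubT).run I.table σ₄ := ⟨_, rfl⟩
  obtain ⟨σ₆, e₆⟩ : ∃ s, s = (Cmd.fill 9 Term.blobT).run I.table σ₅ := ⟨_, rfl⟩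
  have hτ : τ = σ₆ := by rw [e₆, e₅, e₄, e₃, e₂, e₁]; rfl
  have H₁ : I.Holds L R σ₁ := e₁ ▸ h.run rfl rfl
  have H₂ : I.Holds L R σ₂ := e₂ ▸ H₁.run rfl rfl
  have H₃ : I.Holds L R σ₃ := e₃ ▸ H₂.run rfl rfl
  have H₄ : I.Holds L R σ₄ := e₄ ▸ H₃.run rfl rfl
  have H₅ : I.Holds L R σ₅ := e₅ ▸ H₄.run rfl rfl
  obtain ⟨-, a₁, g₁⟩ := Cmd.run_fill (D := I.table) 5 Term.heavyT σ
  obtain ⟨-, a₂, g₂⟩ := Cmd.run_fill (D := I.table) 6 Term.selT σ₁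
  obtain ⟨-, a₃, g₃⟩ := Cmd.run_fill (D := I.table) 7 Term.effT σ₂
  obtain ⟨-, a₄, g₄⟩ := Cmd.run_fill (D := I.table) 8 Term.capT σ₃
  obtain ⟨-, a₅, g₅⟩ := Cmd.run_fill (D := I.table) 26 Term.ubT σ₄
  obtain ⟨-, a₆, g₆⟩ := Cmd.run_fill (D := I.table) 9 Term.blobT σ₅
  rw [← e₁, h.n_eq] at g₁
  rw [← e₂, H₁.n_eq] at g₂
  rw [← e₃, H₂.n_eq] at g₃
  rw [← e₄, H₃.n_eq] at g₄
  rw [← e₅, H₄.n_eq] at g₅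
  rw [← e₆, H₅.n_eq] at g₆
  rw [← e₁] at a₁
  rw [← e₂] at a₂
  rw [← e₃] at a₃
  rw [← e₄] at a₄
  rw [← e₅] at a₅
  rw [← e₆] at a₆
  clear e₁ e₂ e₃ e₄ e₅ e₆
  have b₅ : σ₆.arr 5 = σ₁.arr 5 := by
    rw [a₆ _ (by decide), a₅ _ (by decide), a₄ _ (by decide), a₃ _ (by decide), a₂ _ (by decide)]
  have b₆ : σ₆.arr 6 = σ₂.arr 6 := by
    rw [a₆ _ (by decide), a₅ _ (by decide), a₄ _ (by decide), a₃ _ (by decide)]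
  have b₇ : σ₆.arr 7 = σ₃.arr 7 := by
    rw [a₆ _ (by decide), a₅ _ (by decide), a₄ _ (by decide)]
  have b₈ : σ₆.arr 8 = σ₄.arr 8 := by rw [a₆ _ (by decide), a₅ _ (by decide)]
  have b₂₆ : σ₆.arr 26 = σ₅.arr 26 := by rw [a₆ _ (by decide)]
  rw [hτ]
  refine ⟨fun u hu => ?_, fun u hu => ?_, fun u hu => ?_, fun u hu => ?_, fun u hu => ?_,
    fun u hu => ?_⟩
  · obtain ⟨ρ, hρ, he⟩ := g₁ u hu
    have hh := h.fill (by omega) hρ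
    rw [b₅, he]
    change Term.heavyT.tr I.table ρ ↔ _
    simp [Term.heavyT, Term.near, Instance.Near, hh.clients, hh.R_eq, hρ.idx, hh.n_eq, hh.facilities, hh.bounds, hh.L_eq]
  · obtain ⟨ρ, hρ, he⟩ := g₂ u hu
    have hh := H₁.fill (by omega) hρ
    rw [b₅, b₆, he]
    change Term.selT.tr I.table ρ ↔ _
    simp only [Term.selT, Term.meets, Instance.Meets, Term.near, Instance.Near, hh.clients, hρ.idx, hh.n_eq, Term.tr_and,
      Term.tr_not, Term.tr_any, Term.tr_lt, Term.tr_get, Term.eval_var, State.set_var,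
      State.set_arr, hρ.arr 5 (by decide)]
    simp +contextual [hρ.idx, hρ.prev, hh.R_eq]
  · obtain ⟨ρ, hρ, he⟩ := g₃ u hu
    have hh := H₂.fill (by omega) hρ
    rw [b₅, b₇, he]
    simp [Term.effT, Term.meets, Instance.Meets, Term.near, Instance.Near, hh.clients, hh.R_eq, hρ.idx, hh.n_eq, hh.bounds,
      hρ.arr 5, a₂]
  · obtain ⟨ρ, hρ, he⟩ := g₄ u hu
    have hh := H₃.fill (by omega) hρ
    rw [b₇, b₈, he]
    simp [Term.capT, hρ.idx, hh.bounds, hρ.arr 7]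
  · obtain ⟨ρ, hρ, he⟩ := g₅ u hu
    have hh := H₄.fill (by omega) hρ
    rw [b₅, b₂₆, he]
    simp [Term.ubT, Term.near, Instance.Near, hh.clients, hh.R_eq, hρ.idx, hh.n_eq, hh.bounds, hρ.arr 5, a₂, a₃, a₄]
  · obtain ⟨ρ, hρ, he⟩ := g₆ u hu
    have hh := H₅.fill (by omega) hρ
    rw [b₆, b₂₆, he]
    simp [Term.blobT, Term.meets, Instance.Meets, Term.near, Instance.Near, hh.clients, hh.R_eq, hρ.idx, hh.n_eq, hρ.arr 6,
      hρ.arr 26, a₃, a₄, a₅]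

theorem run_prim (h : I.Holds L R σ) :
    let τ := Cmd.primCmd.run I.table σ
    IsPrimOrder I.n (fun w => σ.arr 6 w ≠ 0) (I.Linked R (σ.arr 5) (σ.arr 9)) (σ.arr 8)
      (τ.arr 10) (τ.arr 11) ∧
    (∀ v < I.n, τ.arr 12 v = first (fun k => σ.arr 9 v < I.n ∧ τ.arr 10 k = σ.arr 9 v) I.n) ∧
    ∀ k < I.n, τ.arr 13 k = σ.arr 8 (τ.arr 10 k) := by
  intro τ
  obtain ⟨σ₁, e₁⟩ : ∃ s, s = (Cmd.fill 10 Term.ndT).run I.table σ := ⟨_, rfl⟩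
  obtain ⟨σ₂, e₂⟩ : ∃ s, s = (Cmd.fill 11 Term.parT).run I.table σ₁ := ⟨_, rfl⟩
  obtain ⟨σ₃, e₃⟩ : ∃ s, s = (Cmd.fill 12 Term.nodeT).run I.table σ₂ := ⟨_, rfl⟩
  obtain ⟨σ₄, e₄⟩ : ∃ s, s = (Cmd.fill 13 Term.nodeCapT).run I.table σ₃ := ⟨_, rfl⟩
  have hτ : τ = σ₄ := by rw [e₄, e₃, e₂, e₁]; rfl
  have H₁ : I.Holds L R σ₁ := e₁ ▸ h.run rfl rfl
  have H₂ : I.Holds L R σ₂ := e₂ ▸ H₁.run rfl rfl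
  have H₃ : I.Holds L R σ₃ := e₃ ▸ H₂.run rfl rfl
  obtain ⟨-, a₁, g₁⟩ := Cmd.run_fill (D := I.table) 10 Term.ndT σ
  obtain ⟨-, a₂, g₂⟩ := Cmd.run_fill (D := I.table) 11 Term.parT σ₁
  obtain ⟨-, a₃, g₃⟩ := Cmd.run_fill (D := I.table) 12 Term.nodeT σ₂
  obtain ⟨-, a₄, g₄⟩ := Cmd.run_fill (D := I.table) 13 Term.nodeCapT σ₃
  rw [← e₁, h.n_eq] at g₁
  rw [← e₂, H₁.n_eq] at g₂
  rw [← e₃, H₂.n_eq] at g₃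
  rw [← e₄, H₃.n_eq] at g₄
  rw [← e₁] at a₁
  rw [← e₂] at a₂
  rw [← e₃] at a₃
  rw [← e₄] at a₄
  clear e₁ e₂ e₃ e₄
  have b₁₀ : σ₄.arr 10 = σ₁.arr 10 := by
    rw [a₄ _ (by decide), a₃ _ (by decide), a₂ _ (by decide)]
  rw [hτ, b₁₀, a₄ 11 (by decide), a₃ 11 (by decide), a₄ 12 (by decide)]
  refine ⟨⟨fun k hk y₁ hy₁ => ?_, fun k hk => ?_⟩, fun v hv => ?_, fun k hk => ?_⟩
  · obtain ⟨ρ, hρ, he⟩ := g₁ k hk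
    have hh := h.fill (by omega) hρ
    have key : Term.nextT.eval I.table ρ = y₁ := by
      rw [hy₁]
      simp only [← isBest_congr hρ.prev]
      simp [Term.nextT, Term.best, Term.cand, Term.weight, Term.picked, Term.linked, Term.near,
        IsBest, IsCand, Instance.Linked, Instance.Near, hρ.idx, hh.n_eq, hh.clients, hh.R_eq,
        hρ.arr 5, hρ.arr 6, hρ.arr 8, hρ.arr 9]
    rw [he, Term.ndT, Term.eval_ite, Term.tr_lt, key, Term.eval_var, hh.n_eq]
    congr 1
    simp only [Term.eval_find, hh.n_eq]
    congr 1
    funext y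
    simp +contextual [Term.picked, hρ.idx, hh.n_eq, hρ.arr 6, hρ.prev]
  · obtain ⟨ρ, hρ, he⟩ := g₂ k hk
    have hh := H₁.fill (by omega) hρ
    rw [he]
    simp [Term.parT, Term.best, Term.cand, Term.weight, Term.picked, Term.linked, Term.near,
        IsBest, IsCand, Instance.Linked, Instance.Near, hρ.idx, hh.n_eq, hh.clients, hh.R_eq,
        hρ.arr 5, hρ.arr 6, hρ.arr 8, hρ.arr 9, hρ.arr 10, a₁]
  · obtain ⟨ρ, hρ, he⟩ := g₃ v hv
    have hh := H₂.fill (by omega) hρ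
    rw [he]
    simp [Term.nodeT, hρ.idx, hh.n_eq, hρ.arr 9, hρ.arr 10, a₁, a₂]
  · obtain ⟨ρ, hρ, he⟩ := g₄ k hk
    rw [he]
    simp [Term.nodeCapT, hρ.idx, hρ.arr 8, hρ.arr 10, a₁, a₂, a₃]

end Stage

/-! ### Properties of the first stage -/

theorem exists_max_of_exists {n : ℕ} {p : ℕ → Prop} (f : ℕ → ℕ) (h : ∃ i < n, p i) :
    ∃ i < n, p i ∧ ∀ j < n, p j → f j ≤ f i := by
  classical
  obtain ⟨i, hi, hp⟩ := h
  obtain ⟨k, hk, hmax⟩ := exists_max_image {i ∈ range n | p i} f ⟨i, by simp [hi, hp]⟩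
  simp only [mem_filter, mem_range] at hk hmax
  exact ⟨k, hk.1, hk.2, fun j hj hpj => hmax j ⟨hj, hpj⟩⟩

namespace Instance

variable {I : Instance} {R : ℝ≥0}

theorem table_comm (x y : ℕ) : I.table x y = I.table y x := by
  unfold table
  by_cases h : x < I.n ∧ y < I.n
  · rw [dif_pos h, dif_pos h.symm, I.d_comm]
  · rw [dif_neg h, dif_neg fun h' => h h'.symm]

theorem table_triangle {x y z : ℕ} (hx : x < I.n) (hy : y < I.n) (hz : z < I.n) :
    I.table x z ≤ I.table x y + I.table y z := by
  rw [table, table, table, dif_pos ⟨hx, hz⟩, dif_pos ⟨hx, hy⟩, dif_pos ⟨hy, hz⟩]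
  exact I.d_triangle ..

theorem Meets.symm {u w : ℕ} (h : I.Meets R u w) : I.Meets R w u := by
  obtain ⟨v, hv, h1, h2⟩ := h
  exact ⟨v, hv, h2, h1⟩

theorem Meets.dist_le {u w : ℕ} (h : I.Meets R u w) (hu : u < I.n) (hw : w < I.n) :
    I.table u w ≤ 2 * R := by
  obtain ⟨v, hv, h1, h2⟩ := h
  calc I.table u w ≤ I.table u v + I.table v w := table_triangle hu hv hw
    _ ≤ R + R := add_le_add (by rw [table_comm]; exact h1.2) h2.2
    _ = 2 * R := (two_mul R).symm

theorem Linked.symm {heavy blob : ℕ → ℕ} {x y : ℕ} (h : I.Linked R heavy blob x y) :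
    I.Linked R heavy blob y x := by
  obtain ⟨u, hu, hh, h1, h2⟩ := h
  exact ⟨u, hu, hh, h2, h1⟩

end Instance

/-! ### Geometry of the groups -/

namespace IsCover

variable {I : Instance} {R : ℝ≥0} {L : ℕ} {heavy sel eff cap ub blob : ℕ → ℕ}

theorem meets_self (C : IsCover I R L heavy sel eff cap ub blob) (hL : 0 < L) {u : ℕ}
    (hu : u < I.n) (h : heavy u ≠ 0) : I.Meets R u u := by
  obtain ⟨v, hv, h1⟩ := exists_of_cnt_pos (hL.trans_le ((C.heavy_iff u hu).1 h).2.1)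
  exact ⟨v, hv, h1, h1⟩

theorem heavy_of_sel (C : IsCover I R L heavy sel eff cap ub blob) {w : ℕ} (hw : w < I.n)
    (h : sel w ≠ 0) : heavy w ≠ 0 := ((C.sel_iff w hw).1 h).1

theorem exists_sel (C : IsCover I R L heavy sel eff cap ub blob) (hL : 0 < L) {u : ℕ}
    (hu : u < I.n) (h : heavy u ≠ 0) : ∃ w < I.n, sel w ≠ 0 ∧ I.Meets R u w := by
  by_cases hs : sel u ≠ 0
  · exact ⟨u, hu, hs, C.meets_self hL hu h⟩
  · rw [C.sel_iff u hu] at hs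
    push Not at hs
    obtain ⟨w, hw, -, h1, h2⟩ := hs h
    exact ⟨w, hw, h1, h2.symm⟩

theorem sel_unique (C : IsCover I R L heavy sel eff cap ub blob) {v w w' : ℕ} (hv : v < I.n)
    (hw : w < I.n) (hw' : w' < I.n) (h : sel w ≠ 0) (h' : sel w' ≠ 0) (hn : I.Near R v w)
    (hn' : I.Near R v w') : w = w' := by
  rcases Nat.lt_trichotomy w w' with hlt | heq | hlt
  · exact absurd ⟨w, hw, hlt, h, v, hv, hn, hn'⟩ ((C.sel_iff w' hw').1 h').2
  · exact heq
  · exact absurd ⟨w', hw', hlt, h', v, hv, hn', hn⟩ ((C.sel_iff w hw).1 h).2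

/-- The search succeeds because `w` meets itself, its neighbourhood being nonempty by `0 < L`. -/
theorem eff_spec (C : IsCover I R L heavy sel eff cap ub blob) (hL : 0 < L) {w : ℕ}
    (hw : w < I.n) (h : sel w ≠ 0) : eff w < I.n ∧ heavy (eff w) ≠ 0 ∧ I.Meets R (eff w) w ∧
      ∀ u < I.n, heavy u ≠ 0 → I.Meets R u w → I.input.arr 2 u ≤ cap w := by
  have hh := C.heavy_of_sel hw h
  obtain ⟨i, hi, hp, hmax⟩ := exists_max_of_exists (p := fun u => heavy u ≠ 0 ∧ I.Meets R u w)
    (I.input.arr 2) ⟨w, hw, hh, C.meets_self hL hw hh⟩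
  have hlt := first_lt (p := fun u => (heavy u ≠ 0 ∧ I.Meets R u w) ∧
    ∀ u' < I.n, heavy u' ≠ 0 ∧ I.Meets R u' w → I.input.arr 2 u' ≤ I.input.arr 2 u) hi ⟨hp, hmax⟩
  have hs := first_spec hlt
  rw [← C.eff_eq w hw] at hlt hs
  exact ⟨hlt, hs.1.1, hs.1.2, fun u hu h1 h2 => by rw [C.cap_eq w hw]; exact hs.2 u hu ⟨h1, h2⟩⟩

theorem ub_spec (C : IsCover I R L heavy sel eff cap ub blob) {v u : ℕ}
    (hv : v < I.n) (hu : u < I.n) (h : heavy u ≠ 0) (hn : I.Near R v u) :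
    ub v < I.n ∧ heavy (ub v) ≠ 0 ∧ I.Near R v (ub v) ∧
      ∀ u < I.n, heavy u ≠ 0 → I.Near R v u → I.input.arr 2 u ≤ I.input.arr 2 (ub v) := by
  obtain ⟨i, hi, hp, hmax⟩ := exists_max_of_exists (p := fun u => heavy u ≠ 0 ∧ I.Near R v u)
    (I.input.arr 2) ⟨u, hu, h, hn⟩
  have hlt := first_lt (p := fun u => (heavy u ≠ 0 ∧ I.Near R v u) ∧
    ∀ u' < I.n, heavy u' ≠ 0 ∧ I.Near R v u' → I.input.arr 2 u' ≤ I.input.arr 2 u) hi ⟨hp, hmax⟩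
  have hs := first_spec hlt
  rw [← C.ub_eq v hv] at hlt hs
  exact ⟨hlt, hs.1.1, hs.1.2, fun u hu h1 h2 => hs.2 u hu ⟨h1, h2⟩⟩

theorem blob_spec (C : IsCover I R L heavy sel eff cap ub blob) {v : ℕ} (hv : v < I.n)
    (h : blob v < I.n) : sel (blob v) ≠ 0 ∧ (I.Near R v (blob v) ∨
      (¬ ∃ w' < I.n, sel w' ≠ 0 ∧ I.Near R v w') ∧ ub v < I.n ∧ I.Meets R (ub v) (blob v)) := by
  rw [C.blob_eq v hv] at h ⊢
  exact first_spec h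

theorem blob_of_near_sel (C : IsCover I R L heavy sel eff cap ub blob) {v w : ℕ}
    (hv : v < I.n) (hw : w < I.n) (h : sel w ≠ 0) (hn : I.Near R v w) : blob v = w := by
  have hlt : blob v < I.n := by
    rw [C.blob_eq v hv]
    exact first_lt hw ⟨h, .inl hn⟩
  obtain ⟨h1, h2⟩ := C.blob_spec hv hlt
  rcases h2 with h2 | ⟨h2, -⟩
  · exact C.sel_unique hv hlt hw h1 h h2 hn
  · exact absurd ⟨w, hw, h, hn⟩ h2

/-- If `v` is near a selected `w`, then `u` meets `w` through `v`. Otherwise `v` follows `ub v`,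
which has the largest bound among the heavy facilities near `v` and meets a selected facility by
maximality of the selection. -/
theorem blob_of_near_heavy (C : IsCover I R L heavy sel eff cap ub blob) (hL : 0 < L) {v u : ℕ}
    (hv : v < I.n) (hu : u < I.n) (h : heavy u ≠ 0) (hn : I.Near R v u) :
    blob v < I.n ∧ I.input.arr 2 u ≤ cap (blob v) := by
  by_cases hc : ∃ w' < I.n, sel w' ≠ 0 ∧ I.Near R v w'
  · obtain ⟨w, hw, hs, hnw⟩ := hc
    rw [C.blob_of_near_sel hv hw hs hnw]
    exact ⟨hw, (C.eff_spec hL hw hs).2.2.2 u hu h ⟨v, hv, hn, hnw⟩⟩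
  · obtain ⟨h1, h2, -, h4⟩ := C.ub_spec hv hu h hn
    obtain ⟨w, hw, hs, hm⟩ := C.exists_sel hL h1 h2
    have hlt : blob v < I.n := by
      rw [C.blob_eq v hv]
      exact first_lt hw ⟨hs, .inr ⟨hc, h1, hm⟩⟩
    obtain ⟨h5, h6⟩ := C.blob_spec hv hlt
    rcases h6 with h6 | ⟨-, -, h6⟩
    · exact absurd ⟨_, hlt, h5, h6⟩ hc
    · exact ⟨hlt, (h4 u hu h hn).trans ((C.eff_spec hL hlt h5).2.2.2 _ h1 h2 h6)⟩

theorem near_of_lt (C : IsCover I R L heavy sel eff cap ub blob) {v : ℕ} (hv : v < I.n)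
    (h : ub v < I.n) : I.Near R v (ub v) := by
  rw [C.ub_eq v hv] at h ⊢
  exact (first_spec h).1.2

theorem blob_dist (C : IsCover I R L heavy sel eff cap ub blob) {v : ℕ} (hv : v < I.n)
    (h : blob v < I.n) : I.input.arr 0 v ≠ 0 ∧ I.table v (blob v) ≤ 3 * R := by
  rcases (C.blob_spec hv h).2 with h1 | ⟨-, h2, h3⟩
  · exact ⟨h1.1, h1.2.trans (le_mul_of_one_le_left' (by norm_num))⟩
  · have h4 := C.near_of_lt hv h2
    refine ⟨h4.1, ?_⟩
    calc I.table v (blob v) ≤ I.table v (ub v) + I.table (ub v) (blob v) :=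
          I.table_triangle hv h2 h
      _ ≤ R + 2 * R := add_le_add h4.2 (h3.dist_le h2 h)
      _ = 3 * R := by ring

/-- The path through the heavy facility and its two neighbours has length at most `3 * R + R + R + 3
* R`. -/
theorem linked_dist (C : IsCover I R L heavy sel eff cap ub blob) (hL : 0 < L) {x y : ℕ}
    (h : I.Linked R heavy blob x y) : x < I.n ∧ y < I.n ∧ I.table x y ≤ 8 * R := by
  obtain ⟨u, hu, hh, ⟨v, hv, hn, rfl⟩, v', hv', hn', rfl⟩ := h
  have h1 := (C.blob_of_near_heavy hL hv hu hh hn).1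
  have h2 := (C.blob_of_near_heavy hL hv' hu hh hn').1
  refine ⟨h1, h2, ?_⟩
  have d1 := (C.blob_dist hv h1).2
  have d2 := (C.blob_dist hv' h2).2
  rw [I.table_comm] at d1
  calc I.table (blob v) (blob v')
      ≤ I.table (blob v) v + (I.table v u + (I.table u v' + I.table v' (blob v'))) := by
        refine (I.table_triangle h1 hv h2).trans (add_le_add_right ?_ _)
        refine (I.table_triangle hv hu h2).trans (add_le_add_right ?_ _)
        exact I.table_triangle hu hv' h2
    _ ≤ 3 * R + (R + (R + 3 * R)) :=
        add_le_add d1 (add_le_add hn.2 (add_le_add (by rw [I.table_comm]; exact hn'.2) d2))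
    _ = 8 * R := by ring

end IsCover

/-! ### The order found by Prim's algorithm -/

namespace IsPrimOrder

variable {n : ℕ} {S : ℕ → Prop} {A : ℕ → ℕ → Prop} {cap nd par : ℕ → ℕ}

theorem nd_spec (P : IsPrimOrder n S A cap nd par) {k : ℕ} (hk : k < n) (h : nd k < n) :
    S (nd k) ∧ ∀ i < k, nd i ≠ nd k := by
  have he := P.nd_eq k hk _ rfl
  split_ifs at he with h1
  · obtain ⟨j, hj, hb⟩ := first_spec h1
    rw [← he] at hb
    exact ⟨hb.1.2.1, fun i hi heq => hb.1.2.2.1 ⟨i, hi.trans hk, hi, heq⟩⟩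
  · rw [he] at h
    have h2 := first_spec h
    rw [← he] at h2
    exact ⟨h2.1, fun i hi heq => h2.2 ⟨i, hi.trans hk, hi, heq⟩⟩

theorem par_spec (P : IsPrimOrder n S A cap nd par) {k : ℕ} (hk : k < n) (h : par k < n) :
    nd k < n ∧ IsBest n S A cap nd k (par k) (nd k) := by
  rw [P.par_eq k hk] at h
  have := first_spec h
  rwa [← P.par_eq k hk] at this

/-- Pigeonhole: while `w` is missing, every position receives a new facility, so `n` positions
exhaust all points, including `w`. -/
theorem exists_nd (P : IsPrimOrder n S A cap nd par) {w : ℕ} (hw : w < n) (hS : S w) :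
    ∃ k < n, nd k = w := by
  by_contra! hne
  have hlt : ∀ k < n, nd k < n := by
    intro k hk
    rw [P.nd_eq k hk _ rfl]
    split_ifs with h1
    · exact h1
    · exact first_lt hw ⟨hS, fun ⟨i, hi, _, h⟩ => hne i hi h⟩
  have hinj : Set.InjOn nd (range n) := by
    intro i hi j hj hij
    simp only [coe_range, Set.mem_Iio] at hi hj
    rcases Nat.lt_trichotomy i j with h | h | h
    · exact absurd hij ((P.nd_spec hj (hlt j hj)).2 i h)
    · exact h
    · exact absurd hij.symm ((P.nd_spec hi (hlt i hi)).2 j h)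
  have hsub : (range n).image nd ⊆ range n := fun x hx => by
    obtain ⟨k, hk, rfl⟩ := mem_image.1 hx
    exact mem_range.2 (hlt k (mem_range.1 hk))
  have heq := eq_of_subset_of_card_le hsub (by rw [card_image_of_injOn hinj])
  obtain ⟨k, hk, h⟩ := mem_image.1 (heq ▸ mem_range.2 hw)
  exact hne k (mem_range.1 hk) h

theorem nd_injective (P : IsPrimOrder n S A cap nd par) {i j : ℕ} (hi : i < n) (hj : j < n)
    (h : nd i = nd j) (hn : nd i < n) : i = j := by
  rcases Nat.lt_trichotomy i j with h' | h' | h'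
  · exact absurd h ((P.nd_spec hj (h ▸ hn)).2 i h')
  · exact h'
  · exact absurd h.symm ((P.nd_spec hi hn).2 j h')

/-- If some edge crosses the cut at `k`, a heaviest one exists; then `nd k` is the end of such an
edge and the search for its parent succeeds. -/
theorem isPrim (P : IsPrimOrder n S A cap nd par) (hA : ∀ x y, A x y → x < n ∧ y < n) :
    IsPrim n par (fun k => cap (nd k)) fun i j => A (nd i) (nd j) := by
  have hcand : ∀ k < n, ∀ i < k, ∀ j < n, k ≤ j → A (nd i) (nd j) →
      IsCand n S A nd k i (nd j) := by
    intro k hk i hi j hj hkj hij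
    obtain ⟨h1, h2⟩ := P.nd_spec hj (hA _ _ hij).2
    exact ⟨hi, h1, fun ⟨i', _, hi'k, h'⟩ => h2 i' (by omega) h', hij⟩
  refine ⟨fun k hk h => (P.par_spec hk h).2.1.1, fun k hk h => (P.par_spec hk h).2.1.2.2.2,
    fun k hk h i hi j hj hkj hij => ?_, fun k hk h i hi j hj hkj hij => ?_⟩
  · exact (P.par_spec hk h).2.2 i (by omega) (nd j) (hA _ _ hij).2 (hcand k hk i hi j hj hkj hij)
  · classical
    have hc := hcand k hk i hi j hj hkj hij
    obtain ⟨⟨a, y⟩, hay, hmax⟩ := exists_max_image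
      {q ∈ range n ×ˢ range n | IsCand n S A nd k q.1 q.2}
      (fun q => min (cap (nd q.1)) (cap q.2))
      ⟨(i, nd j), by simp [hc, (hA _ _ hij).2, hi.trans hk]⟩
    simp only [mem_filter, mem_product, mem_range, Prod.forall] at hay hmax
    have hbest : IsBest n S A cap nd k a y :=
      ⟨hay.2, fun j' hj' y' hy' h' => hmax j' y' ⟨⟨hj', hy'⟩, h'⟩⟩
    have hfirst : first (fun y => ∃ j < n, IsBest n S A cap nd k j y) n < n :=
      first_lt hay.1.2 ⟨a, hay.1.1, hbest⟩
    have he := P.nd_eq k hk _ rfl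
    rw [if_pos hfirst] at he
    obtain ⟨a', ha', hb'⟩ := first_spec hfirst
    rw [← he] at hb' hfirst
    rw [P.par_eq k hk] at h
    exact h (first_lt ha' ⟨hfirst, hb'⟩)

end IsPrimOrder

/-- The forest on which the clients are redistributed: node `k` is located at `nd k`, its clusters
are centered at `loc k`, with capacity `cap k`; client `v` starts at node `b v`. -/
structure IsForest (I : Instance) (R : ℝ≥0) (L : ℕ) (nd loc cap par b : ℕ → ℕ)
    (A : ℕ → ℕ → Prop) : Prop where
  prim : IsPrim I.n par cap A
  symm : ∀ i j, A i j → A j i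
  node : ∀ k < I.n, (L ≤ cap k ∧ L ≤ cnt (fun v => b v = k ∧ I.Near R v (nd (b v))) I.n) ∨
    (cnt (fun v => b v = k) I.n = 0 ∧ I.n ≤ par k ∧ ∀ j < I.n, par j ≠ k)
  client : ∀ v < I.n, b v < I.n → I.input.arr 0 v ≠ 0 ∧ nd (b v) < I.n ∧
    I.table v (nd (b v)) ≤ 3 * R
  par_dist : ∀ k < I.n, par k < I.n → nd k < I.n ∧ nd (par k) < I.n ∧
    I.table (nd (par k)) (nd k) ≤ 8 * R
  loc_spec : ∀ k < I.n, nd k < I.n → loc k < I.n ∧ I.table (nd k) (loc k) ≤ 2 * R ∧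
    I.input.arr 1 (loc k) ≠ 0 ∧ cap k = I.input.arr 2 (loc k)
  heavy : ∀ u < I.n, I.input.arr 1 u ≠ 0 → L ≤ cnt (fun v => I.Near R v u) I.n →
    L ≤ I.input.arr 2 u → (∀ v < I.n, I.Near R v u → b v < I.n ∧ I.input.arr 2 u ≤ cap (b v)) ∧
    ∀ v < I.n, ∀ v' < I.n, I.Near R v u → I.Near R v' u → A (b v) (b v')

/-- Positions with no facility (`nd k` not below `n`) are padding without clients and edges. At the
others, all neighbours of the selected facility are core clients, hence at least `L`. The neighbours
of a heavy facility form a clique, that facility itself witnessing every link. -/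
theorem isForest {I : Instance} {R : ℝ≥0} {L : ℕ} {heavy sel eff cap ub blob nd par b : ℕ → ℕ}
    (hL : 0 < L) (C : IsCover I R L heavy sel eff cap ub blob)
    (P : IsPrimOrder I.n (fun w => sel w ≠ 0) (I.Linked R heavy blob) cap nd par)
    (hb : ∀ v < I.n, b v = first (fun k => blob v < I.n ∧ nd k = blob v) I.n) :
    IsForest I R L nd (fun k => eff (nd k)) (fun k => cap (nd k)) par b
      fun i j => I.Linked R heavy blob (nd i) (nd j) := by
  have hA : ∀ x y, I.Linked R heavy blob x y → x < I.n ∧ y < I.n := fun x y h =>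
    ⟨(C.linked_dist hL h).1, (C.linked_dist hL h).2.1⟩
  have hb1 : ∀ v < I.n, b v < I.n → blob v < I.n ∧ nd (b v) = blob v := by
    intro v hv h
    rw [hb v hv] at h ⊢
    exact first_spec h
  have hb2 : ∀ v < I.n, blob v < I.n → b v < I.n := by
    intro v hv h
    obtain ⟨k, hk, he⟩ := P.exists_nd h (C.blob_spec hv h).1
    rw [hb v hv]
    exact first_lt hk ⟨h, he⟩
  have hpar : ∀ k < I.n, par k < I.n → nd k < I.n ∧ nd (par k) < I.n ∧
      I.table (nd (par k)) (nd k) ≤ 8 * R := by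
    intro k hk h
    obtain ⟨h1, h2⟩ := P.par_spec hk h
    obtain ⟨h3, -, h4⟩ := C.linked_dist hL h2.1.2.2.2
    exact ⟨h1, h3, h4⟩
  refine ⟨P.isPrim hA, fun i j h => h.symm, fun k hk => ?_, fun v hv h => ?_, hpar,
    fun k hk h => ?_, fun u hu h1 h2 h3 => ?_⟩
  · by_cases hn : nd k < I.n
    · left
      have hs := (P.nd_spec hk hn).1
      have hh := (C.heavy_iff _ hn).1 (C.heavy_of_sel hn hs)
      refine ⟨hh.2.2.trans ((C.eff_spec hL hn hs).2.2.2 _ hn (C.heavy_of_sel hn hs)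
        (C.meets_self hL hn (C.heavy_of_sel hn hs))), hh.2.1.trans (cnt_mono fun v hv hnv => ?_)⟩
      have he := C.blob_of_near_sel hv hn hs hnv
      have hbv := hb2 v hv (he ▸ hn)
      have hbk : b v = k :=
        P.nd_injective hbv hk ((hb1 v hv hbv).2.trans he) (by rw [(hb1 v hv hbv).2, he]; exact hn)
      exact ⟨hbk, by rwa [hbk]⟩
    · right
      refine ⟨cnt_eq_zero fun v hv h => ?_, ?_, fun j hj h => ?_⟩
      · subst h
        have := hb1 v hv hk
        exact hn (this.2 ▸ this.1)
      · by_contra! h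
        exact hn (hpar k hk h).1
      · subst h
        exact hn (hpar j hj hk).2.1
  · obtain ⟨h1, h2⟩ := hb1 v hv h
    obtain ⟨h3, h4⟩ := C.blob_dist hv h1
    rw [h2]
    exact ⟨h3, h1, h4⟩
  · obtain ⟨h1, h2, h3, -⟩ := C.eff_spec hL h (P.nd_spec hk h).1
    exact ⟨h1, h3.symm.dist_le h h1, ((C.heavy_iff _ h1).1 h2).1, C.cap_eq _ h⟩
  · have hu' : heavy u ≠ 0 := (C.heavy_iff u hu).2 ⟨h1, h2, h3⟩
    have hnear : ∀ v < I.n, I.Near R v u → b v < I.n ∧ nd (b v) = blob v := by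
      intro v hv hn
      have := hb2 v hv (C.blob_of_near_heavy hL hv hu hu' hn).1
      exact ⟨this, (hb1 v hv this).2⟩
    refine ⟨fun v hv hn => ⟨(hnear v hv hn).1, ?_⟩, fun v hv v' hv' hn hn' => ?_⟩
    · simp only [(hnear v hv hn).2]
      exact (C.blob_of_near_heavy hL hv hu hu' hn).2
    · exact ⟨u, hu, hu', ⟨v, hv, hn, (hnear v hv hn).2.symm⟩,
        ⟨v', hv', hn', (hnear v' hv' hn').2.symm⟩⟩

theorem IsPrim.congr_cap {n : ℕ} {par cap cap' : ℕ → ℕ} {A : ℕ → ℕ → Prop}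
    (P : IsPrim n par cap A) (h : ∀ k < n, cap' k = cap k) : IsPrim n par cap' A := by
  refine ⟨P.par_lt, P.adj, fun k hk hp i hi j hj hkj hij => ?_, P.root⟩
  rw [h i (by omega), h j hj, h _ hp, h k hk]
  exact P.max k hk hp i hi j hj hkj hij

theorem IsForest.congr_cap {I : Instance} {R : ℝ≥0} {L : ℕ} {nd loc cap cap' par b : ℕ → ℕ}
    {A : ℕ → ℕ → Prop} (F : IsForest I R L nd loc cap par b A) (h : ∀ k < I.n, cap' k = cap k) :
    IsForest I R L nd loc cap' par b A := by
  refine ⟨F.prim.congr_cap h, F.symm, fun k hk => ?_, F.client, F.par_dist, fun k hk hn => ?_,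
    fun u hu h1 h2 h3 => ?_⟩
  · rw [h k hk]
    exact F.node k hk
  · rw [h k hk]
    exact F.loc_spec k hk hn
  · obtain ⟨h4, h5⟩ := F.heavy u hu h1 h2 h3
    refine ⟨fun v hv hn => ?_, h5⟩
    rw [h _ (h4 v hv hn).1]
    exact h4 v hv hn

/-! ### Second stage: redistribution of the clients -/

namespace Term

/-- Layout of the second stage: arrays `14` to `20` hold `s`, `c`, `root`, `gap`, `pre`, `x`, `e` of
`Flow`. Array `21` holds ranks of core clients, `22` the offset of a node among its siblings, `27`
the child receiving a client, and `23` the final node. -/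
def totT (k : Term) : Term := add (count 44 (eq (.get 12 (.var 44)) k))
  (sumIf 45 (eq (.get 11 (.var 45)) k) (.get 14 (.var 45)))
def remT : Term :=
  .sub (totT (.var 21)) (mul 50 (div 46 50 (totT (.var 21)) (.var 4)) (.var 4))
def quotT : Term := div 46 50 (totT (.var 20)) (.var 4)
def rootT : Term :=
  .ite (lt (.get 11 (.var 20)) (.var 0)) (.get 16 (.get 11 (.var 20))) (.var 20)
def gapT : Term := mul 50 (.get 15 (.var 20)) (.sub (.get 13 (.var 20)) (.var 4))
def preT : Term := sumIf 45 (and (lt (.var 45) (.var 20))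
  (eq (.get 16 (.var 45)) (.get 16 (.var 20)))) (.get 17 (.var 45))
def extraT : Term := .sub
  (min (.get 14 (.get 16 (.var 20))) (.add (.get 18 (.var 20)) (.get 17 (.var 20))))
  (min (.get 14 (.get 16 (.var 20))) (.get 18 (.var 20)))
def backT : Term := add (.get 19 (.var 21))
  (sumIf 45 (eq (.get 11 (.var 45)) (.var 21)) (.get 20 (.var 45)))
def rankT : Term := count 45 (and (lt (.var 45) (.var 20))
  (and (eq (.get 12 (.var 45)) (.get 12 (.var 20))) (near (.var 45) (.get 10 (.get 12 (.var 45))))))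
def offT : Term := sumIf 45 (and (lt (.var 45) (.var 20))
  (eq (.get 11 (.var 45)) (.get 11 (.var 20)))) (.sub (.get 20 (.var 45)) (.get 14 (.var 45)))
def upT : Term := .sub (.get 14 (.get 12 (.var 20))) (.get 20 (.get 12 (.var 20)))
def childT : Term := .find 45 (and (eq (.get 11 (.var 45)) (.get 12 (.var 20)))
  (and (.le (.add upT (.get 22 (.var 45))) (.get 21 (.var 20)))
    (lt (.get 21 (.var 20)) (.add (.add upT (.get 22 (.var 45)))
      (.sub (.get 20 (.var 45)) (.get 14 (.var 45)))))))
def targetT : Term := .ite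
  (and (lt (.get 12 (.var 20)) (.var 0)) (near (.var 20) (.get 10 (.get 12 (.var 20)))))
  (.ite (lt (.get 21 (.var 20)) upT) (.get 11 (.get 12 (.var 20)))
    (.ite (lt (.get 27 (.var 20)) (.var 0)) (.get 27 (.var 20)) (.get 12 (.var 20))))
  (.get 12 (.var 20))

end Term

namespace Cmd

/-- Computation of the numbers of clusters and of the amounts passed along the forest. -/
def flowCmd : Cmd :=
  .seq (revFill 14 Term.remT) <| .seq (fill 15 Term.quotT) <| .seq (fill 16 Term.rootT) <|
  .seq (fill 17 Term.gapT) <| .seq (fill 18 Term.preT) <| .seq (fill 19 Term.extraT)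
    (revFill 20 Term.backT)

/-- Computation of the nodes that the clients are sent to. -/
def targetCmd : Cmd :=
  .seq (fill 21 Term.rankT) <| .seq (fill 22 Term.offT) <| .seq (fill 27 Term.childT)
    (fill 23 Term.targetT)

end Cmd

theorem sum_range_and_lt {n k : ℕ} (hk : k ≤ n) (p : ℕ → Prop) [DecidablePred p] (f : ℕ → ℕ) :
    (∑ j ∈ range n, if j < k ∧ p j then f j else 0) = ∑ j ∈ range k, if p j then f j else 0 := by
  rw [← sum_filter, ← sum_filter]
  refine sum_congr ?_ fun _ _ => rfl
  ext j
  simp only [mem_filter, mem_range]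
  constructor
  · tauto
  · rintro ⟨h, h'⟩
    exact ⟨by omega, h, h'⟩

theorem Instance.Holds.revFill {I : Instance} {L : ℕ} {R : ℝ≥0} {σ τ ρ : State}
    (h : I.Holds L R σ) {a i : ℕ} (ha : 2 < a) (hρ : Cmd.RevFillState a σ τ i ρ) :
    I.Holds L R ρ :=
  ⟨by rw [hρ.var 0 (by omega) (by omega), h.n_eq], by rw [hρ.var 4 (by omega) (by omega), h.L_eq],
    by rw [hρ.var 5 (by omega) (by omega), hρ.var 6 (by omega) (by omega), h.R_eq],
    by rw [hρ.arr 0 (by omega), h.clients], by rw [hρ.arr 1 (by omega), h.facilities],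
    by rw [hρ.arr 2 (by omega), h.bounds]⟩

section Stage

variable {I : Instance} {L : ℕ} {R : ℝ≥0} {σ ρ : State}

theorem eval_totT (h : I.Holds L R ρ) {x k : ℕ} (hx : x < 44) (hρ : ρ.var x = k) :
    (Term.totT (.var x)).eval I.table ρ = cnt (fun v => ρ.arr 12 v = k) I.n +
      ∑ j ∈ range I.n, if ρ.arr 11 j = k then ρ.arr 14 j else 0 := by
  simp [Term.totT, h.n_eq, hρ, show x ≠ 44 by omega, show x ≠ 45 by omega]

theorem eval_div_totT (h : I.Holds L R ρ) {x : ℕ} (hx : x < 44) (hL : 0 < L)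
    (hle : (Term.totT (.var x)).eval I.table ρ ≤ I.n * L) :
    (Term.div 46 50 (Term.totT (.var x)) (.var 4)).eval I.table ρ =
      (Term.totT (.var x)).eval I.table ρ / L := by
  rw [Term.eval_div (by decide) (by decide)]
  · simp [h.L_eq]
  · intro i
    simp [Term.totT, show x ≠ 44 by omega, show x ≠ 45 by omega, show x ≠ 46 by omega]
  · simp
  · simp
  · simpa [h.n_eq, h.L_eq] using hle
  · simpa [h.L_eq] using hL

/-- At most `n` clients start at a node and at most `n` children pass on at most `L - 1` each. So
the quotient by `L` is at most `n`, as bounded division requires. -/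
theorem tot_le {n L m : ℕ} {q : ℕ → Prop} [DecidablePred q] {s : ℕ → ℕ} (hL : 0 < L) (hm : m ≤ n)
    (hs : ∀ j < n, q j → s j < L) : m + (∑ j ∈ range n, if q j then s j else 0) ≤ n * L := by
  have : (∑ j ∈ range n, if q j then s j else 0) ≤ ∑ j ∈ range n, (L - 1) := by
    refine sum_le_sum fun j hj => ?_
    split_ifs with h
    · have := hs j (mem_range.1 hj) h
      omega
    · omega
  rw [sum_const, card_range, smul_eq_mul] at this
  calc _ ≤ n + n * (L - 1) := by omega
    _ = n * L := by
      obtain ⟨l, rfl⟩ : ∃ l, L = l + 1 := ⟨L - 1, by omega⟩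
      simp only [Nat.add_sub_cancel]
      ring

theorem run_flow (h : I.Holds L R σ) (hL : 0 < L) {core : ℕ → Prop}
    (hpar : ∀ k < I.n, σ.arr 11 k < I.n → σ.arr 11 k < k)
    (hnode : ∀ k < I.n,
      (L ≤ σ.arr 13 k ∧ L ≤ cnt (fun v => σ.arr 12 v = k ∧ core v) I.n) ∨
      (cnt (fun v => σ.arr 12 v = k) I.n = 0 ∧ I.n ≤ σ.arr 11 k ∧ ∀ j < I.n, σ.arr 11 j ≠ k)) :
    let τ := Cmd.flowCmd.run I.table σ
    Flow I.n L (σ.arr 11) (σ.arr 13) (σ.arr 12) core (τ.arr 14) (τ.arr 15) (τ.arr 16) (τ.arr 17)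
      (τ.arr 18) (τ.arr 19) (τ.arr 20) := by
  intro τ
  obtain ⟨σ₁, e₁⟩ : ∃ s, s = (Cmd.revFill 14 Term.remT).run I.table σ := ⟨_, rfl⟩
  obtain ⟨σ₂, e₂⟩ : ∃ s, s = (Cmd.fill 15 Term.quotT).run I.table σ₁ := ⟨_, rfl⟩
  obtain ⟨σ₃, e₃⟩ : ∃ s, s = (Cmd.fill 16 Term.rootT).run I.table σ₂ := ⟨_, rfl⟩
  obtain ⟨σ₄, e₄⟩ : ∃ s, s = (Cmd.fill 17 Term.gapT).run I.table σ₃ := ⟨_, rfl⟩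
  obtain ⟨σ₅, e₅⟩ : ∃ s, s = (Cmd.fill 18 Term.preT).run I.table σ₄ := ⟨_, rfl⟩
  obtain ⟨σ₆, e₆⟩ : ∃ s, s = (Cmd.fill 19 Term.extraT).run I.table σ₅ := ⟨_, rfl⟩
  obtain ⟨σ₇, e₇⟩ : ∃ s, s = (Cmd.revFill 20 Term.backT).run I.table σ₆ := ⟨_, rfl⟩
  have hτ : τ = σ₇ := by rw [e₇, e₆, e₅, e₄, e₃, e₂, e₁]; rfl
  have H₁ : I.Holds L R σ₁ := e₁ ▸ h.run rfl rfl
  have H₂ : I.Holds L R σ₂ := e₂ ▸ H₁.run rfl rfl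
  have H₃ : I.Holds L R σ₃ := e₃ ▸ H₂.run rfl rfl
  have H₄ : I.Holds L R σ₄ := e₄ ▸ H₃.run rfl rfl
  have H₅ : I.Holds L R σ₅ := e₅ ▸ H₄.run rfl rfl
  have H₆ : I.Holds L R σ₆ := e₆ ▸ H₅.run rfl rfl
  obtain ⟨-, a₁, g₁⟩ := Cmd.run_revFill (D := I.table) 14 Term.remT σ
  obtain ⟨-, a₂, g₂⟩ := Cmd.run_fill (D := I.table) 15 Term.quotT σ₁
  obtain ⟨-, a₃, g₃⟩ := Cmd.run_fill (D := I.table) 16 Term.rootT σ₂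
  obtain ⟨-, a₄, g₄⟩ := Cmd.run_fill (D := I.table) 17 Term.gapT σ₃
  obtain ⟨-, a₅, g₅⟩ := Cmd.run_fill (D := I.table) 18 Term.preT σ₄
  obtain ⟨-, a₆, g₆⟩ := Cmd.run_fill (D := I.table) 19 Term.extraT σ₅
  obtain ⟨-, a₇, g₇⟩ := Cmd.run_revFill (D := I.table) 20 Term.backT σ₆
  rw [← e₁, h.n_eq] at g₁
  rw [← e₂, H₁.n_eq] at g₂
  rw [← e₃, H₂.n_eq] at g₃
  rw [← e₄, H₃.n_eq] at g₄
  rw [← e₅, H₄.n_eq] at g₅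
  rw [← e₆, H₅.n_eq] at g₆
  rw [← e₇, H₆.n_eq] at g₇
  rw [← e₁] at a₁
  rw [← e₂] at a₂
  rw [← e₃] at a₃
  rw [← e₄] at a₄
  rw [← e₅] at a₅
  rw [← e₆] at a₆
  rw [← e₇] at a₇
  clear e₁ e₂ e₃ e₄ e₅ e₆ e₇
  have b₁₄ : σ₇.arr 14 = σ₁.arr 14 := by
    rw [a₇ _ (by decide), a₆ _ (by decide), a₅ _ (by decide), a₄ _ (by decide),
      a₃ _ (by decide), a₂ _ (by decide)]
  have b₁₅ : σ₇.arr 15 = σ₂.arr 15 := by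
    rw [a₇ _ (by decide), a₆ _ (by decide), a₅ _ (by decide), a₄ _ (by decide), a₃ _ (by decide)]
  have b₁₆ : σ₇.arr 16 = σ₃.arr 16 := by
    rw [a₇ _ (by decide), a₆ _ (by decide), a₅ _ (by decide), a₄ _ (by decide)]
  have b₁₇ : σ₇.arr 17 = σ₄.arr 17 := by
    rw [a₇ _ (by decide), a₆ _ (by decide), a₅ _ (by decide)]
  have b₁₈ : σ₇.arr 18 = σ₅.arr 18 := by rw [a₇ _ (by decide), a₆ _ (by decide)]
  have b₁₉ : σ₇.arr 19 = σ₆.arr 19 := by rw [a₇ _ (by decide)]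
  -- Downward induction on `k`: the values at the children, which have larger numbers, must be known
  -- to be below `L` before the division at `k` is justified.
  have hs : ∀ d k, k < I.n → I.n - k ≤ d → σ₁.arr 14 k < L ∧
      σ₁.arr 14 k = (cnt (fun v => σ.arr 12 v = k) I.n +
        ∑ j ∈ range I.n, if σ.arr 11 j = k then σ₁.arr 14 j else 0) % L := by
    intro d
    induction d with
    | zero => intro k hk hd; omega
    | succ d ih =>
      intro k hk hd
      have hch : ∀ j < I.n, σ.arr 11 j = k → k < j := fun j hj hjk =>
        hjk ▸ hpar j hj (hjk ▸ hk)
      obtain ⟨ρ, hρ, he⟩ := g₁ k hk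
      have hh := h.revFill (by omega) hρ
      have htot : (Term.totT (.var 21)).eval I.table ρ = cnt (fun v => σ.arr 12 v = k) I.n +
          ∑ j ∈ range I.n, if σ.arr 11 j = k then σ₁.arr 14 j else 0 := by
        rw [eval_totT hh (by decide) hρ.idx, hρ.arr 12 (by decide), hρ.arr 11 (by decide)]
        congr 1
        refine sum_congr rfl fun j hj => ?_
        rw [mem_range] at hj
        split_ifs with hjk
        · exact hρ.next j (hch j hj hjk) (by rwa [h.n_eq])
        · rfl
      have hle : (Term.totT (.var 21)).eval I.table ρ ≤ I.n * L := by
        rw [htot]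
        refine tot_le hL cnt_le fun j hj hjk => (ih j hj ?_).1
        have := hch j hj hjk
        omega
      have hdiv := eval_div_totT hh (by decide) hL hle
      have hval : σ₁.arr 14 k = (Term.totT (.var 21)).eval I.table ρ % L := by
        rw [he, Term.remT, Term.eval_sub, Term.eval_mul, hdiv, Term.eval_var, hh.L_eq,
          Nat.mod_eq_sub_div_mul]
        · intro i
          simp [Term.div, Term.totT, Term.mul]
        · simp
        · rw [hdiv, hh.n_eq]
          exact Nat.div_le_of_le_mul (by rwa [mul_comm])
      rw [← htot]
      exact ⟨hval ▸ Nat.mod_lt _ hL, hval⟩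
  have hs' : ∀ k < I.n, _ := fun k hk => hs I.n k hk (by omega)
  have htle : ∀ k < I.n, cnt (fun v => σ.arr 12 v = k) I.n +
      (∑ j ∈ range I.n, if σ.arr 11 j = k then σ₁.arr 14 j else 0) ≤ I.n * L := fun k hk =>
    tot_le hL cnt_le fun j hj _ => (hs' j hj).1
  have hc : ∀ k < I.n, σ₂.arr 15 k = (cnt (fun v => σ.arr 12 v = k) I.n +
      ∑ j ∈ range I.n, if σ.arr 11 j = k then σ₁.arr 14 j else 0) / L := by
    intro k hk
    obtain ⟨ρ, hρ, he⟩ := g₂ k hk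
    have hh := H₁.fill (by omega) hρ
    have htot := eval_totT hh (by decide) hρ.idx
    rw [hρ.arr 12 (by decide), hρ.arr 11 (by decide), hρ.arr 14 (by decide), a₁ 12 (by decide),
      a₁ 11 (by decide)] at htot
    rw [he, Term.quotT, eval_div_totT hh (by decide) hL (htot ▸ htle k hk), htot]
  have hroot : ∀ k < I.n, σ₃.arr 16 k = if σ.arr 11 k < I.n then σ₃.arr 16 (σ.arr 11 k) else k := by
    intro k hk
    obtain ⟨ρ, hρ, he⟩ := g₃ k hk
    have hh := H₂.fill (by omega) hρ
    rw [he]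
    simp only [Term.rootT, Term.eval_ite, Term.tr_lt, Term.eval_get, Term.eval_var, hρ.idx,
      hh.n_eq, hρ.arr 11 (by decide), a₂ 11 (by decide), a₁ 11 (by decide)]
    split_ifs with hp
    · exact hρ.prev _ (hpar k hk hp)
    · rfl
  rw [hτ, b₁₄, b₁₅, b₁₆, b₁₇, b₁₈, b₁₉]
  refine ⟨hL, hpar, hnode, fun k hk => ?_, fun k hk => (hs' k hk).1, hroot, fun k hk => ?_,
    fun k hk => ?_, fun k hk => ?_, fun k hk => ?_⟩
  · rw [hc k hk, (hs' k hk).2]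
    exact Nat.div_add_mod _ _
  · obtain ⟨ρ, hρ, he⟩ := g₄ k hk
    have hh := H₃.fill (by omega) hρ
    have h15 : ρ.arr 15 = σ₂.arr 15 := by rw [hρ.arr 15 (by decide), a₃ 15 (by decide)]
    have h13 : ρ.arr 13 = σ.arr 13 := by
      rw [hρ.arr 13 (by decide), a₃ 13 (by decide), a₂ 13 (by decide), a₁ 13 (by decide)]
    rw [he, Term.gapT, Term.eval_mul]
    · simp [hρ.idx, h15, h13, hh.L_eq]
    · simp
    · simp
    · simp only [Term.eval_get, Term.eval_var, hρ.idx, h15, hh.n_eq]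
      rw [hc k hk]
      exact Nat.div_le_of_le_mul (by rw [mul_comm]; exact htle k hk)
  · obtain ⟨ρ, hρ, he⟩ := g₅ k hk
    have hh := H₄.fill (by omega) hρ
    rw [he, ← sum_range_and_lt hk.le]
    simp [Term.preT, hρ.idx, hh.n_eq, hρ.arr 16, hρ.arr 17, a₄]
  · obtain ⟨ρ, hρ, he⟩ := g₆ k hk
    rw [he]
    simp [Term.extraT, hρ.idx, hρ.arr 14, hρ.arr 16, hρ.arr 17, hρ.arr 18, a₅, a₄, a₃, a₂]
  · obtain ⟨ρ, hρ, he⟩ := g₇ k hk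
    have hh := H₆.revFill (by omega) hρ
    have hch : ∀ j < I.n, σ.arr 11 j = k → k < j := fun j hj hjk =>
      hjk ▸ hpar j hj (hjk ▸ hk)
    have : ∀ j ∈ range I.n, (if σ.arr 11 j = k then σ₇.arr 20 j else 0) =
        if σ.arr 11 j = k then ρ.arr 20 j else 0 := by
      intro j hj
      rw [mem_range] at hj
      split_ifs with hjk
      · exact (hρ.next j (hch j hj hjk) (by rwa [H₆.n_eq])).symm
      · rfl
    rw [he, sum_congr rfl this]
    simp [Term.backT, hρ.idx, hh.n_eq, hρ.arr 19, hρ.arr 11, a₆, a₅, a₄, a₃, a₂, a₁]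

end Stage

/-- The distribution of the core clients of a node according to their ranks. -/
noncomputable def destFun (n : ℕ) (par s e : ℕ → ℕ) (w r : ℕ) : ℕ :=
  let j := first (fun j => par j = w ∧
    (s w - e w) + (∑ i ∈ range j, if par i = par j then e i - s i else 0) ≤ r ∧
    r < (s w - e w) + (∑ i ∈ range j, if par i = par j then e i - s i else 0) + (e j - s j)) n
  if r < s w - e w then par w else if j < n then j else w

/-- In `destFun` the offset of `j` refers to `par j` instead of `w`, so it can be tabulated once per
node. Both agree for children of `w`, and `prefix_unique` shows that at most one child claims a
rank. -/
theorem isDest_destFun (n : ℕ) (par s e : ℕ → ℕ) : Flow.IsDest n par s e (destFun n par s e) := by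
  refine ⟨fun w _ r hr => if_pos hr, fun w _ r j hj hjw h1 h2 => ?_, fun w _ r hr hno => ?_⟩
  · rw [destFun, if_neg (by omega)]
    have : first (fun j => par j = w ∧
        (s w - e w) + (∑ i ∈ range j, if par i = par j then e i - s i else 0) ≤ r ∧
        r < (s w - e w) + (∑ i ∈ range j, if par i = par j then e i - s i else 0) + (e j - s j))
        n = j := by
      refine first_eq hj ⟨hjw, by simpa only [hjw] using h1, by simpa only [hjw] using h2⟩ ?_
      rintro j' hj' ⟨hjw', h1', h2'⟩
      simp only [hjw'] at h1' h2'
      refine prefix_unique (fun i => if par i = w then e i - s i else 0) (i := r - (s w - e w))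
        (by omega) ?_ (by omega) ?_
      · simp only [hjw', if_true]
        omega
      · simp only [hjw, if_true]
        omega
    simp only [this, if_pos hj]
  · rw [destFun, if_neg hr]
    refine if_neg fun hlt => ?_
    obtain ⟨h1, h2, h3⟩ := first_spec hlt
    simp only [h1] at h2 h3
    exact hno _ hlt h1 h2 h3

section Stage

variable {I : Instance} {L : ℕ} {R : ℝ≥0} {σ ρ : State}

theorem run_target (h : I.Holds L R σ) :
    let τ := Cmd.targetCmd.run I.table σ
    (∀ v < I.n, σ.arr 12 v < I.n → I.Near R v (σ.arr 10 (σ.arr 12 v)) →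
      τ.arr 23 v = destFun I.n (σ.arr 11) (σ.arr 14) (σ.arr 20) (σ.arr 12 v)
        (cnt (fun u => σ.arr 12 u = σ.arr 12 v ∧ I.Near R u (σ.arr 10 (σ.arr 12 u))) v)) ∧
    ∀ v < I.n, ¬ (σ.arr 12 v < I.n ∧ I.Near R v (σ.arr 10 (σ.arr 12 v))) →
      τ.arr 23 v = σ.arr 12 v := by
  classical
  intro τ
  obtain ⟨σ₁, e₁⟩ : ∃ s, s = (Cmd.fill 21 Term.rankT).run I.table σ := ⟨_, rfl⟩
  obtain ⟨σ₂, e₂⟩ : ∃ s, s = (Cmd.fill 22 Term.offT).run I.table σ₁ := ⟨_, rfl⟩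
  obtain ⟨σ₃, e₃⟩ : ∃ s, s = (Cmd.fill 27 Term.childT).run I.table σ₂ := ⟨_, rfl⟩
  obtain ⟨σ₄, e₄⟩ : ∃ s, s = (Cmd.fill 23 Term.targetT).run I.table σ₃ := ⟨_, rfl⟩
  have hτ : τ = σ₄ := by rw [e₄, e₃, e₂, e₁]; rfl
  have H₁ : I.Holds L R σ₁ := e₁ ▸ h.run rfl rfl
  have H₂ : I.Holds L R σ₂ := e₂ ▸ H₁.run rfl rfl
  have H₃ : I.Holds L R σ₃ := e₃ ▸ H₂.run rfl rfl
  obtain ⟨-, a₁, g₁⟩ := Cmd.run_fill (D := I.table) 21 Term.rankT σ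
  obtain ⟨-, a₂, g₂⟩ := Cmd.run_fill (D := I.table) 22 Term.offT σ₁
  obtain ⟨-, a₃, g₃⟩ := Cmd.run_fill (D := I.table) 27 Term.childT σ₂
  obtain ⟨-, a₄, g₄⟩ := Cmd.run_fill (D := I.table) 23 Term.targetT σ₃
  rw [← e₁, h.n_eq] at g₁
  rw [← e₂, H₁.n_eq] at g₂
  rw [← e₃, H₂.n_eq] at g₃
  rw [← e₄, H₃.n_eq] at g₄
  rw [← e₁] at a₁
  rw [← e₂] at a₂
  rw [← e₃] at a₃
  rw [← e₄] at a₄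
  clear e₁ e₂ e₃ e₄
  have hrank : ∀ v < I.n, σ₁.arr 21 v =
      cnt (fun u => σ.arr 12 u = σ.arr 12 v ∧ I.Near R u (σ.arr 10 (σ.arr 12 u))) v := by
    intro v hv
    obtain ⟨ρ, hρ, he⟩ := g₁ v hv
    have hh := h.fill (by omega) hρ
    rw [he, ← cnt_and_lt hv.le]
    simp [Term.rankT, Term.near, Instance.Near, hρ.idx, hh.n_eq, hh.clients, hh.R_eq, hρ.arr 12,
      hρ.arr 10]
  have hoff : ∀ j < I.n, σ₂.arr 22 j = ∑ i ∈ range j,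
      if σ.arr 11 i = σ.arr 11 j then σ.arr 20 i - σ.arr 14 i else 0 := by
    intro j hj
    obtain ⟨ρ, hρ, he⟩ := g₂ j hj
    have hh := H₁.fill (by omega) hρ
    rw [he, ← sum_range_and_lt hj.le]
    simp [Term.offT, hρ.idx, hh.n_eq, hρ.arr 11, hρ.arr 20, hρ.arr 14, a₁]
  have hchild : ∀ v < I.n, σ₃.arr 27 v = first (fun j => σ.arr 11 j = σ.arr 12 v ∧
      (σ.arr 14 (σ.arr 12 v) - σ.arr 20 (σ.arr 12 v)) + σ₂.arr 22 j ≤ σ₁.arr 21 v ∧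
      σ₁.arr 21 v < (σ.arr 14 (σ.arr 12 v) - σ.arr 20 (σ.arr 12 v)) + σ₂.arr 22 j +
        (σ.arr 20 j - σ.arr 14 j)) I.n := by
    intro v hv
    obtain ⟨ρ, hρ, he⟩ := g₃ v hv
    have hh := H₂.fill (by omega) hρ
    rw [he]
    simp [Term.childT, Term.upT, hρ.idx, hh.n_eq, hρ.arr 11, hρ.arr 12, hρ.arr 14, hρ.arr 20,
      hρ.arr 21, hρ.arr 22, a₁, a₂]
  have htgt : ∀ v < I.n, σ₄.arr 23 v =
      if σ.arr 12 v < I.n ∧ I.Near R v (σ.arr 10 (σ.arr 12 v)) then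
        if σ₁.arr 21 v < σ.arr 14 (σ.arr 12 v) - σ.arr 20 (σ.arr 12 v) then
          σ.arr 11 (σ.arr 12 v)
        else if σ₃.arr 27 v < I.n then σ₃.arr 27 v else σ.arr 12 v
      else σ.arr 12 v := by
    intro v hv
    obtain ⟨ρ, hρ, he⟩ := g₄ v hv
    have hh := H₃.fill (by omega) hρ
    rw [he]
    simp [Term.targetT, Term.upT, Term.near, Instance.Near, hρ.idx, hh.n_eq, hh.clients, hh.R_eq,
      hρ.arr 10, hρ.arr 11, hρ.arr 12, hρ.arr 14, hρ.arr 20, hρ.arr 21, hρ.arr 27, a₁, a₂, a₃]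
    congr
  rw [hτ]
  refine ⟨fun v hv hb hn => ?_, fun v hv hn => by rw [htgt v hv, if_neg hn]⟩
  have hfirst : σ₃.arr 27 v = first (fun j => σ.arr 11 j = σ.arr 12 v ∧
      (σ.arr 14 (σ.arr 12 v) - σ.arr 20 (σ.arr 12 v)) + (∑ i ∈ range j,
        if σ.arr 11 i = σ.arr 11 j then σ.arr 20 i - σ.arr 14 i else 0) ≤ σ₁.arr 21 v ∧
      σ₁.arr 21 v < (σ.arr 14 (σ.arr 12 v) - σ.arr 20 (σ.arr 12 v)) + (∑ i ∈ range j,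
        if σ.arr 11 i = σ.arr 11 j then σ.arr 20 i - σ.arr 14 i else 0) +
        (σ.arr 20 j - σ.arr 14 j)) I.n := by
    rw [hchild v hv]
    exact first_congr fun j hj => by rw [hoff j hj]
  rw [htgt v hv, if_pos ⟨hb, hn⟩, destFun, ← hrank v hv, ← hfirst]

end Stage

/-! ### From targets to solutions -/

/-- The arrays `cen` and `asg` encode `a` clusters with lower bound `L` and radius `11 * R`. -/
structure IsPlan (I : Instance) (L : ℕ) (R : ℝ≥0) (a : ℕ) (cen asg : ℕ → ℕ) : Prop where
  le : a ≤ I.n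
  center : ∀ j < a, cen j < I.n ∧ I.input.arr 1 (cen j) ≠ 0 ∧
    L ≤ cnt (fun v => asg v = j + 1) I.n ∧
    cnt (fun v => asg v = j + 1) I.n ≤ I.input.arr 2 (cen j)
  client : ∀ v < I.n, asg v ≠ 0 → I.input.arr 0 v ≠ 0 ∧ asg v ≤ a ∧
    I.table v (cen (asg v - 1)) ≤ 11 * R

theorem cnt_fiber_lt {n : ℕ} (f : ℕ → ℕ) (m : ℕ) :
    cnt (fun v => f v < m) n = ∑ k ∈ range m, cnt (fun v => f v = k) n := by
  simpa using cnt_eq_sum_fiber (p := fun _ => True) (n := n) f m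

namespace Flow

variable {n L : ℕ} {par cap b : ℕ → ℕ} {core : ℕ → Prop} {s c root gap pre x e : ℕ → ℕ}

theorem eq_zero_or_le (F : Flow n L par cap b core s c root gap pre x e) {k : ℕ} (hk : k < n) :
    c k = 0 ∨ (L ≤ cap k ∧ L ≤ cnt (fun v => b v = k ∧ core v) n) := by
  rcases F.node k hk with h | ⟨h1, -, h2⟩
  · exact .inr h
  · left
    have := F.bal k hk
    rw [h1, sum_eq_zero fun j hj => if_neg (h2 j (mem_range.1 hj))] at this
    have hL := F.L_pos
    have : L * c k = 0 := by omega
    rcases Nat.mul_eq_zero.1 this with h | h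
    · omega
    · exact h

/-- Node `k` takes back at most its gap `c k * (cap k - L)`, and this vanishes if it has no cluster.
-/
theorem served_le (F : Flow n L par cap b core s c root gap pre x e) {k : ℕ} (hk : k < n) :
    L * c k + x k ≤ c k * cap k := by
  have hx : x k ≤ c k * (cap k - L) := by
    rw [F.x_eq k hk, ← F.gap_eq k hk]
    omega
  rcases F.eq_zero_or_le hk with h | ⟨h, -⟩
  · rw [h, zero_mul] at hx
    simp [h, Nat.le_zero.1 hx]
  · obtain ⟨d, hd⟩ := Nat.exists_eq_add_of_le h
    rw [hd] at hx ⊢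
    rw [Nat.add_sub_cancel_left] at hx
    calc L * c k + x k ≤ L * c k + c k * d := by omega
      _ = c k * (L + d) := by ring

end Flow

section Plan

variable {I : Instance} {R : ℝ≥0} {L : ℕ} {nd loc cap par b : ℕ → ℕ} {A : ℕ → ℕ → Prop}
  {s c root gap pre x e tgt cen asg : ℕ → ℕ} {dest : ℕ → ℕ → ℕ}

/-- A core client is within `R` of its node and crosses at most one edge of length at most `8 * R`;
any other client stays at its node, within `3 * R`. -/
theorem dist_target_le (hF : IsForest I R L nd loc cap par b A)
    (F : Flow I.n L par cap b (fun v => I.Near R v (nd (b v))) s c root gap pre x e)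
    (hd : Flow.IsDest I.n par s e dest)
    (ht : ∀ v < I.n, b v < I.n → I.Near R v (nd (b v)) →
      tgt v = dest (b v) (cnt (fun u => b u = b v ∧ I.Near R u (nd (b u))) v))
    (ht' : ∀ v < I.n, ¬ (b v < I.n ∧ I.Near R v (nd (b v))) → tgt v = b v) {v : ℕ}
    (hv : v < I.n) (h : tgt v < I.n) :
    I.input.arr 0 v ≠ 0 ∧ nd (tgt v) < I.n ∧ I.table v (nd (tgt v)) ≤ 9 * R := by
  by_cases hcore : b v < I.n ∧ I.Near R v (nd (b v))
  · obtain ⟨hb, hn⟩ := hcore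
    have hnd := (hF.client v hv hb).2.1
    have key : ∀ w, nd w < I.n → I.table (nd (b v)) (nd w) ≤ 8 * R →
        I.table v (nd w) ≤ 9 * R := fun w hw hle =>
      calc I.table v (nd w) ≤ I.table v (nd (b v)) + I.table (nd (b v)) (nd w) :=
            I.table_triangle hv hnd hw
        _ ≤ R + 8 * R := add_le_add hn.2 hle
        _ = 9 * R := by ring
    refine ⟨hn.1, ?_⟩
    rw [ht v hv hb hn] at h ⊢
    generalize cnt (fun u => b u = b v ∧ I.Near R u (nd (b u))) v = r at h ⊢
    rcases F.dest_cases hd hb r with ⟨-, h1⟩ | ⟨j, hj, h1, -, -, -, h2⟩ | ⟨-, h1⟩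
    · rw [h1] at h ⊢
      obtain ⟨-, h2, h3⟩ := hF.par_dist _ hb h
      exact ⟨h2, key _ h2 (by rwa [I.table_comm])⟩
    · rw [h2]
      obtain ⟨h3, -, h4⟩ := hF.par_dist j hj (by rwa [h1])
      rw [h1] at h4
      exact ⟨h3, key _ h3 h4⟩
    · rw [h1]
      exact ⟨hnd, hn.2.trans (le_mul_of_one_le_left' (by norm_num))⟩
  · rw [ht' v hv hcore] at h ⊢
    obtain ⟨h1, h2, h3⟩ := hF.client v hv h
    exact ⟨h1, h2, h3.trans (mul_le_mul_left (by norm_num) R)⟩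

/-- The node is within `9 * R` of the client by `dist_target_le` and the center within `2 * R` of
the node, which gives `11 * R`. -/
theorem isPlan (hF : IsForest I R L nd loc cap par b A)
    (F : Flow I.n L par cap b (fun v => I.Near R v (nd (b v))) s c root gap pre x e)
    (hd : Flow.IsDest I.n par s e dest)
    (ht : ∀ v < I.n, b v < I.n → I.Near R v (nd (b v)) →
      tgt v = dest (b v) (cnt (fun u => b u = b v ∧ I.Near R u (nd (b u))) v))
    (ht' : ∀ v < I.n, ¬ (b v < I.n ∧ I.Near R v (nd (b v))) → tgt v = b v)
    (hasg : ∀ v < I.n, asg v = if tgt v < I.n then ∑ j ∈ range (tgt v), c j +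
      cnt (fun u => tgt u = tgt v) v % c (tgt v) + 1 else 0)
    (hcen : ∀ j < I.n, cen j = loc (first (fun k => ∑ i ∈ range k, c i ≤ j ∧
      j < ∑ i ∈ range k, c i + c k) I.n)) :
    IsPlan I L R (∑ k ∈ range I.n, c k) cen asg := by
  have hcnt : ∀ k < I.n, cnt (fun v => tgt v = k) I.n = L * c k + x k := fun k hk =>
    F.cnt_target hd ht ht' hk
  -- Every cluster has a client since `0 < L`; hence the list of centers fits into `n` array
  -- entries.
  have hle : ∑ k ∈ range I.n, c k ≤ I.n := by
    calc ∑ k ∈ range I.n, c k ≤ ∑ k ∈ range I.n, cnt (fun v => tgt v = k) I.n := by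
          refine sum_le_sum fun k hk => ?_
          rw [hcnt k (mem_range.1 hk)]
          exact (Nat.le_mul_of_pos_left _ F.L_pos).trans (Nat.le_add_right _ _)
      _ = cnt (fun v => tgt v < I.n) I.n := (cnt_fiber_lt tgt I.n).symm
      _ ≤ I.n := cnt_le
  obtain ⟨h1, h2⟩ := cnt_copy (n := I.n) (L := L) (tgt := tgt) (c := c) (cap := cap)
    (asg := fun v => asg v - 1)
    (fun k hk => by rw [hcnt k hk, mul_comm]; omega)
    (fun k hk => by rw [hcnt k hk]; exact F.served_le hk)
    (fun v hv h => by rw [hasg v hv, if_pos h]; rfl)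
  have hasg' : ∀ j, cnt (fun v => asg v = j + 1) I.n =
      cnt (fun v => tgt v < I.n ∧ asg v - 1 = j) I.n := by
    refine fun j => cnt_congr fun v hv => ?_
    have := hasg v hv
    split_ifs at this with h
    · simp only [h, true_and]
      omega
    · simp only [h, false_and, iff_false]
      omega
  have hcen' : ∀ k < I.n, ∀ j, ∑ i ∈ range k, c i ≤ j → j < ∑ i ∈ range k, c i + c k →
      cen j = loc k := by
    intro k hk j hj hj'
    have hj2 : j < ∑ k ∈ range I.n, c k :=
      hj'.trans_le (by rw [← sum_range_succ]; exact prefix_mono c hk)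
    rw [hcen j (hj2.trans_le hle)]
    congr 1
    exact first_eq hk ⟨hj, hj'⟩ fun i _ hi => prefix_unique c hi.1 hi.2 hj hj'
  have hnd : ∀ k < I.n, 0 < c k → nd k < I.n := by
    intro k hk hc
    rcases F.eq_zero_or_le hk with h | ⟨-, h⟩
    · omega
    · obtain ⟨v, hv, rfl, -⟩ := exists_of_cnt_pos (F.L_pos.trans_le h)
      exact (hF.client v hv hk).2.1
  refine ⟨hle, fun j hj => ?_, fun v hv h => ?_⟩
  · obtain ⟨k, hk, hj1, hj2⟩ := exists_prefix c hj
    obtain ⟨h3, -, h4, h5⟩ := hF.loc_spec k hk (hnd k hk (by omega))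
    rw [hcen' k hk j hj1 hj2, hasg', ← h5]
    exact ⟨h3, h4, h2 k hk j hj1 hj2⟩
  · have ha := hasg v hv
    split_ifs at ha with htv
    · obtain ⟨h3, h4⟩ := h1 v hv htv
      obtain ⟨h5, h6, h7⟩ := dist_target_le hF F hd ht ht' hv htv
      obtain ⟨h8, h9, -⟩ := hF.loc_spec _ htv h6
      refine ⟨h5, ?_, ?_⟩
      · have : ∑ j ∈ range (tgt v), c j + c (tgt v) ≤ ∑ k ∈ range I.n, c k := by
          rw [← sum_range_succ]
          exact prefix_mono c htv
        omega
      · rw [hcen' _ htv _ h3 h4]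
        calc I.table v (loc (tgt v)) ≤ I.table v (nd (tgt v)) + I.table (nd (tgt v)) (loc (tgt v)) :=
              I.table_triangle hv h6 h8
          _ ≤ 9 * R + 2 * R := add_le_add h7 h9
          _ = 11 * R := by ring
    · exact absurd ha h

theorem sum_load (S : Solution I) : ∑ j, S.load j = #S.served := by
  simp only [Solution.load]
  rw [← card_eq_sum_card_fiberwise (fun _ _ => mem_univ _)]
  simp

theorem Instance.table_val (i j : Fin I.n) : I.table i j = I.d i j := by
  rw [Instance.table, dif_pos ⟨i.2, j.2⟩]

/-- Every center with at least one client is heavy, so its clients lie in a clique of nodes with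
sufficient capacity and `Flow.card_le_served` applies. Centers without clients contribute nothing
and are discarded, which also settles `I.L = 0`. -/
theorem card_served_le (hF : IsForest I R L nd loc cap par b A) (hLI : L = max I.L 1)
    (F : Flow I.n L par cap b (fun v => I.Near R v (nd (b v))) s c root gap pre x e)
    (S : Solution I) (hS : S.IsFeasible) (hR : S.radius ≤ R) :
    #S.served ≤ ∑ k ∈ range I.n, (L * c k + x k) := by
  classical
  set X : Fin S.copies → Finset ℕ := fun j =>
    (univ.filter fun v => S.assign v = j).image fun v => (v.1 : ℕ) with hXdef
  have hmem : ∀ j w, w ∈ X j ↔ ∃ v : {v // v ∈ S.served}, S.assign v = j ∧ (v.1 : ℕ) = w := by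
    intro j w
    simp only [hXdef, mem_image, mem_filter, mem_univ, true_and]
  have hcard : ∀ j, #(X j) = S.load j := fun j =>
    card_image_of_injective _ fun v w h => Subtype.ext (Fin.ext h)
  have hnear : ∀ j, ∀ w ∈ X j, w < I.n ∧ I.Near R w (S.center j) := by
    intro j w hw
    obtain ⟨v, rfl, rfl⟩ := (hmem j w).1 hw
    refine ⟨v.1.2, ?_, ?_⟩
    · simp [Instance.input, hS.served_subset v.2]
    · rw [I.table_val]
      refine le_trans ?_ hR
      exact le_sup (f := fun v : {v // v ∈ S.served} => I.d v (S.center (S.assign v))) (mem_univ v)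
  have hfac : ∀ j, I.input.arr 1 (S.center j) ≠ 0 := fun j => by
    simp [Instance.input, hS.center_mem j]
  have hub : ∀ j, I.input.arr 2 (S.center j) = I.U (S.center j) := fun j => by
    simp [Instance.input, hS.center_mem j]
  have hlow : ∀ j, 0 < S.load j → L ≤ #(X j) := fun j hj => by
    rw [hLI, hcard]
    exact max_le (hS.lower j) hj
  have hcnt : ∀ j, #(X j) ≤ cnt (fun v => I.Near R v (S.center j)) I.n := fun j => by
    rw [cnt_eq_card]
    refine card_le_card fun w hw => ?_
    simpa using hnear j w hw
  have hheavy : ∀ j, 0 < S.load j → _ := fun j hj =>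
    hF.heavy (S.center j) (S.center j).2 (hfac j) ((hlow j hj).trans (hcnt j))
      ((hlow j hj).trans (by rw [hcard, hub]; exact hS.upper j))
  have := F.card_le_served hF.symm hF.prim (univ.filter fun j => 0 < S.load j) X
    (fun j => I.U (S.center j)) ?_ ?_ ?_ ?_ ?_
  · rw [← sum_load S]
    refine le_trans (le_of_eq ?_) this
    simp only [hcard]
    refine (sum_filter_of_ne fun j _ h => Nat.pos_of_ne_zero h).symm
  · intro j _ j' _ hne
    refine disjoint_left.2 fun w hw hw' => hne ?_
    obtain ⟨v, rfl, hv⟩ := (hmem j w).1 hw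
    obtain ⟨v', rfl, hv'⟩ := (hmem j' w).1 hw'
    rw [show v = v' from Subtype.ext (Fin.ext (hv.trans hv'.symm))]
  · simpa using hlow
  · intro j _
    rw [hcard]
    exact hS.upper j
  · intro j hj w hw
    obtain ⟨h1, h2⟩ := hnear j w hw
    obtain ⟨h3, h4⟩ := (hheavy j (mem_filter.1 hj).2).1 w h1 h2
    exact ⟨h1, h3, hub j ▸ h4⟩
  · intro j hj w hw w' hw'
    obtain ⟨h1, h2⟩ := hnear j w hw
    obtain ⟨h3, h4⟩ := hnear j w' hw'
    exact (hheavy j (mem_filter.1 hj).2).2 w h1 w' h3 h2 h4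

end Plan

theorem cnt_eq_card_fin (q : ℕ → Prop) (n : ℕ) [DecidablePred q] :
    cnt q n = #(univ.filter fun v : Fin n => q v) := by
  rw [cnt_eq_card, ← card_image_of_injective _ Fin.val_injective]
  congr 1
  ext v
  simp only [mem_filter, mem_range, mem_image, mem_univ, true_and]
  exact ⟨fun h => ⟨⟨v, h.1⟩, h.2, rfl⟩, fun ⟨w, h, hw⟩ => hw ▸ ⟨w.2, h⟩⟩

theorem IsPlan.exists_solution {I : Instance} {L a : ℕ} {R : ℝ≥0} {cen asg : ℕ → ℕ} (hL : I.L ≤ L)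
    (h : IsPlan I L R a cen asg) (hp : I.p ≤ cnt (fun v => asg v ≠ 0) I.n) {τ : State}
    (h3 : τ.var 3 = a) (hc : ∀ j < I.n, τ.arr 3 j = cen j) (ha : ∀ v < I.n, τ.arr 4 v = asg v) :
    ∃ S : Solution I, Outputs τ S ∧ S.IsFeasible ∧ S.radius ≤ 11 * R := by
  set S : Solution I := ⟨univ.filter fun v : Fin I.n => asg v ≠ 0, a,
    fun j => ⟨cen j, (h.center j j.2).1⟩, fun v => ⟨asg v.1 - 1, by
      have h1 := (mem_filter.1 v.2).2
      have := (h.client v.1 v.1.2 h1).2.1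
      omega⟩⟩ with hSdef
  have hmem : ∀ v, v ∈ S.served ↔ asg v ≠ 0 := fun v => by simp [hSdef]
  have hload : ∀ j : Fin a, S.load j = cnt (fun v => asg v = j + 1) I.n := by
    intro j
    rw [cnt_eq_card_fin, Solution.load, ← card_image_of_injective _ Subtype.val_injective]
    congr 1
    ext v
    simp only [mem_image, mem_filter, mem_univ, true_and, Subtype.exists, exists_and_right,
      exists_eq_right]
    constructor
    · rintro ⟨hv, rfl⟩
      have := (hmem v).1 hv
      change asg v = asg v - 1 + 1
      omega
    · intro hv
      refine ⟨(hmem v).2 (by omega), Fin.ext ?_⟩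
      change asg v - 1 = j
      omega
  refine ⟨S, ⟨h3, fun j => ?_, fun v => ?_⟩, ⟨fun v hv => ?_, ?_, fun j => ?_, fun j => ?_,
    fun j => ?_⟩, Finset.sup_le fun v _ => ?_⟩
  · exact hc j (lt_of_lt_of_le j.2 h.le)
  · rw [ha v v.2]
    split_ifs with hv
    · have := (hmem v).1 hv
      change asg v = asg v - 1 + 1
      omega
    · by_contra h0
      exact hv ((hmem v).2 h0)
  · have := (h.client v v.2 ((hmem v).1 hv)).1
    simpa [Instance.input] using this
  · rwa [cnt_eq_card_fin] at hp
  · have := (h.center j j.2).2.1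
    simpa [Instance.input, (h.center j j.2).1] using this
  · rw [hload]
    exact hL.trans (h.center j j.2).2.2.1
  · obtain ⟨h1, h2, -, h4⟩ := h.center j j.2
    rw [hload]
    refine h4.trans (le_of_eq ?_)
    have h5 : (⟨cen j, h1⟩ : Fin I.n) ∈ I.facilities := by simpa [Instance.input, h1] using h2
    simp [Instance.input, h1, h5]
    rfl
  · rw [← I.table_val]
    exact (h.client v.1 v.1.2 ((hmem v.1).1 v.2)).2.2

/-! ### Third stage: the clusters of a pair of points -/

namespace Term

/-- Layout of the third stage: array `24` holds the first cluster number of each node, `25` the rank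
of a client at its final node, `28` the cluster number plus one (`0` if unserved), and `29` the
centers. -/
def baseT : Term := sumIf 45 (lt (.var 45) (.var 20)) (.get 15 (.var 45))
def posT : Term := count 45 (and (lt (.var 45) (.var 20))
  (eq (.get 23 (.var 45)) (.get 23 (.var 20))))
def copiesT : Term := .get 15 (.get 23 (.var 20))
def clusterT : Term := .ite (lt (.get 23 (.var 20)) (.var 0))
  (.add (.add (.get 24 (.get 23 (.var 20)))
    (.sub (.get 25 (.var 20)) (mul 50 (div 46 50 (.get 25 (.var 20)) copiesT) copiesT)))
    (.const 1)) (.const 0)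
def centerT : Term := .get 7 (.get 10 (.find 45 (and (.le (.get 24 (.var 45)) (.var 20))
  (lt (.var 20) (.add (.get 24 (.var 45)) (.get 15 (.var 45)))))))

end Term

namespace Cmd

/-- Computation of the clusters. -/
def clusterCmd : Cmd := .seq (fill 24 Term.baseT) <| .seq (fill 25 Term.posT) <|
  .seq (fill 28 Term.clusterT) (fill 29 Term.centerT)

/-- Computation of a solution for the distance of the points in registers `5` and `6`. -/
def planCmd : Cmd := .seq coverCmd <| .seq primCmd <| .seq flowCmd <| .seq targetCmd clusterCmd

end Cmd

section Stage

variable {I : Instance} {L : ℕ} {R : ℝ≥0} {σ ρ : State}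

theorem run_cluster (h : I.Holds L R σ)
    (hpos : ∀ v < I.n, σ.arr 23 v < I.n → 0 < σ.arr 15 (σ.arr 23 v)) :
    let τ := Cmd.clusterCmd.run I.table σ
    (∀ v < I.n, τ.arr 28 v = if σ.arr 23 v < I.n then ∑ j ∈ range (σ.arr 23 v), σ.arr 15 j +
      cnt (fun u => σ.arr 23 u = σ.arr 23 v) v % σ.arr 15 (σ.arr 23 v) + 1 else 0) ∧
    ∀ j < I.n, τ.arr 29 j = σ.arr 7 (σ.arr 10 (first (fun k => ∑ i ∈ range k, σ.arr 15 i ≤ j ∧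
      j < ∑ i ∈ range k, σ.arr 15 i + σ.arr 15 k) I.n)) := by
  intro τ
  obtain ⟨σ₁, e₁⟩ : ∃ s, s = (Cmd.fill 24 Term.baseT).run I.table σ := ⟨_, rfl⟩
  obtain ⟨σ₂, e₂⟩ : ∃ s, s = (Cmd.fill 25 Term.posT).run I.table σ₁ := ⟨_, rfl⟩
  obtain ⟨σ₃, e₃⟩ : ∃ s, s = (Cmd.fill 28 Term.clusterT).run I.table σ₂ := ⟨_, rfl⟩
  obtain ⟨σ₄, e₄⟩ : ∃ s, s = (Cmd.fill 29 Term.centerT).run I.table σ₃ := ⟨_, rfl⟩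
  have hτ : τ = σ₄ := by rw [e₄, e₃, e₂, e₁]; rfl
  have H₁ : I.Holds L R σ₁ := e₁ ▸ h.run rfl rfl
  have H₂ : I.Holds L R σ₂ := e₂ ▸ H₁.run rfl rfl
  have H₃ : I.Holds L R σ₃ := e₃ ▸ H₂.run rfl rfl
  obtain ⟨-, a₁, g₁⟩ := Cmd.run_fill (D := I.table) 24 Term.baseT σ
  obtain ⟨-, a₂, g₂⟩ := Cmd.run_fill (D := I.table) 25 Term.posT σ₁
  obtain ⟨-, a₃, g₃⟩ := Cmd.run_fill (D := I.table) 28 Term.clusterT σ₂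
  obtain ⟨-, a₄, g₄⟩ := Cmd.run_fill (D := I.table) 29 Term.centerT σ₃
  rw [← e₁, h.n_eq] at g₁
  rw [← e₂, H₁.n_eq] at g₂
  rw [← e₃, H₂.n_eq] at g₃
  rw [← e₄, H₃.n_eq] at g₄
  rw [← e₁] at a₁
  rw [← e₂] at a₂
  rw [← e₃] at a₃
  rw [← e₄] at a₄
  clear e₁ e₂ e₃ e₄
  have hbase : ∀ k < I.n, σ₁.arr 24 k = ∑ j ∈ range k, σ.arr 15 j := by
    intro k hk
    obtain ⟨ρ, hρ, he⟩ := g₁ k hk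
    have hh := h.fill (by omega) hρ
    have := sum_range_and_lt hk.le (fun _ => True) (σ.arr 15)
    simp only [and_true, if_true] at this
    rw [he, ← this]
    simp [Term.baseT, hρ.idx, hh.n_eq, hρ.arr 15]
  have hrank : ∀ v < I.n, σ₂.arr 25 v = cnt (fun u => σ.arr 23 u = σ.arr 23 v) v := by
    intro v hv
    obtain ⟨ρ, hρ, he⟩ := g₂ v hv
    have hh := H₁.fill (by omega) hρ
    rw [he, ← cnt_and_lt hv.le]
    simp [Term.posT, hρ.idx, hh.n_eq, hρ.arr 23, a₁]
  rw [hτ]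
  refine ⟨fun v hv => ?_, fun j hj => ?_⟩
  · obtain ⟨ρ, hρ, he⟩ := g₃ v hv
    have hh := H₂.fill (by omega) hρ
    have hc : Term.copiesT.eval I.table ρ = σ.arr 15 (σ.arr 23 v) := by
      simp [Term.copiesT, hρ.idx, hρ.arr 15, hρ.arr 23, a₁, a₂]
    have hp : (Term.get 25 (.var 20)).eval I.table ρ =
        cnt (fun u => σ.arr 23 u = σ.arr 23 v) v := by
      rw [← hrank v hv]
      simp [hρ.idx, hρ.arr 25]
    rw [a₄ 28 (by decide), he, Term.clusterT, Term.eval_ite]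
    simp only [Term.tr_lt, Term.eval_get, Term.eval_var, hρ.idx, hh.n_eq, hρ.arr 23 (by decide),
      a₂ 23 (by decide), a₁ 23 (by decide)]
    split_ifs with htv
    · have hple : cnt (fun u => σ.arr 23 u = σ.arr 23 v) v ≤ I.n := cnt_le.trans hv.le
      have hdiv : (Term.div 46 50 (.get 25 (.var 20)) Term.copiesT).eval I.table ρ =
          cnt (fun u => σ.arr 23 u = σ.arr 23 v) v / σ.arr 15 (σ.arr 23 v) := by
        rw [Term.eval_div (by decide) (by decide), hc, hp]
        · simp
        · simp [Term.copiesT]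
        · simp [Term.copiesT]
        · rw [hc, hp, hh.n_eq]
          exact hple.trans (Nat.le_mul_of_pos_right _ (hpos v hv htv))
        · rw [hc]
          exact hpos v hv htv
      rw [Term.eval_add, Term.eval_add, Term.eval_sub, Term.eval_mul, hdiv, hc, hp,
        Nat.mod_eq_sub_div_mul]
      · simp [hρ.idx, hρ.arr 23, hρ.arr 24, a₁, a₂, hbase _ htv]
      · simp [Term.div, Term.copiesT, Term.mul]
      · simp [Term.copiesT]
      · rw [hdiv, hh.n_eq]
        exact (Nat.div_le_self _ _).trans hple
    · rfl
  · obtain ⟨ρ, hρ, he⟩ := g₄ j hj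
    have hh := H₃.fill (by omega) hρ
    have hfirst : first (fun k => σ₁.arr 24 k ≤ j ∧ j < σ₁.arr 24 k + σ.arr 15 k) I.n =
        first (fun k => ∑ i ∈ range k, σ.arr 15 i ≤ j ∧
          j < ∑ i ∈ range k, σ.arr 15 i + σ.arr 15 k) I.n :=
      first_congr fun k hk => by rw [hbase k hk]
    rw [he, ← hfirst]
    simp [Term.centerT, hρ.idx, hh.n_eq, hρ.arr 7, hρ.arr 10, hρ.arr 15, hρ.arr 24, a₁, a₂, a₃]

theorem run_plan (h : I.Holds L R σ) (hL : L = max I.L 1) :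
    let τ := Cmd.planCmd.run I.table σ
    IsPlan I L R (∑ k ∈ range I.n, τ.arr 15 k) (τ.arr 29) (τ.arr 28) ∧
    ∀ S : Solution I, S.IsFeasible → S.radius ≤ R →
      #S.served ≤ cnt (fun v => τ.arr 28 v ≠ 0) I.n := by
  intro τ
  have hL0 : 0 < L := hL ▸ lt_max_of_lt_right one_pos
  obtain ⟨σ₁, e₁⟩ : ∃ s, s = Cmd.coverCmd.run I.table σ := ⟨_, rfl⟩
  obtain ⟨σ₂, e₂⟩ : ∃ s, s = Cmd.primCmd.run I.table σ₁ := ⟨_, rfl⟩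
  obtain ⟨σ₃, e₃⟩ : ∃ s, s = Cmd.flowCmd.run I.table σ₂ := ⟨_, rfl⟩
  obtain ⟨σ₄, e₄⟩ : ∃ s, s = Cmd.targetCmd.run I.table σ₃ := ⟨_, rfl⟩
  obtain ⟨σ₅, e₅⟩ : ∃ s, s = Cmd.clusterCmd.run I.table σ₄ := ⟨_, rfl⟩
  have hτ : τ = σ₅ := by rw [e₅, e₄, e₃, e₂, e₁]; rfl
  have H₁ : I.Holds L R σ₁ := e₁ ▸ h.run rfl rfl
  have H₂ : I.Holds L R σ₂ := e₂ ▸ H₁.run rfl rfl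
  have H₃ : I.Holds L R σ₃ := e₃ ▸ H₂.run rfl rfl
  have H₄ : I.Holds L R σ₄ := e₄ ▸ H₃.run rfl rfl
  have C := run_cover h
  obtain ⟨P, hb, hcap⟩ := run_prim H₁
  rw [← e₁] at C
  rw [← e₂] at P hb hcap
  have hF := (isForest hL0 C P hb).congr_cap hcap
  have F := run_flow H₂ hL0 (core := fun v => I.Near R v (σ₂.arr 10 (σ₂.arr 12 v)))
    hF.prim.par_lt hF.node
  have T := run_target H₃
  rw [← e₃] at F
  rw [← e₄] at T
  have k7 : σ₄.arr 7 = σ₁.arr 7 := by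
    rw [e₄, Cmd.run_arr rfl, e₃, Cmd.run_arr rfl, e₂, Cmd.run_arr rfl]
  have k10 : σ₃.arr 10 = σ₂.arr 10 := by rw [e₃, Cmd.run_arr rfl]
  have k11 : σ₃.arr 11 = σ₂.arr 11 := by rw [e₃, Cmd.run_arr rfl]
  have k12 : σ₃.arr 12 = σ₂.arr 12 := by rw [e₃, Cmd.run_arr rfl]
  have k10' : σ₄.arr 10 = σ₂.arr 10 := by rw [e₄, Cmd.run_arr rfl, k10]
  have k15 : σ₄.arr 15 = σ₃.arr 15 := by rw [e₄, Cmd.run_arr rfl]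
  have k15' : σ₅.arr 15 = σ₃.arr 15 := by rw [e₅, Cmd.run_arr rfl, k15]
  rw [k10, k11, k12] at T
  obtain ⟨ht, ht'⟩ := T
  have hd := isDest_destFun I.n (σ₂.arr 11) (σ₃.arr 14) (σ₃.arr 20)
  have hcnt : ∀ k < I.n, cnt (fun v => σ₄.arr 23 v = k) I.n = L * σ₃.arr 15 k + σ₃.arr 19 k :=
    fun k hk => F.cnt_target hd ht ht' hk
  -- A node without clusters ends with no clients, so the division by the number of clusters is
  -- never by zero.
  have hpos : ∀ v < I.n, σ₄.arr 23 v < I.n → 0 < σ₄.arr 15 (σ₄.arr 23 v) := by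
    intro v hv hlt
    rw [k15]
    by_contra! h0
    have h1 := F.served_le hlt
    rw [← hcnt _ hlt, Nat.le_zero.1 h0, zero_mul] at h1
    exact absurd (cnt_pos (p := fun u => σ₄.arr 23 u = σ₄.arr 23 v) hv rfl) (by omega)
  have O := run_cluster H₄ hpos
  rw [← e₅, k15, k7, k10'] at O
  obtain ⟨hasg, hcen⟩ := O
  rw [hτ, k15']
  refine ⟨isPlan hF F hd ht ht' hasg hcen, fun S hS hR => ?_⟩
  refine (card_served_le hF hL F S hS hR).trans (le_of_eq ?_)
  rw [← sum_congr rfl fun k hk => hcnt k (mem_range.1 hk), ← cnt_fiber_lt]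
  refine cnt_congr fun v hv => ?_
  rw [hasg v hv]
  split_ifs with h1 <;> simp [h1]

end Stage

/-! ### The algorithm -/

namespace Term

/-- The current clusters serve enough clients, and no smaller distance has been found before. -/
def improvesT : Term := and (.le (.var 2) (count 45 (.get 28 (.var 45))))
  (or (not (.var 7)) (.distLe (.var 5) (.var 6) (.var 8) (.var 9)))

end Term

namespace Cmd

/-- Record the current clusters as output. -/
def recordCmd : Cmd := .seq (.assign 7 (.const 1)) <| .seq (.assign 8 (.var 5)) <|
  .seq (.assign 9 (.var 6)) <| .seq (.assign 3 (.sum 45 (.get 15 (.var 45)))) <|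
  .seq (fill 3 (.get 29 (.var 20))) (fill 4 (.get 28 (.var 20)))

/-- Treatment of one pair of points. -/
def stepCmd : Cmd := .seq planCmd (.cond Term.improvesT recordCmd .skip)

/-- The approximation algorithm. -/
def supplierCmd : Cmd := .seq
  (.assign 4 (.ite (.le (.const 1) (.var 1)) (.var 1) (.const 1)))
  (.cond (.var 2) (.loop 5 (.loop 6 stepCmd)) .skip)

end Cmd

/-! ### Search over all guesses of the radius -/

/-- The state during the search over all pairs of points, where the pairs in `Q` have been treated:
register `7` tells whether a solution is recorded, and registers `8` and `9` hold a pair whose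
distance bounds its radius. -/
structure Searching (I : Instance) (Q : ℕ → ℕ → Prop) (σ : State) : Prop where
  n_eq : σ.var 0 = I.n
  p_eq : σ.var 2 = I.p
  L_eq : σ.var 4 = max I.L 1
  clients : σ.arr 0 = I.input.arr 0
  facilities : σ.arr 1 = I.input.arr 1
  bounds : σ.arr 2 = I.input.arr 2
  sound : σ.var 7 ≠ 0 → ∃ S : Solution I, Outputs σ S ∧ S.IsFeasible ∧
    S.radius ≤ 11 * I.table (σ.var 8) (σ.var 9)
  complete : ∀ i j, Q i j → ∀ S : Solution I, S.IsFeasible → S.radius ≤ I.table i j →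
    σ.var 7 ≠ 0 ∧ I.table (σ.var 8) (σ.var 9) ≤ I.table i j

theorem Outputs.congr {I : Instance} {σ τ : State} {S : Solution I} (h : Outputs σ S)
    (hv : τ.var 3 = σ.var 3) (h3 : τ.arr 3 = σ.arr 3) (h4 : τ.arr 4 = σ.arr 4) : Outputs τ S := by
  unfold Outputs
  rw [hv, h3, h4]
  exact h

namespace Searching

variable {I : Instance} {Q Q' : ℕ → ℕ → Prop} {σ τ : State}

theorem congr (h : Searching I Q σ) (hQ : ∀ i j, Q' i j → Q i j)
    (hv : ∀ y, y ≠ 5 → y ≠ 6 → y < 10 → τ.var y = σ.var y) (ha : ∀ a < 5, τ.arr a = σ.arr a) :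
    Searching I Q' τ := by
  refine ⟨by rw [hv _ (by omega) (by omega) (by omega), h.n_eq],
    by rw [hv _ (by omega) (by omega) (by omega), h.p_eq],
    by rw [hv _ (by omega) (by omega) (by omega), h.L_eq],
    by rw [ha _ (by omega), h.clients], by rw [ha _ (by omega), h.facilities],
    by rw [ha _ (by omega), h.bounds], fun h7 => ?_, fun i j hq S hS hR => ?_⟩
  · rw [hv _ (by omega) (by omega) (by omega)] at h7
    rw [hv 8 (by omega) (by omega) (by omega), hv 9 (by omega) (by omega) (by omega)]
    obtain ⟨S, hO, hS⟩ := h.sound h7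
    exact ⟨S, hO.congr (hv _ (by omega) (by omega) (by omega)) (ha _ (by omega))
      (ha _ (by omega)), hS⟩
  · rw [hv 8 (by omega) (by omega) (by omega), hv 9 (by omega) (by omega) (by omega),
      hv 7 (by omega) (by omega) (by omega)]
    exact h.complete i j (hQ i j hq) S hS hR

/-- If a solution of radius at most the current distance exists, `run_plan` serves at least `p`
clients. So a failed test can only mean that a pair of smaller distance is already recorded. -/
theorem step (h : Searching I Q σ) :
    Searching I (fun i j => Q i j ∨ (i = σ.var 5 ∧ j = σ.var 6))
      (Cmd.stepCmd.run I.table σ) := by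
  have H : I.Holds (max I.L 1) (I.table (σ.var 5) (σ.var 6)) σ :=
    ⟨h.n_eq, h.L_eq, rfl, h.clients, h.facilities, h.bounds⟩
  obtain ⟨σ₁, e₁⟩ : ∃ s, s = Cmd.planCmd.run I.table σ := ⟨_, rfl⟩
  have hplan := run_plan H rfl
  have hv : ∀ y < 10, σ₁.var y = σ.var y := by
    intro y hy
    rw [e₁]
    interval_cases y <;> exact Cmd.run_var rfl σ
  have ha : ∀ a < 5, σ₁.arr a = σ.arr a := by
    intro a ha
    rw [e₁]
    interval_cases a <;> exact Cmd.run_arr rfl σ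
  have h₁ : Searching I Q σ₁ := h.congr (fun _ _ => id) (fun y _ _ => hv y) ha
  have hstep : Cmd.stepCmd.run I.table σ =
      (Cmd.cond Term.improvesT Cmd.recordCmd .skip).run I.table σ₁ := by rw [e₁]; rfl
  rw [← e₁] at hplan
  rw [hstep, ← hv 5 (by omega), ← hv 6 (by omega)]
  rw [← hv 5 (by omega), ← hv 6 (by omega)] at hplan
  clear hstep e₁ H hv ha h
  obtain ⟨hP, hmax⟩ := hplan
  have himp : Term.improvesT.tr I.table σ₁ ↔ I.p ≤ cnt (fun v => σ₁.arr 28 v ≠ 0) I.n ∧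
      (σ₁.var 7 = 0 ∨ I.table (σ₁.var 5) (σ₁.var 6) ≤ I.table (σ₁.var 8) (σ₁.var 9)) := by
    rw [Term.improvesT]
    simp [h₁.n_eq, h₁.p_eq]
  rw [Cmd.run]
  split_ifs with hc
  · obtain ⟨hp, hless⟩ := himp.1 hc
    obtain ⟨τ, hτ⟩ : ∃ s, s = Cmd.recordCmd.run I.table σ₁ := ⟨_, rfl⟩
    rw [← hτ]
    set τ₀ := ((((σ₁.set 7 1).set 8 (σ₁.var 5)).set 9 (σ₁.var 6)).set 3
      (∑ k ∈ range I.n, σ₁.arr 15 k)) with hτ₀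
    have hrec : Cmd.recordCmd.run I.table σ₁ =
        (Cmd.fill 4 (.get 28 (.var 20))).run I.table
          ((Cmd.fill 3 (.get 29 (.var 20))).run I.table τ₀) := by
      rw [hτ₀]
      simp [Cmd.recordCmd, Cmd.run, h₁.n_eq]
    rw [hrec] at hτ
    obtain ⟨τ₁, e₁⟩ : ∃ s, s = (Cmd.fill 3 (.get 29 (.var 20))).run I.table τ₀ := ⟨_, rfl⟩
    obtain ⟨v₁, a₁, g₁⟩ := Cmd.run_fill (D := I.table) 3 (.get 29 (.var 20)) τ₀
    obtain ⟨v₂, a₂, g₂⟩ := Cmd.run_fill (D := I.table) 4 (.get 28 (.var 20)) τ₁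
    rw [← e₁] at hτ v₁ a₁ g₁
    rw [← hτ] at v₂ a₂ g₂
    have hn₀ : τ₀.var 0 = I.n := by simp [hτ₀, h₁.n_eq]
    rw [hn₀] at g₁
    rw [v₁ 0 (by decide), hn₀] at g₂
    have hvar : ∀ y, y ≠ 20 → τ.var y = τ₀.var y := fun y hy => by rw [v₂ y hy, v₁ y hy]
    have harr : ∀ b, b ≠ 3 → b ≠ 4 → τ.arr b = σ₁.arr b := fun b h3 h4 => by
      rw [a₂ b h4, a₁ b h3]
      rfl
    have hcen : ∀ j < I.n, τ.arr 3 j = σ₁.arr 29 j := by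
      intro j hj
      obtain ⟨ρ, hρ, he⟩ := g₁ j hj
      rw [a₂ 3 (by decide), he]
      simp [hρ.idx, hρ.arr 29, hτ₀]
    have hasg : ∀ v < I.n, τ.arr 4 v = σ₁.arr 28 v := by
      intro v hv
      obtain ⟨ρ, hρ, he⟩ := g₂ v hv
      rw [he]
      simp [hρ.idx, hρ.arr 28, a₁, hτ₀]
    have h7 : τ.var 7 = 1 := by rw [hvar 7 (by decide)]; simp [hτ₀]
    have h8 : τ.var 8 = σ₁.var 5 := by rw [hvar 8 (by decide)]; simp [hτ₀]
    have h9 : τ.var 9 = σ₁.var 6 := by rw [hvar 9 (by decide)]; simp [hτ₀]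
    refine ⟨?_, ?_, ?_, ?_, ?_, ?_, fun _ => ?_, fun i j hq S hS hR => ?_⟩
    · rw [hvar 0 (by decide), hn₀]
    · rw [hvar 2 (by decide), ← h₁.p_eq]
      simp [hτ₀]
    · rw [hvar 4 (by decide), ← h₁.L_eq]
      simp [hτ₀]
    · rw [harr 0 (by decide) (by decide), h₁.clients]
    · rw [harr 1 (by decide) (by decide), h₁.facilities]
    · rw [harr 2 (by decide) (by decide), h₁.bounds]
    · rw [h8, h9]
      exact hP.exists_solution (le_max_left _ _) hp
        (by rw [hvar 3 (by decide)]; simp [hτ₀]) hcen hasg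
    · rw [h7, h8, h9]
      refine ⟨one_ne_zero, ?_⟩
      rcases hq with hq | ⟨rfl, rfl⟩
      · obtain ⟨h, h'⟩ := h₁.complete i j hq S hS hR
        rcases hless with h0 | hless
        · exact absurd h0 h
        · exact hless.trans h'
      · exact le_rfl
  · have hn := fun h' => hc (himp.2 h')
    refine ⟨h₁.n_eq, h₁.p_eq, h₁.L_eq, h₁.clients, h₁.facilities, h₁.bounds, h₁.sound,
      fun i j hq S hS hR => ?_⟩
    rcases hq with hq | ⟨rfl, rfl⟩
    · exact h₁.complete i j hq S hS hR
    · by_contra hcon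
      refine hn ⟨hS.p_le.trans (hmax S hS hR), ?_⟩
      by_cases h7 : σ₁.var 7 = 0
      · exact .inl h7
      · exact .inr (le_of_not_ge fun hle => hcon ⟨h7, hle⟩)

theorem loop (h : Searching I (fun _ _ => False) σ) :
    Searching I (fun i j => i < I.n ∧ j < I.n)
      ((Cmd.loop 5 (.loop 6 Cmd.stepCmd)).run I.table σ) := by
  have hmain := iter_invariant (n := I.n) (s := σ)
    (f := fun i s' => (Cmd.loop 6 Cmd.stepCmd).run I.table (s'.set 5 i))
    (fun m s => Searching I (fun i j => i < m ∧ j < I.n) s)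
    (h.congr (by simp) (fun _ _ _ _ => rfl) fun _ _ => rfl) ?_
  · rw [Cmd.run, h.n_eq]
    exact hmain
  · intro i hi s hs
    -- The treated pairs are the complete rows before `i` and an initial part of row `i`, empty at
    -- this point.
    have hs' : Searching I (fun a b => (a < i ∧ b < I.n) ∨ (a = i ∧ b < 0)) (s.set 5 i) :=
      hs.congr (by simp) (fun y h5 _ _ => by simp [h5]) fun _ _ => rfl
    have hin := iter_invariant (n := I.n) (s := s.set 5 i)
      (f := fun j s' => Cmd.stepCmd.run I.table (s'.set 6 j))
      (fun m s => Searching I (fun a b => (a < i ∧ b < I.n) ∨ (a = i ∧ b < m)) s ∧ s.var 5 = i)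
      ⟨hs', by simp⟩ ?_
    · rw [Cmd.run, hs'.n_eq]
      refine hin.1.congr (fun a b hab => ?_) (fun _ _ _ _ => rfl) fun _ _ => rfl
      omega
    · rintro j hj τ ⟨hτ, h5⟩
      have hτ' : Searching I (fun a b => (a < i ∧ b < I.n) ∨ (a = i ∧ b < j)) (τ.set 6 j) :=
        hτ.congr (fun _ _ => id) (fun y _ h6 _ => by simp [h6]) fun _ _ => rfl
      refine ⟨hτ'.step.congr (fun a b hab => ?_) (fun _ _ _ _ => rfl) fun _ _ => rfl, ?_⟩
      · simp only [State.set_var, h5, if_true, show (5 : ℕ) ≠ 6 by decide, if_false]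
        omega
      · rw [Cmd.run_var rfl]
        simpa using h5

end Searching

theorem exists_radius_eq {I : Instance} {S : Solution I} (h : S.served.Nonempty) :
    ∃ i < I.n, ∃ j < I.n, S.radius = I.table i j := by
  obtain ⟨v, hv⟩ := h
  obtain ⟨w, -, hw⟩ := exists_mem_eq_sup (univ : Finset {v // v ∈ S.served}) ⟨⟨v, hv⟩, mem_univ _⟩
    fun v => I.d v (S.center (S.assign v))
  exact ⟨w.1, w.1.2, S.center (S.assign w), (S.center (S.assign w)).2, by
    rw [I.table_val]; exact hw⟩

/-- For `p ≠ 0` every feasible radius occurs among the guesses, so the recorded distance is at most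
each of them, hence at most the optimum. -/
theorem run_supplier (I : Instance) (hI : I.Solvable) :
    ∃ S : Solution I, Outputs (Cmd.supplierCmd.run I.table I.input) S ∧ S.IsFeasible ∧
      S.radius ≤ 11 * I.opt := by
  set σ := I.input.set 4 (max I.L 1) with hσ
  have hrun : Cmd.supplierCmd.run I.table I.input =
      (Cmd.cond (.var 2) (.loop 5 (.loop 6 Cmd.stepCmd)) .skip).run I.table σ := by
    rw [hσ, Cmd.supplierCmd, Cmd.run, Cmd.run]
    congr 2
    simp only [Term.eval_ite, Term.tr_le, Term.eval_const, Term.eval_var]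
    change (if 1 ≤ I.L then I.L else 1) = max I.L 1
    split_ifs <;> omega
  rw [hrun, Cmd.run]
  have hp2 : (Term.var 2).eval I.table σ = I.p := by
    simp [hσ]
    rfl
  rw [hp2]
  split_ifs with hp
  · have hsearch : Searching I (fun _ _ => False) σ :=
      ⟨rfl, rfl, rfl, rfl, rfl, rfl, fun h => absurd rfl h, fun _ _ h => h.elim⟩
    have hfin := hsearch.loop
    generalize (Cmd.loop 5 (.loop 6 Cmd.stepCmd)).run I.table σ = τ at hfin ⊢
    have key : ∀ S : Solution I, S.IsFeasible →
        τ.var 7 ≠ 0 ∧ I.table (τ.var 8) (τ.var 9) ≤ S.radius := by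
      intro S hS
      obtain ⟨i, hi, j, hj, hij⟩ := exists_radius_eq (S := S)
        (card_pos.1 ((Nat.pos_of_ne_zero hp).trans_le hS.p_le))
      rw [hij]
      exact hfin.complete i j ⟨hi, hj⟩ S hS hij.le
    obtain ⟨S₀, hS₀⟩ := hI
    obtain ⟨S, hO, hS, hR⟩ := hfin.sound (key S₀ hS₀).1
    refine ⟨S, hO, hS, hR.trans (mul_le_mul_right ?_ 11)⟩
    refine le_csInf ⟨_, S₀, hS₀, rfl⟩ ?_
    rintro _ ⟨S', hS', rfl⟩
    exact (key S' hS').2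
  -- For `p = 0` nothing is computed: register `3` and array `4` are still zero, which encodes the
  -- empty solution.
  · refine ⟨⟨∅, 0, Fin.elim0, fun v => absurd v.2 (notMem_empty _)⟩, ⟨rfl, fun j => j.elim0, ?_⟩,
      ⟨by simp, by omega, fun j => j.elim0, fun j => j.elim0, fun j => j.elim0⟩, ?_⟩
    · intro v
      rw [dif_neg (notMem_empty _)]
      rfl
    · exact Finset.sup_le fun v _ => absurd v.2 (notMem_empty _)

theorem exists_polyTimeApproximation : ∃ c : Prog, IsPolyTimeApproximation 11 c := by
  have hok : Cmd.supplierCmd.ok := by decide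
  obtain ⟨P, hP⟩ := Cmd.exec hok
  refine ⟨Cmd.supplierCmd.compile 100, P, fun I => ?_⟩
  obtain ⟨t, s', hs, ht, harr, hvar⟩ := hP I.table I.input
  refine ⟨t, s', hs, ht, fun hI => ?_⟩
  obtain ⟨S, hO, hS⟩ := run_supplier I hI
  exact ⟨S, hO.congr (hvar 3 (by norm_num)) (by rw [harr]) (by rw [harr]), hS⟩

end SoftSupplier

/-- There is a polynomial-time 11-approximation algorithm for the supplier problem with uniform
lower bounds, non-uniform upper bounds, soft capacities, outliers, and any number of centers. -/
theorem mainTheorem4 :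
    ∃ c : SoftSupplier.Prog, SoftSupplier.IsPolyTimeApproximation 11 c := by
  exact SoftSupplier.exists_polyTimeApproximation
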